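/- **Setting.** Let $0<\alpha<\pi/2$ and let the root be the origin $r=0$ of the plane. For a point $p$ with polar coordinates $(R,\phi)$, the right spiral $\mathcal S^+_p$ is the curve $s\mapsto(Re^{-s},\,\phi+s\tan\alpha)$ and the left spiral $\mathcal S^-_p$ the curve $s\mapsto(Re^{-s},\,\phi-s\tan\alpha)$, $s\ge 0$. The spiral region $\mathcal R_p$ is the set of points reachable from $p$ by a path whose tangent always makes an angle at most $\alpha$ with the direction to $r$. A spiral subtree for a family of terminals is a rooted tree drawn in the plane whose nodes include the terminals, whose leaves are all terminals, and in which each node other than the root node is joined to its parent, at a different point, by an arc consisting of finitely many segments of right or left spirals, followed towards $r$ (a last segment may run along a whole spiral into $r$). It is a spiral tree if its root node lies at $r$; it is planar if distinct nodes are distinct points and arcs meet only at common end nodes. Its length is the total Euclidean length of its arcs; a spiral tree is optimal if its length is minimum among all spiral trees (planar or not) for the same terminals. Let $t_1,\dots,t_n\neq r$ ($n\ge1$) be terminals numbered in counterclockwise radial order around $r$ (starting anywhere), with $t_i\notin\mathcal R_{t_j}$ for all $i\neq j$. Indices are cyclic modulo $n$. Let $w_{ij}$ be the closed unbounded wedge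 swept counterclockwise from the ray $rt_i$ to the ray $rt_j$ (a single ray if $i=j$), and $D(p,q)=\sec(\alpha)\,\bigl|\,|p|-|q|\,\bigr|$. **Claim.** 1. For all $i,j$ there is a unique point $p_{ij}$ farthest from $r$ in $\mathcal S^+_{t_i}\cap\mathcal S^-_{t_j}$; it lies in $w_{ij}$, and $p_{ii}=t_i$. 2. In every planar spiral tree for $t_1,\dots,t_n$ every terminal is a leaf, and the (cyclic, counterclockwise) leaf order is the radial order $t_1,\dots,t_n$. The same holds for every optimal spiral tree. 3. The recurrence $F(i,i)=0$ and, for $i\ne j$, $$F(i,j)=\min_{k}\bigl(F(i,k)+F(k+1,j)+D(p_{ik},p_{ij})+D(p_{(k+1)j},p_{ij})\bigr),$$ with $k$ ranging over $i,i+1,\dots,j-1$ in cyclic order, has exactly one solution $F$, and for all $i,j$, $F(i,j)$ is the minimum length of a spiral subtree for the terminals $t_i,t_{i+1},\dots,t_j$ (cyclic order), with root node anywhere, that is contained in $w_{ij}$. Moreover the minimum length of a spiral tree for $t_1,\dots,t_n$ is $$\min_{1\le i\le n}\bigl(F(i,i-1)+D(p_{i(i-1)},r)\bigr).$$ 4.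 There are a constant $C$ and a single real-RAM program (exact unit-cost real arithmetic, comparisons, $\sqrt{\cdot}$, $\exp$, $\log$, $\sin$, $\cos$ and polar angle of a point, and unit-cost index arithmetic and array access) that, for all $n,\alpha,t_1,\dots,t_n$ as above, given $n$, $\alpha$ and the Cartesian coordinates of the terminals in this order, halts after at most $Cn^3$ steps and outputs an optimal spiral tree (nodes with coordinates, parents, the nodes of the terminals, and the left/right kind of the single spiral segment that forms each arc) together with its length. -/

import Mathlib

open scoped Topology ENNReal

noncomputable section

namespace SpiralTrees

/-! ### Spirals and spiral regions. The plane is `ℂ` and the root `r` is `0`. -/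

/-- The right spiral through `p`: in polar coordinates, for `p = (R, φ)`, the curve
`s ↦ (R * e ^ (-s), φ + tan α * s)`. -/
def rightSpiral (α : ℝ) (p : ℂ) (s : ℝ) : ℂ :=
  p * (Real.exp (-s) : ℂ) * Complex.exp ((Real.tan α * s : ℝ) * Complex.I)

/-- The left spiral: the right spiral with `α` replaced by `-α`. -/
def leftSpiral (α : ℝ) (p : ℂ) (s : ℝ) : ℂ := rightSpiral (-α) p s

/-- The spiral through `p` of a given kind: `true` is left, `false` is right. -/
def spiral (α : ℝ) (left : Bool) (p : ℂ) (s : ℝ) : ℂ :=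
  if left then leftSpiral α p s else rightSpiral α p s

/-- A path `γ : [0,1] → ℂ` (continuous, differentiable up to finitely many exceptions) is
angle-restricted if at each of its points the angle between the tangent vector and the vector
towards the root is at most `α` (whenever these two vectors are nonzero). -/
def IsAngleRestricted (α : ℝ) (γ : ℝ → ℂ) : Prop :=
  ContinuousOn γ (Set.Icc 0 1) ∧
    ∃ S : Set ℝ, S.Finite ∧ ∀ s ∈ Set.Ioo (0 : ℝ) 1 \ S, ∃ v : ℂ, HasDerivAt γ v s ∧
      (v = 0 ∨ γ s = 0 ∨ InnerProductGeometry.angle v (-(γ s)) ≤ α)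

/-- The spiral region of `p`: all points reachable from `p` by an angle-restricted path. -/
def spiralRegion (α : ℝ) (p : ℂ) : Set ℂ :=
  {q | ∃ γ : ℝ → ℂ, IsAngleRestricted α γ ∧ γ 0 = p ∧ γ 1 = q}

/-- The length of a shortest spiral path between `p` and a point `q` reachable from it. -/
def spiralDist (α : ℝ) (p q : ℂ) : ℝ := (Real.cos α)⁻¹ * |‖p‖ - ‖q‖|

/-! ### Angles, wedges, instances -/

/-- The counterclockwise angle in `[0, 2π)` from the ray through `x` to the ray through `y`. -/
def ccwAngle (x y : ℂ) : ℝ := toIcoMod Real.two_pi_pos 0 (y.arg - x.arg)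

/-- The directions `x`, `y`, `z` are pairwise distinct and in counterclockwise cyclic order. -/
def Ccw (x y z : ℂ) : Prop := 0 < ccwAngle x y ∧ ccwAngle x y < ccwAngle x z

/-- The closed unbounded wedge swept counterclockwise from the ray through `a` to the ray
through `b`. -/
def wedge (a b : ℂ) : Set ℂ := {z | z = 0 ∨ ccwAngle a z ≤ ccwAngle a b}

/-- An input with empty spiral regions: `0 < α < π/2`, the terminals differ from the root, they
are numbered in counterclockwise radial order (the first one being arbitrary), and no terminal
lies in the spiral region of another one. -/
structure IsInstance {n : ℕ} [NeZero n] (α : ℝ) (t : Fin n → ℂ) : Prop where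
  alpha_pos : 0 < α
  alpha_lt : α < Real.pi / 2
  ne_root : ∀ i, t i ≠ 0
  radial : Monotone fun i => ccwAngle (t 0) (t i)
  empty : ∀ i j, i ≠ j → t i ∉ spiralRegion α (t j)

/-! ### Arcs: finite sequences of spiral segments

A segment `(left, τ)` follows a spiral for the parameters `0 ≤ s ≤ τ`; with `τ = ∞` it runs into
the root. -/

/-- The end point of the segment of duration `τ` that starts at `p`. -/
def segEnd (α : ℝ) (left : Bool) (p : ℂ) (τ : ℝ≥0∞) : ℂ :=
  if τ = ⊤ then 0 else spiral α left p τ.toReal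

/-- The end point of an arc that starts at `p`. -/
def arcEnd (α : ℝ) : ℂ → List (Bool × ℝ≥0∞) → ℂ
  | p, [] => p
  | p, (d, τ) :: l => arcEnd α (segEnd α d p τ) l

/-- The points of an arc that starts at `p`, without its end point. -/
def arcTrace (α : ℝ) : ℂ → List (Bool × ℝ≥0∞) → Set ℂ
  | _, [] => ∅
  | p, (d, τ) :: l =>
      {z | ∃ s : ℝ, 0 ≤ s ∧ ENNReal.ofReal s < τ ∧ z = spiral α d p s} ∪
        arcTrace α (segEnd α d p τ) l

/-- The Euclidean length of an arc that starts at `p`: the sum over its segments of the integral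
of the speed. -/
def arcLength (α : ℝ) : ℂ → List (Bool × ℝ≥0∞) → ℝ
  | _, [] => 0
  | p, (d, τ) :: l =>
      (∫ s in {s : ℝ | 0 ≤ s ∧ ENNReal.ofReal s < τ}, ‖deriv (spiral α d p) s‖) +
        arcLength α (segEnd α d p τ) l

/-! ### Spiral trees -/

/-- A rooted tree, drawn in the plane with spiral arcs directed from each node to its parent,
that contains the terminals `t i` and whose leaves are all terminals. The root node may be
anywhere (this is a "spiral subtree"); nodes may have any degree and the drawing may have
crossings. -/
structure SpiralSubtree (α : ℝ) {ι : Type} (t : ι → ℂ) where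
  V : Type
  fintypeV : Fintype V
  root : V
  parent : V → V
  parent_root : parent root = root
  parent_iterate : ∀ v, ∃ k : ℕ, parent^[k] v = root
  pos : V → ℂ
  term : ι → V
  pos_term : ∀ i, pos (term i) = t i
  leaf_term : ∀ v, (∀ w, w ≠ root → parent w ≠ v) → ∃ i, term i = v
  /-- the arc from `v` to its parent (empty for the root) -/
  arc : V → List (Bool × ℝ≥0∞)
  arc_root : arc root = []
  arc_end : ∀ v, arcEnd α (pos v) (arc v) = pos (parent v)
  /-- arcs join distinct points -/
  arc_ne : ∀ v, v ≠ root → pos (parent v) ≠ pos v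
  /-- an arc can meet the origin only at its end -/
  arc_avoid : ∀ v, (0 : ℂ) ∉ arcTrace α (pos v) (arc v)

attribute [instance] SpiralSubtree.fintypeV

namespace SpiralSubtree

variable {α : ℝ} {ι : Type} {t : ι → ℂ}

/-- The points of the arc from `v` to its parent, without the end point at the parent. -/
def trace (T : SpiralSubtree α t) (v : T.V) : Set ℂ := arcTrace α (T.pos v) (T.arc v)

/-- All points of the tree. -/
def carrier (T : SpiralSubtree α t) : Set ℂ := Set.range T.pos ∪ ⋃ v, T.trace v

/-- The total length. -/
def length (T : SpiralSubtree α t) : ℝ := ∑ v, arcLength α (T.pos v) (T.arc v)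

/-- A spiral tree for the terminals: the root node is the root `r = 0`. -/
def IsSpiralTree (T : SpiralSubtree α t) : Prop := T.pos T.root = 0

/-- A spiral tree of minimum length among all spiral trees on the same terminals. -/
def IsOptimal (T : SpiralSubtree α t) : Prop :=
  T.IsSpiralTree ∧ ∀ T' : SpiralSubtree α t, T'.IsSpiralTree → T.length ≤ T'.length

/-- The drawing is planar: distinct nodes are distinct points and arcs meet only at common end
nodes. (Each half-open arc contains its start node, so this is disjointness of the half-open
arcs and the root.) -/
def IsPlanar (T : SpiralSubtree α t) : Prop :=
  (∀ v w, v ≠ w → Disjoint (T.trace v) (T.trace w)) ∧ ∀ v, T.pos T.root ∉ T.trace v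

/-- `u` lies on the path from `v` to the root (possibly `u = v`). -/
def IsAncestor (T : SpiralSubtree α t) (u v : T.V) : Prop := ∃ k : ℕ, T.parent^[k] v = u

/-- The arc from `e` to `parent e` is the first one on the path in the tree from `m` to `x`. -/
def FirstArc (T : SpiralSubtree α t) (m x e : T.V) : Prop :=
  (e ≠ T.root ∧ T.parent e = m ∧ T.IsAncestor e x) ∨
    (e = m ∧ m ≠ T.root ∧ ¬ T.IsAncestor m x)

/-- The leaf order, as a cyclic order: `i`, `j`, `k` are in counterclockwise order if, at the
node `m` where the three paths of the tree to these terminals separate, the first arcs of these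
paths leave `m` in counterclockwise order, i.e. meet all small circles around `m` in this
order. -/
def LeafCcw (T : SpiralSubtree α t) (i j k : ι) : Prop :=
  ∃ m a b c : T.V, T.FirstArc m (T.term i) a ∧ T.FirstArc m (T.term j) b ∧
    T.FirstArc m (T.term k) c ∧ a ≠ b ∧ b ≠ c ∧ a ≠ c ∧
    ∀ᶠ ε : ℝ in 𝓝[>] 0, ∀ x ∈ T.trace a, ∀ y ∈ T.trace b, ∀ z ∈ T.trace c,
      ‖x - T.pos m‖ = ε → ‖y - T.pos m‖ = ε → ‖z - T.pos m‖ = ε →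
        Ccw (x - T.pos m) (y - T.pos m) (z - T.pos m)

/-- Every terminal is a leaf. -/
def TerminalsAreLeaves (T : SpiralSubtree α t) : Prop :=
  ∀ i w, w ≠ T.root → T.parent w ≠ T.term i

/-- The leaf order follows the numbering of the terminals, as cyclic orders. -/
def LeafOrderFollows {n : ℕ} {t : Fin n → ℂ} (T : SpiralSubtree α t) : Prop :=
  ∀ i j k : Fin n, (i < j ∧ j < k) ∨ (j < k ∧ k < i) ∨ (k < i ∧ i < j) → T.LeafCcw i j k

end SpiralSubtree

/-! ### The recurrence -/

/-- `x` is the first intersection of the right spiral from `p` and the left spiral from `q`,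
both followed towards the root: the common point that is farthest from the root. -/
def IsSpiralIntersection (α : ℝ) (p q x : ℂ) : Prop :=
  IsGreatest {r | ∃ y ∈ rightSpiral α p '' Set.Ici 0 ∩ leftSpiral α q '' Set.Ici 0, ‖y‖ = r} ‖x‖ ∧
    x ∈ rightSpiral α p '' Set.Ici 0 ∩ leftSpiral α q '' Set.Ici 0

/-- The spiral intersection point `p_ij`. -/
def joinPoint {n : ℕ} (α : ℝ) (t : Fin n → ℂ) (i j : Fin n) : ℂ :=
  Classical.epsilon (IsSpiralIntersection α (t i) (t j))

/-- `F` satisfies the recurrence: `F i i = 0`, and for `i ≠ j`, `F i j` is the minimum over all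
`k` from `i` to `j - 1` in cyclic order (subtraction and addition in `Fin n` are cyclic) of
`F i k + F (k+1) j + D(p_ik, p_ij) + D(p_(k+1)j, p_ij)`. -/
def IsRecurrence {n : ℕ} [NeZero n] (α : ℝ) (t : Fin n → ℂ) (F : Fin n → Fin n → ℝ) : Prop :=
  (∀ i, F i i = 0) ∧ ∀ i j, i ≠ j →
    IsLeast {x : ℝ | ∃ k : Fin n, k - i < j - i ∧
      x = F i k + F (k + 1) j + spiralDist α (joinPoint α t i k) (joinPoint α t i j)
        + spiralDist α (joinPoint α t (k + 1) j) (joinPoint α t i j)} (F i j)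

/-- The terminals `t i, …, t j` in cyclic order. -/
def cyclicRange {n : ℕ} [NeZero n] (t : Fin n → ℂ) (i j : Fin n) :
    {k : Fin n // k - i ≤ j - i} → ℂ := fun k => t k

/-! ### A real RAM

Programs have integer arrays and real arrays (with one name and two indices per cell). Each
arithmetic operation, elementary function, comparison, memory access and control step costs one
unit. Integers are natural numbers with addition and truncated subtraction. -/

structure State where
  int : ℕ → ℕ → ℕ → ℕ
  real : ℕ → ℕ → ℕ → ℝ

inductive IntExpr where
  | const (k : ℕ)
  | cell (a : ℕ) (i j : IntExpr)
  | add (e f : IntExpr)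
  | sub (e f : IntExpr)

namespace IntExpr

def eval (s : State) : IntExpr → ℕ
  | const k => k
  | cell a i j => s.int a (i.eval s) (j.eval s)
  | add e f => e.eval s + f.eval s
  | sub e f => e.eval s - f.eval s

def cost : IntExpr → ℕ
  | const _ => 1
  | cell _ i j => i.cost + j.cost + 1
  | add e f => e.cost + f.cost + 1
  | sub e f => e.cost + f.cost + 1

end IntExpr

inductive RealExpr where
  | ofInt (e : IntExpr)
  | cell (a : ℕ) (i j : IntExpr)
  | add (e f : RealExpr)
  | sub (e f : RealExpr)
  | mul (e f : RealExpr)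
  | div (e f : RealExpr)
  | sqrt (e : RealExpr)
  | exp (e : RealExpr)
  | log (e : RealExpr)
  | sin (e : RealExpr)
  | cos (e : RealExpr)
  /-- the polar angle in `(-π, π]` of the point with coordinates `(e, f)` -/
  | polarAngle (e f : RealExpr)

namespace RealExpr

def eval (s : State) : RealExpr → ℝ
  | ofInt e => (e.eval s : ℝ)
  | cell a i j => s.real a (i.eval s) (j.eval s)
  | add e f => e.eval s + f.eval s
  | sub e f => e.eval s - f.eval s
  | mul e f => e.eval s * f.eval s
  | div e f => e.eval s / f.eval s
  | sqrt e => Real.sqrt (e.eval s)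
  | exp e => Real.exp (e.eval s)
  | log e => Real.log (e.eval s)
  | sin e => Real.sin (e.eval s)
  | cos e => Real.cos (e.eval s)
  | polarAngle e f => Complex.arg ⟨e.eval s, f.eval s⟩

def cost : RealExpr → ℕ
  | ofInt e => e.cost + 1
  | cell _ i j => i.cost + j.cost + 1
  | add e f => e.cost + f.cost + 1
  | sub e f => e.cost + f.cost + 1
  | mul e f => e.cost + f.cost + 1
  | div e f => e.cost + f.cost + 1
  | sqrt e => e.cost + 1
  | exp e => e.cost + 1
  | log e => e.cost + 1
  | sin e => e.cost + 1
  | cos e => e.cost + 1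
  | polarAngle e f => e.cost + f.cost + 1

end RealExpr

inductive Test where
  | ltInt (e f : IntExpr)
  | ltReal (e f : RealExpr)

namespace Test

def holds (s : State) : Test → Prop
  | ltInt e f => e.eval s < f.eval s
  | ltReal e f => e.eval s < f.eval s

def cost : Test → ℕ
  | ltInt e f => e.cost + f.cost + 1
  | ltReal e f => e.cost + f.cost + 1

end Test

namespace State

def setInt (s : State) (a i j v : ℕ) : State where
  int := fun a' i' j' => if a' = a ∧ i' = i ∧ j' = j then v else s.int a' i' j'
  real := s.real

def setReal (s : State) (a i j : ℕ) (v : ℝ) : State where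
  int := s.int
  real := fun a' i' j' =>
    haveI := Classical.dec (a' = a ∧ i' = i ∧ j' = j)
    if a' = a ∧ i' = i ∧ j' = j then v else s.real a' i' j'

end State

/-- Programs. -/
inductive Program where
  | skip
  | setInt (a : ℕ) (i j e : IntExpr)
  | setReal (a : ℕ) (i j : IntExpr) (e : RealExpr)
  | seq (P Q : Program)
  | cond (b : Test) (P Q : Program)
  | loop (b : Test) (P : Program)

/-- `Runs P s s' c`: started in state `s`, the program `P` halts in state `s'` after `c` steps. -/
inductive Runs : Program → State → State → ℕ → Prop
  | skip (s : State) : Runs Program.skip s s 1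
  | setInt (s : State) (a : ℕ) (i j e : IntExpr) :
      Runs (Program.setInt a i j e) s (s.setInt a (i.eval s) (j.eval s) (e.eval s))
        (i.cost + j.cost + e.cost + 1)
  | setReal (s : State) (a : ℕ) (i j : IntExpr) (e : RealExpr) :
      Runs (Program.setReal a i j e) s (s.setReal a (i.eval s) (j.eval s) (e.eval s))
        (i.cost + j.cost + e.cost + 1)
  | seq {P Q : Program} {s s' s'' : State} {c d : ℕ} :
      Runs P s s' c → Runs Q s' s'' d → Runs (Program.seq P Q) s s'' (c + d + 1)
  | cond_true {b : Test} {P Q : Program} {s s' : State} {c : ℕ} :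
      b.holds s → Runs P s s' c → Runs (Program.cond b P Q) s s' (b.cost + c + 1)
  | cond_false {b : Test} {P Q : Program} {s s' : State} {c : ℕ} :
      ¬ b.holds s → Runs Q s s' c → Runs (Program.cond b P Q) s s' (b.cost + c + 1)
  | loop_true {b : Test} {P : Program} {s s' s'' : State} {c d : ℕ} :
      b.holds s → Runs P s s' c → Runs (Program.loop b P) s' s'' d →
        Runs (Program.loop b P) s s'' (b.cost + c + d + 1)
  | loop_false {b : Test} {P : Program} {s : State} :
      ¬ b.holds s → Runs (Program.loop b P) s s (b.cost + 1)

/-- The input: integer array `0` holds `n`, real array `0` holds `α`, and row `i` of real array `1`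
holds the Cartesian coordinates of terminal `i`. All other cells are `0`. -/
def inputState {n : ℕ} (α : ℝ) (t : Fin n → ℂ) : State where
  int := fun a i j => if a = 0 ∧ i = 0 ∧ j = 0 then n else 0
  real := fun a i j =>
    if a = 0 ∧ i = 0 ∧ j = 0 then α
    else if h : a = 1 ∧ i < n then
      (if j = 0 then (t ⟨i, h.2⟩).re else if j = 1 then (t ⟨i, h.2⟩).im else 0)
    else 0

/-- The final state describes the tree `T`, all of whose arcs are single spiral segments: cell `0`
of integer array `1` is the number of nodes; for each node, integer array `2` holds its parent
(the root being its own parent) and the kind of the spiral to its parent (`1` left, `0` right), and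
real array `2` its Cartesian coordinates; integer array `3` holds the nodes of the terminals, and
cell `0` of real array `3` the length of `T`. -/
def Describes {n : ℕ} {α : ℝ} {t : Fin n → ℂ} (s : State) (T : SpiralSubtree α t) : Prop :=
  (∃ e : T.V ≃ Fin (s.int 1 0 0),
    (∀ v, s.int 2 (e v) 0 = e (T.parent v)) ∧
    (∀ v, v ≠ T.root → ∃ (left : Bool) (τ : ℝ≥0∞),
      T.arc v = [(left, τ)] ∧ s.int 2 (e v) 1 = if left then 1 else 0) ∧
    (∀ v, s.real 2 (e v) 0 = (T.pos v).re ∧ s.real 2 (e v) 1 = (T.pos v).im) ∧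
    (∀ i : Fin n, s.int 3 i 0 = e (T.term i))) ∧
  s.real 3 0 0 = T.length

end SpiralTrees

end

open SpiralTrees

open scoped Topology ENNReal
noncomputable section
namespace SpiralTrees

/-! ### Logarithmic coordinates -/

/-! Write a point as `exp (-h + i θ tan α)`. In the coordinates `(h, θ)`, with `θ` modulo `period
α`, right and left spirals are lines of slope `1` and `-1`, the cone `|θ' - θ| ≤ h' - h` lies in the
spiral region of its apex, every arc is the graph of a 1-Lipschitz function of `h` (`arc_lift`), and
an arc from `p` to `q` has length `sec α (|p| - |q|)`. Hence `cos α` times the length of a tree is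
the integral over `ρ` of the number of arcs that meet the circle of radius `ρ`
(`lintegral_card_arcsAt`): length bounds become counting bounds.

Terminals are lifted to the universal cover and indexed by the integers, where adding `n` adds one
period. Empty spiral regions force both `X = θ - h` and `Y = θ + h` to increase strictly with the
index (`lift_strict`). The join point of the lifts `a ≤ b` has coordinates `X_a` and `Y_b`, hence
height `(Y_b - X_a) / 2`, and no lifted paths from `a` and `b` can meet at a smaller height.

Lower bound. Since a tree may cross itself, each terminal is followed along the leftmost path in the
lifted drawing. Leftmost paths keep their order and stay together once they meet
(`FlowSet.coalescing`). If every gap between consecutive indices in `[i, j]` closed below the join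
height of `i` and `j`, then the paths of `i` and `j` would meet too early; so for some `k` the
groups `[i, k]` and `[k+1, j]` stay apart up to that height (`Coalescing.exists_split`). Counting
distinct values at each radius then reproduces the recurrence by induction on `j - i`
(`Coalescing.lower_bound`). For a spiral tree, closing all gaps of one period would make a path meet
its own translate, so some gap never closes (`Coalescing.exists_cut`); cutting there leaves a single
interval of `n` lifts.

Optimal trees are planar. Where two arcs share a point, the leftmost paths can spare one of them
over a short range of radii, so the lower bound is strict (`length_lower_of_not_isPlanar`).

Leaf order. In a planar drawing the lifted paths to the root keep their order (`IsPath.le`), and at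
most one arc of each kind arrives at a node other than the root. The first fact orders the branches
at the root; together they order those at every other node.

Attainment. Splitting intervals as the recurrence prescribes and following one right and one left
spiral to the join point realises `F` inside a wedge (`exists_wedge_tree`). The optimal spiral tree
is the output of the algorithm: dynamic programming over the lifts `0, …, 2n - 1`, the best starting
terminal, and a queue that unfolds the stored splits. The invariant of the queue
(`Layout.IsPartial`) proves both the shape and the length of this tree. -/

/-- The point of the plane at logarithmic height `h` and scaled angle `θ`. -/
def cyl (α h θ : ℝ) : ℂ := Complex.exp ((-h : ℝ) + (Real.tan α * θ : ℝ) * Complex.I)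

theorem norm_cyl (α h θ : ℝ) : ‖cyl α h θ‖ = Real.exp (-h) := by
  simp [cyl, Complex.norm_exp]

theorem cyl_ne_zero (α h θ : ℝ) : cyl α h θ ≠ 0 := Complex.exp_ne_zero _

/-- The period of the scaled angle. -/
def period (α : ℝ) : ℝ := 2 * Real.pi / Real.tan α

theorem period_pos {α : ℝ} (hα : 0 < Real.tan α) : 0 < period α := by
  unfold period; positivity

theorem cyl_eq_iff {α : ℝ} (hα : 0 < Real.tan α) {h θ h' θ' : ℝ} :
    cyl α h θ = cyl α h' θ' ↔ h = h' ∧ ∃ m : ℤ, θ = θ' + m * period α := by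
  unfold cyl period
  rw [Complex.exp_eq_exp_iff_exists_int]
  generalize Real.tan α = T at hα ⊢
  constructor
  · rintro ⟨m, hm⟩
    have h1 := congrArg Complex.re hm
    have h2 := congrArg Complex.im hm
    simp at h1 h2
    refine ⟨h1, m, ?_⟩
    field_simp
    linarith
  · rintro ⟨rfl, m, rfl⟩
    refine ⟨m, ?_⟩
    apply Complex.ext
    · simp
    · simp
      field_simp

theorem exists_cyl {α : ℝ} (hα : 0 < Real.tan α) {z : ℂ} (hz : z ≠ 0) :
    ∃ θ, z = cyl α (-Real.log ‖z‖) θ := by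
  refine ⟨z.arg / Real.tan α, ?_⟩
  unfold cyl
  rw [mul_div_cancel₀ _ hα.ne', neg_neg, Complex.exp_add, ← Complex.ofReal_exp,
    Real.exp_log (norm_pos_iff.2 hz)]
  exact (Complex.norm_mul_exp_arg_mul_I z).symm

theorem cyl_add_period {α : ℝ} (hα : 0 < Real.tan α) (h θ : ℝ) (m : ℤ) :
    cyl α h (θ + m * period α) = cyl α h θ := (cyl_eq_iff hα).2 ⟨rfl, m, rfl⟩

/-- The direction of a spiral kind: the left spiral decreases the angle. -/
def sgn (d : Bool) : ℝ := if d then -1 else 1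

theorem spiral_cyl (α : ℝ) (d : Bool) (h θ s : ℝ) :
    spiral α d (cyl α h θ) s = cyl α (h + s) (θ + sgn d * s) := by
  cases d <;>
  · simp only [spiral, leftSpiral, rightSpiral, cyl, sgn, Complex.ofReal_exp, ← Complex.exp_add,
      Real.tan_neg, if_true, Bool.false_eq_true, if_false]
    congr 1
    push_cast
    ring

theorem spiral_zero_left (α : ℝ) (d : Bool) (s : ℝ) : spiral α d 0 s = 0 := by
  cases d <;> simp [spiral, leftSpiral, rightSpiral]

theorem norm_spiral (α : ℝ) (d : Bool) (p : ℂ) (s : ℝ) :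
    ‖spiral α d p s‖ = ‖p‖ * Real.exp (-s) := by
  cases d <;> simp only [spiral, leftSpiral, rightSpiral, norm_mul, Complex.norm_exp_ofReal_mul_I,
    mul_one, if_true, Bool.false_eq_true, if_false, Complex.norm_real, Real.norm_eq_abs,
    Real.abs_exp]

/-! ### Zigzag functions -/

/-- A function that is `1`-Lipschitz and has slope `1` or `-1` on short intervals to the left and
to the right of every point. -/
structure Zigzag (g : ℝ → ℝ) : Prop where
  lip : ∀ a b, |g a - g b| ≤ |a - b|
  right : ∀ a, ∃ δ > 0, ∃ σ : ℝ, (σ = 1 ∨ σ = -1) ∧ ∀ s, 0 ≤ s → s ≤ δ → g (a + s) = g a + σ * s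
  left : ∀ a, ∃ δ > 0, ∃ σ : ℝ, (σ = 1 ∨ σ = -1) ∧ ∀ s, 0 ≤ s → s ≤ δ → g (a - s) = g a - σ * s

theorem lipschitz_glue {g₁ g₂ : ℝ → ℝ} (h₁ : ∀ a b, |g₁ a - g₁ b| ≤ |a - b|)
    (h₂ : ∀ a b, |g₂ a - g₂ b| ≤ |a - b|) {c : ℝ} (hc : g₁ c = g₂ c) (a b : ℝ) :
    |(if a ≤ c then g₁ a else g₂ a) - (if b ≤ c then g₁ b else g₂ b)| ≤ |a - b| := by
  split_ifs with ha hb hb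
  · exact h₁ a b
  · have e1 := abs_le.1 (h₁ a c)
    have e2 := abs_le.1 (h₂ c b)
    rw [abs_of_nonpos (a := a - c) (by linarith)] at e1
    rw [abs_of_nonpos (a := c - b) (by linarith)] at e2
    rw [abs_of_nonpos (a := a - b) (by linarith), abs_le]; constructor <;> linarith [e1.1, e1.2, e2.1, e2.2]
  · have e1 := abs_le.1 (h₁ b c)
    have e2 := abs_le.1 (h₂ c a)
    rw [abs_of_nonpos (a := b - c) (by linarith)] at e1
    rw [abs_of_nonpos (a := c - a) (by linarith)] at e2
    rw [abs_of_nonneg (a := a - b) (by linarith), abs_le]; constructor <;> linarith [e1.1, e1.2, e2.1, e2.2]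
  · exact h₂ a b

/-- At the seam `c` the slope on the left comes from `g₁` and the slope on the right from `g₂`; a
one-sided slope condition is what makes concatenation possible at a corner. -/
theorem Zigzag.glue {g₁ g₂ : ℝ → ℝ} (h₁ : Zigzag g₁) (h₂ : Zigzag g₂) {c : ℝ}
    (hc : g₁ c = g₂ c) : Zigzag fun a => if a ≤ c then g₁ a else g₂ a where
  lip := lipschitz_glue h₁.lip h₂.lip hc
  right a := by
    rcases lt_or_ge a c with hac | hac
    · obtain ⟨δ, hδ, σ, hσ, H⟩ := h₁.right a
      refine ⟨min δ (c - a), lt_min hδ (by linarith), σ, hσ, fun s hs hs' => ?_⟩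
      have := min_le_left δ (c - a)
      have := min_le_right δ (c - a)
      rw [if_pos (by linarith), if_pos hac.le, H s hs (by linarith)]
    · obtain ⟨δ, hδ, σ, hσ, H⟩ := h₂.right a
      refine ⟨δ, hδ, σ, hσ, fun s hs hs' => ?_⟩
      have key : ∀ b, c ≤ b → (if b ≤ c then g₁ b else g₂ b) = g₂ b := by
        intro b hb
        split_ifs with h
        · rw [le_antisymm h hb, hc]
        · rfl
      rw [key _ hac, key _ (by linarith), H s hs hs']
  left a := by
    rcases le_or_gt a c with hac | hac
    · obtain ⟨δ, hδ, σ, hσ, H⟩ := h₁.left a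
      refine ⟨δ, hδ, σ, hσ, fun s hs hs' => ?_⟩
      rw [if_pos (by linarith), if_pos hac, H s hs hs']
    · obtain ⟨δ, hδ, σ, hσ, H⟩ := h₂.left a
      refine ⟨min δ ((a - c) / 2), lt_min hδ (by linarith), σ, hσ, fun s hs hs' => ?_⟩
      have := min_le_left δ ((a - c) / 2)
      have := min_le_right δ ((a - c) / 2)
      rw [if_neg (by linarith), if_neg (by linarith), H s hs (by linarith)]

theorem Zigzag.linear {σ : ℝ} (hσ : σ = 1 ∨ σ = -1) (h θ : ℝ) :
    Zigzag fun a => θ + σ * (a - h) where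
  lip a b := by
    have : θ + σ * (a - h) - (θ + σ * (b - h)) = σ * (a - b) := by ring
    rw [this, abs_mul]
    rcases hσ with rfl | rfl <;> simp
  right a := ⟨1, one_pos, σ, hσ, fun s _ _ => by ring⟩
  left a := ⟨1, one_pos, σ, hσ, fun s _ _ => by ring⟩

theorem Zigzag.add_const {g : ℝ → ℝ} (hg : Zigzag g) (t : ℝ) : Zigzag fun a => g a + t where
  lip a b := by simpa using hg.lip a b
  right a := by
    obtain ⟨δ, hδ, σ, hσ, H⟩ := hg.right a
    exact ⟨δ, hδ, σ, hσ, fun s h1 h2 => by rw [H s h1 h2]; ring⟩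
  left a := by
    obtain ⟨δ, hδ, σ, hσ, H⟩ := hg.left a
    exact ⟨δ, hδ, σ, hσ, fun s h1 h2 => by rw [H s h1 h2]; ring⟩

theorem Zigzag.continuous {g : ℝ → ℝ} (hg : Zigzag g) : Continuous g :=
  (LipschitzWith.of_dist_le_mul (K := 1) fun a b => by
    simpa [Real.dist_eq] using hg.lip a b).continuous

theorem sgn_eq (d : Bool) : sgn d = 1 ∨ sgn d = -1 := by cases d <;> simp [sgn]

/-! ### Arcs -/

theorem segEnd_zero (α : ℝ) (d : Bool) (τ : ℝ≥0∞) : segEnd α d 0 τ = 0 := by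
  unfold segEnd; split_ifs <;> simp [spiral_zero_left]

theorem arcEnd_zero (α : ℝ) (l : List (Bool × ℝ≥0∞)) : arcEnd α 0 l = 0 := by
  induction l with
  | nil => rfl
  | cons x l ih => obtain ⟨d, τ⟩ := x; simp [arcEnd, segEnd_zero, ih]

/-- A segment of positive duration starting at the origin would have the origin on its trace.
Avoidance therefore leaves only segments of duration `0` after the root has been reached. -/
theorem arcTrace_zero (α : ℝ) (l : List (Bool × ℝ≥0∞)) (h : (0 : ℂ) ∉ arcTrace α 0 l) :
    arcTrace α 0 l = ∅ ∧ arcLength α 0 l = 0 := by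
  induction l with
  | nil => exact ⟨rfl, rfl⟩
  | cons x l ih =>
    obtain ⟨d, τ⟩ := x
    simp only [arcTrace, segEnd_zero, spiral_zero_left, Set.mem_union, not_or, arcLength] at h ⊢
    obtain ⟨h1, h2⟩ := h
    have hτ : τ = 0 := by
      by_contra hne
      exact h1 ⟨0, le_rfl, by simpa using pos_iff_ne_zero.2 hne, rfl⟩
    rw [(ih h2).1, (ih h2).2]
    subst hτ
    simp

/-- The height grows at unit speed along every segment, so the arc is a graph over the height. The
height range is expressed through the norm of the end point, which covers arcs that run into the
origin as well (norm `0`, infinite range). Outside that range the values of `g` are an arbitrary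
extension. -/
theorem arc_lift {α : ℝ} (l : List (Bool × ℝ≥0∞)) : ∀ h θ : ℝ,
    (0 : ℂ) ∉ arcTrace α (cyl α h θ) l → ∃ g : ℝ → ℝ, Zigzag g ∧ g h = θ ∧
      arcTrace α (cyl α h θ) l =
        {z | ∃ a, h ≤ a ∧ ‖arcEnd α (cyl α h θ) l‖ < Real.exp (-a) ∧ z = cyl α a (g a)} ∧
      (arcEnd α (cyl α h θ) l ≠ 0 → ∃ b, h ≤ b ∧ arcEnd α (cyl α h θ) l = cyl α b (g b)) := by
  induction l with
  | nil =>
    intro h θ _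
    refine ⟨_, Zigzag.linear (Or.inl rfl) h θ, by simp, ?_, fun _ => ⟨h, le_rfl, by simp [arcEnd]⟩⟩
    simp only [arcTrace, arcEnd, norm_cyl]
    symm
    rw [Set.eq_empty_iff_forall_notMem]
    rintro z ⟨a, h1, h2, -⟩
    have := Real.exp_lt_exp.1 h2
    linarith
  | cons x l ih =>
    obtain ⟨d, τ⟩ := x
    intro h θ hav
    simp only [arcTrace, arcEnd, Set.mem_union, not_or] at hav ⊢
    obtain ⟨-, h2⟩ := hav
    have hz := Zigzag.linear (sgn_eq d) h θ
    -- An infinite segment ends at the origin, so whatever follows it has empty trace and the linear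
    -- function of this segment is already the whole lift.
    rcases eq_or_ne τ ⊤ with rfl | hτ
    · have e : segEnd α d (cyl α h θ) ⊤ = 0 := by simp [segEnd]
      rw [e] at h2 ⊢
      refine ⟨_, hz, by simp, ?_, fun hne => absurd (arcEnd_zero α l) hne⟩
      rw [(arcTrace_zero α l h2).1, arcEnd_zero, Set.union_empty]
      ext z
      simp only [Set.mem_ofPred_eq, ENNReal.ofReal_lt_top, true_and, norm_zero, Real.exp_pos]
      constructor
      · rintro ⟨s, hs, rfl⟩
        exact ⟨h + s, by linarith, by rw [spiral_cyl]; congr 2; ring⟩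
      · rintro ⟨a, ha, rfl⟩
        exact ⟨a - h, by linarith, by rw [spiral_cyl]; congr 2; ring⟩
    · lift τ to NNReal using hτ
      have e : segEnd α d (cyl α h θ) τ = cyl α (h + τ) (θ + sgn d * τ) := by
        simp [segEnd, spiral_cyl]
      rw [e] at h2 ⊢
      obtain ⟨g, hg, hg0, htr, hend⟩ := ih _ _ h2
      have hτ0 : (0 : ℝ) ≤ τ := τ.2
      have hc : (fun a => θ + sgn d * (a - h)) (h + τ) = g (h + τ) := by
        simp only [hg0]; ring
      have hle : ‖arcEnd α (cyl α (h + τ) (θ + sgn d * τ)) l‖ ≤ Real.exp (-(h + τ)) := by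
        by_cases h0 : arcEnd α (cyl α (h + τ) (θ + sgn d * τ)) l = 0
        · rw [h0, norm_zero]; positivity
        · obtain ⟨b, hb, hb'⟩ := hend h0
          rw [hb', norm_cyl]
          exact Real.exp_le_exp.2 (by linarith)
      have key : ∀ b, h + (τ : ℝ) ≤ b →
          (if b ≤ h + τ then θ + sgn d * (b - h) else g b) = g b := by
        intro b hb
        split_ifs with h'
        · rw [le_antisymm h' hb]; exact hc
        · rfl
      refine ⟨_, hz.glue hg hc, ?_, ?_, ?_⟩
      · simp [hτ0]
      · rw [htr]
        ext z
        simp only [Set.mem_union, Set.mem_ofPred_eq]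
        constructor
        · rintro (⟨s, hs, hs', rfl⟩ | ⟨a, ha, ha', rfl⟩)
          · rw [ENNReal.ofReal_lt_coe_iff hs] at hs'
            refine ⟨h + s, by linarith, hle.trans_lt (Real.exp_lt_exp.2 (by linarith)), ?_⟩
            rw [spiral_cyl, if_pos (by linarith)]; congr 2; ring
          · exact ⟨a, by linarith, ha', by rw [key a ha]⟩
        · rintro ⟨a, ha, ha', rfl⟩
          rcases lt_or_ge a (h + τ) with hlt | hge
          · left
            refine ⟨a - h, by linarith, ?_, ?_⟩
            · rw [ENNReal.ofReal_lt_coe_iff (by linarith)]; linarith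
            · rw [spiral_cyl, if_pos (by linarith)]; congr 2; ring
          · right
            exact ⟨a, hge, ha', by rw [key a hge]⟩
      · intro hne
        obtain ⟨b, hb, hb'⟩ := hend hne
        exact ⟨b, by linarith, by rw [key b hb]; exact hb'⟩

/-- The spiral is `s ↦ p exp (s w)` with `w = -1 ± i tan α`, and `|w|² = 1 + tan² α = sec² α`. -/
theorem norm_deriv_spiral {α : ℝ} (hα : 0 < Real.cos α) (d : Bool) (p : ℂ) (s : ℝ) :
    ‖deriv (spiral α d p) s‖ = ‖p‖ * (Real.cos α)⁻¹ * Real.exp (-s) := by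
  set w : ℂ := -1 + (sgn d * Real.tan α : ℝ) * Complex.I with hw
  have hfun : spiral α d p = fun s : ℝ => p * Complex.exp (s * w) := by
    funext s
    cases d <;>
    · simp only [spiral, leftSpiral, rightSpiral, hw, sgn, Complex.ofReal_exp, mul_assoc,
        ← Complex.exp_add, Real.tan_neg, if_true, Bool.false_eq_true, if_false]
      congr 2
      push_cast
      ring
  have hd : HasDerivAt (fun s : ℝ => p * Complex.exp (s * w))
      (p * (Complex.exp (s * w) * (1 * w))) s := by
    have h1 : HasDerivAt (fun s : ℝ => (s : ℂ) * w) (1 * w) s :=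
      (Complex.ofRealCLM.hasDerivAt (x := s)).mul_const w
    exact (h1.cexp).const_mul p
  have hwn : ‖w‖ = (Real.cos α)⁻¹ := by
    have h2 : ‖w‖ ^ 2 = ((Real.cos α)⁻¹) ^ 2 := by
      rw [← Complex.normSq_eq_norm_sq, Complex.normSq_apply]
      have : sgn d * sgn d = 1 := by cases d <;> simp [sgn]
      have h3 : 1 + Real.tan α ^ 2 = (Real.cos α)⁻¹ ^ 2 := by
        rw [inv_pow, ← Real.inv_one_add_tan_sq hα.ne', inv_inv]
      have hre : w.re = -1 := by simp [hw, -Complex.ofReal_mul]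
      have him : w.im = sgn d * Real.tan α := by simp [hw, -Complex.ofReal_mul]
      rw [hre, him, ← h3]
      linear_combination Real.tan α ^ 2 * this
    have := (sq_eq_sq₀ (norm_nonneg w) (by positivity)).1 h2
    exact this
  rw [hfun, hd.deriv, one_mul, norm_mul, norm_mul, hwn, Complex.norm_exp]
  have : ((s : ℂ) * w).re = -s := by simp [hw]
  rw [this]; ring

theorem integral_norm_deriv_spiral {α : ℝ} (hα : 0 < Real.cos α) (d : Bool) (p : ℂ) (τ : ℝ≥0∞) :
    ∫ s in {s : ℝ | 0 ≤ s ∧ ENNReal.ofReal s < τ}, ‖deriv (spiral α d p) s‖ =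
      (Real.cos α)⁻¹ * (‖p‖ - ‖segEnd α d p τ‖) := by
  simp only [norm_deriv_spiral hα]
  rw [MeasureTheory.integral_const_mul]
  rcases eq_or_ne τ ⊤ with rfl | hτ
  · have : {s : ℝ | 0 ≤ s ∧ ENNReal.ofReal s < ⊤} = Set.Ici 0 := by ext; simp
    rw [this, MeasureTheory.integral_Ici_eq_integral_Ioi, integral_exp_neg_Ioi]
    simp [segEnd]; ring
  · lift τ to NNReal using hτ
    have : {s : ℝ | 0 ≤ s ∧ ENNReal.ofReal s < τ} = Set.Ico 0 (τ : ℝ) := by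
      ext s
      simp only [Set.mem_ofPred_eq, Set.mem_Ico, and_congr_right_iff]
      intro hs
      exact ENNReal.ofReal_lt_coe_iff hs
    rw [this, MeasureTheory.integral_Ico_eq_integral_Ioo, ← MeasureTheory.integral_Ioc_eq_integral_Ioo]
    have h1 : ∫ x in (0 : ℝ)..τ, Real.exp (-x) = 1 - Real.exp (-τ) := by
      rw [intervalIntegral.integral_comp_neg (fun x => Real.exp x), integral_exp]; simp
    rw [intervalIntegral.integral_of_le τ.coe_nonneg] at h1
    rw [h1]
    simp [segEnd, norm_spiral]; ring

/-- Each segment contributes `sec α` times its loss of norm, and these losses telescope: the length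
of an arc depends only on the distances of its ends from the root. -/
theorem arcLength_eq {α : ℝ} (hα : 0 < Real.cos α) (l : List (Bool × ℝ≥0∞)) : ∀ p : ℂ,
    arcLength α p l = (Real.cos α)⁻¹ * (‖p‖ - ‖arcEnd α p l‖) := by
  induction l with
  | nil => intro p; simp [arcLength, arcEnd]
  | cons x l ih =>
    obtain ⟨d, τ⟩ := x
    intro p
    simp only [arcLength, arcEnd, ih, integral_norm_deriv_spiral hα]
    ring

end SpiralTrees
namespace SpiralTrees

/-! ### Arcs and paths of a spiral subtree -/

namespace SpiralSubtree

variable {α : ℝ} {ι : Type} {t : ι → ℂ} (T : SpiralSubtree α t)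

theorem pos_ne_zero {v : T.V} (hv : v ≠ T.root) : T.pos v ≠ 0 := by
  intro h
  have h1 := T.arc_end v
  rw [h, arcEnd_zero] at h1
  exact T.arc_ne v hv (h1.symm.trans h.symm)

theorem trace_root : T.trace T.root = ∅ := by
  simp [trace, T.arc_root, arcTrace]

theorem trace_lift {v : T.V} (hv : v ≠ T.root) {h θ : ℝ} (hp : T.pos v = cyl α h θ) :
    ∃ g : ℝ → ℝ, Zigzag g ∧ g h = θ ∧
      (∀ z, z ∈ T.trace v ↔
        ∃ a, h ≤ a ∧ ‖T.pos (T.parent v)‖ < Real.exp (-a) ∧ z = cyl α a (g a)) ∧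
      (T.pos (T.parent v) ≠ 0 → ∃ b, h < b ∧ T.pos (T.parent v) = cyl α b (g b)) := by
  have hav := T.arc_avoid v
  rw [hp] at hav
  obtain ⟨g, hg, hgh, htr, hend⟩ := arc_lift (T.arc v) h θ hav
  rw [← hp, T.arc_end] at htr hend
  refine ⟨g, hg, hgh, fun z => by rw [trace, htr]; rfl, fun hne => ?_⟩
  obtain ⟨b, hb, hb'⟩ := hend hne
  -- Equal heights would make the two ends of the arc equal, against `arc_ne`; this is the source of
  -- all strict decrease of norms towards the root.
  refine ⟨b, lt_of_le_of_ne hb ?_, hb'⟩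
  rintro rfl
  exact T.arc_ne v hv (by rw [hb', hgh, hp])

variable (hα : 0 < Real.tan α)
include hα

theorem exists_trace_lift {v : T.V} (hv : v ≠ T.root) :
    ∃ θ, ∃ g : ℝ → ℝ, T.pos v = cyl α (-Real.log ‖T.pos v‖) θ ∧ Zigzag g ∧
      g (-Real.log ‖T.pos v‖) = θ ∧
      (∀ z, z ∈ T.trace v ↔ ∃ a, -Real.log ‖T.pos v‖ ≤ a ∧
        ‖T.pos (T.parent v)‖ < Real.exp (-a) ∧ z = cyl α a (g a)) ∧
      (T.pos (T.parent v) ≠ 0 →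
        ∃ b, -Real.log ‖T.pos v‖ < b ∧ T.pos (T.parent v) = cyl α b (g b)) := by
  obtain ⟨θ, hθ⟩ := exists_cyl hα (T.pos_ne_zero hv)
  obtain ⟨g, hg⟩ := T.trace_lift hv hθ
  exact ⟨θ, g, hθ, hg⟩

theorem norm_parent_lt {v : T.V} (hv : v ≠ T.root) : ‖T.pos (T.parent v)‖ < ‖T.pos v‖ := by
  obtain ⟨θ, g, hp, hg, -, -, hend⟩ := T.exists_trace_lift hα hv
  by_cases h0 : T.pos (T.parent v) = 0
  · rw [h0, norm_zero]; exact norm_pos_iff.2 (T.pos_ne_zero hv)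
  · obtain ⟨b, hb, hb'⟩ := hend h0
    rw [hb', norm_cyl, hp, norm_cyl]
    exact Real.exp_lt_exp.2 (by linarith)

theorem norm_parent_le (v : T.V) : ‖T.pos (T.parent v)‖ ≤ ‖T.pos v‖ := by
  by_cases hv : v = T.root
  · rw [hv, T.parent_root]
  · exact (T.norm_parent_lt hα hv).le

theorem norm_of_mem_trace {v : T.V} {z : ℂ} (hz : z ∈ T.trace v) :
    v ≠ T.root ∧ ‖T.pos (T.parent v)‖ < ‖z‖ ∧ ‖z‖ ≤ ‖T.pos v‖ := by
  have hv : v ≠ T.root := by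
    rintro rfl
    rw [T.trace_root] at hz
    exact hz
  obtain ⟨θ, g, hp, hg, hgθ, htr, -⟩ := T.exists_trace_lift hα hv
  obtain ⟨a, h1, h2, rfl⟩ := (htr z).1 hz
  refine ⟨hv, by rwa [norm_cyl], ?_⟩
  rw [norm_cyl, hp, norm_cyl]
  exact Real.exp_le_exp.2 (by linarith)

theorem trace_unique {v : T.V} {z z' : ℂ} (hz : z ∈ T.trace v) (hz' : z' ∈ T.trace v)
    (h : ‖z‖ = ‖z'‖) : z = z' := by
  obtain ⟨θ, g, hp, hg, hgθ, htr, -⟩ :=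
    T.exists_trace_lift hα (T.norm_of_mem_trace hα hz).1
  obtain ⟨a, h1, h2, rfl⟩ := (htr z).1 hz
  obtain ⟨a', h1', h2', rfl⟩ := (htr z').1 hz'
  rw [norm_cyl, norm_cyl, Real.exp_eq_exp, neg_inj] at h
  rw [h]

theorem pos_mem_trace {v : T.V} (hv : v ≠ T.root) : T.pos v ∈ T.trace v := by
  obtain ⟨θ, g, hp, hg, hgθ, htr, -⟩ := T.exists_trace_lift hα hv
  refine (htr _).2 ⟨_, le_rfl, ?_, by rwa [hgθ]⟩
  rw [neg_neg, Real.exp_log (norm_pos_iff.2 (T.pos_ne_zero hv))]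
  exact T.norm_parent_lt hα hv

omit hα

variable {T}

theorem IsAncestor.refl (v : T.V) : T.IsAncestor v v := ⟨0, rfl⟩

theorem IsAncestor.trans {u v w : T.V} (h₁ : T.IsAncestor u v) (h₂ : T.IsAncestor v w) :
    T.IsAncestor u w := by
  obtain ⟨k, rfl⟩ := h₁
  obtain ⟨l, rfl⟩ := h₂
  exact ⟨k + l, Function.iterate_add_apply _ _ _ _⟩

theorem isAncestor_root (v : T.V) : T.IsAncestor T.root v := T.parent_iterate v

theorem isAncestor_parent (v : T.V) : T.IsAncestor (T.parent v) v := ⟨1, rfl⟩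

theorem IsAncestor.parent_of_ne {u v : T.V} (h : T.IsAncestor u v) (hne : u ≠ v) :
    T.IsAncestor u (T.parent v) := by
  obtain ⟨k, rfl⟩ := h
  cases k with
  | zero => exact absurd rfl hne
  | succ k => exact ⟨k, by rw [Function.iterate_succ_apply]⟩

theorem IsAncestor.total {u u' v : T.V} (h : T.IsAncestor u v) (h' : T.IsAncestor u' v) :
    T.IsAncestor u u' ∨ T.IsAncestor u' u := by
  obtain ⟨k, rfl⟩ := h
  obtain ⟨l, rfl⟩ := h'
  rcases le_total k l with hkl | hkl
  · right
    exact ⟨l - k, by rw [← Function.iterate_add_apply, Nat.sub_add_cancel hkl]⟩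
  · left
    exact ⟨k - l, by rw [← Function.iterate_add_apply, Nat.sub_add_cancel hkl]⟩

/-- A node strictly below `u` lies on or below a child of `u`. -/
theorem IsAncestor.exists_child {u v : T.V} (h : T.IsAncestor u v) (hne : u ≠ v) :
    ∃ w, w ≠ T.root ∧ T.parent w = u ∧ T.IsAncestor w v := by
  obtain ⟨k, hk⟩ := h
  induction k generalizing v with
  | zero => exact absurd hk.symm hne
  | succ k ih =>
    by_cases h : u = T.parent v
    · refine ⟨v, ?_, h.symm, .refl v⟩
      rintro rfl
      rw [T.parent_root] at h
      exact hne h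
    · obtain ⟨w, h1, h2, h3⟩ := ih h (by rw [← hk, Function.iterate_succ_apply])
      exact ⟨w, h1, h2, h3.trans (isAncestor_parent v)⟩

/-- Below every node there is a leaf. -/
theorem exists_leaf (hα : 0 < Real.tan α) (v : T.V) :
    ∃ w, T.IsAncestor v w ∧ ∀ x, x ≠ T.root → T.parent x ≠ w := by
  -- A descendant farthest from the origin is a leaf, since any child would be strictly farther.
  obtain ⟨w, hw, hmax⟩ := Set.Finite.exists_maximalFor (fun w => ‖T.pos w‖)
    {w | T.IsAncestor v w} (Set.toFinite _) ⟨v, .refl v⟩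
  refine ⟨w, hw, fun x hx hxw => ?_⟩
  have h1 := T.norm_parent_lt hα hx
  rw [hxw] at h1
  have h2 : T.IsAncestor v x := IsAncestor.trans hw (hxw ▸ isAncestor_parent x)
  exact absurd (hmax h2 h1.le) (not_le.2 h1)

include hα

theorem IsAncestor.norm_le {u v : T.V} (h : T.IsAncestor u v) : ‖T.pos u‖ ≤ ‖T.pos v‖ := by
  obtain ⟨k, rfl⟩ := h
  induction k with
  | zero => rfl
  | succ k ih =>
    rw [Function.iterate_succ_apply']
    exact (T.norm_parent_le hα _).trans ih

theorem IsAncestor.not_parent {u v : T.V} (hv : v ≠ T.root) (hp : T.parent v = u) :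
    ¬ T.IsAncestor v u := fun h => by
  have h1 := h.norm_le hα
  have h2 := T.norm_parent_lt hα hv
  rw [hp] at h2
  linarith

theorem path_unique {u u' v : T.V} (hu : T.IsAncestor u v) (hu' : T.IsAncestor u' v) {z z' : ℂ}
    (hz : z ∈ T.trace u) (hz' : z' ∈ T.trace u') (h : ‖z‖ = ‖z'‖) : u = u' ∧ z = z' := by
  have key : ∀ {u u' : T.V} {z z' : ℂ}, z ∈ T.trace u → z' ∈ T.trace u' → ‖z‖ = ‖z'‖ →
      T.IsAncestor u u' → u = u' := by
    intro u u' z z' hz hz' h huu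
    by_contra hne
    have h1 := (huu.parent_of_ne hne).norm_le hα
    have h2 := (T.norm_of_mem_trace hα hz).2.2
    have h3 := (T.norm_of_mem_trace hα hz').2.1
    linarith
  have e : u = u' := by
    rcases hu.total hu' with h1 | h1
    · exact key hz hz' h h1
    · exact (key hz' hz h.symm h1).symm
  subst e
  exact ⟨rfl, T.trace_unique hα hz hz' h⟩

variable (T)

omit hα in
theorem exists_path {v : T.V} {h θ : ℝ} (hp : T.pos v = cyl α h θ) :
    ∃ g : ℝ → ℝ, Zigzag g ∧ g h = θ ∧
      (∀ a, h ≤ a → ‖T.pos T.root‖ < Real.exp (-a) →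
        ∃ u, T.IsAncestor u v ∧ cyl α a (g a) ∈ T.trace u) ∧
      (T.pos T.root ≠ 0 → ∃ b, h ≤ b ∧ T.pos T.root = cyl α b (g b)) := by
  obtain ⟨k, hk⟩ := T.parent_iterate v
  induction k generalizing v h θ with
  | zero =>
    simp only [Function.iterate_zero, id] at hk
    refine ⟨_, Zigzag.linear (Or.inl rfl) h θ, by simp, fun a ha ha' => ?_,
      fun _ => ⟨h, le_rfl, by rw [← hk, hp]; simp⟩⟩
    rw [← hk, hp, norm_cyl, Real.exp_lt_exp] at ha'
    linarith
  | succ k ih =>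
    by_cases hv : v = T.root
    · exact ih hp (by rw [hv]; exact Function.iterate_fixed T.parent_root k)
    rw [Function.iterate_succ_apply] at hk
    obtain ⟨g, hg, hgh, htr, hend⟩ := T.trace_lift hv hp
    -- Only the root node can lie at the origin, because an arc from the origin never leaves it. So
    -- either the path ends here, or the lifts of the arc and of the remaining path are glued at the
    -- parent.
    by_cases h0 : T.pos (T.parent v) = 0
    · have hpr : T.parent v = T.root := by
        by_contra hne
        exact T.pos_ne_zero hne h0
      refine ⟨g, hg, hgh, fun a ha ha' => ⟨v, .refl v, (htr _).2 ⟨a, ha, by rwa [hpr], rfl⟩⟩,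
        fun hne => absurd (hpr ▸ h0) hne⟩
    · obtain ⟨b, hb, hb'⟩ := hend h0
      obtain ⟨g', hg', hgb, htr', hend'⟩ := ih hb' hk
      have hkey : ∀ a, b ≤ a → (if a ≤ b then g a else g' a) = g' a := by
        intro a ha
        split_ifs with h'
        · rw [le_antisymm h' ha, hgb]
        · rfl
      refine ⟨_, hg.glue hg' hgb.symm, by rw [if_pos hb.le, hgh], fun a ha ha' => ?_, fun hne => ?_⟩
      · rcases lt_or_ge a b with hab | hab
        · refine ⟨v, .refl v, (htr _).2 ⟨a, ha, ?_, by rw [if_pos hab.le]⟩⟩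
          rw [hb', norm_cyl, Real.exp_lt_exp]
          linarith
        · obtain ⟨u, hu, hu'⟩ := htr' a hab ha'
          refine ⟨u, hu.trans (isAncestor_parent v), ?_⟩
          simp only [hkey a hab]
          exact hu'
      · obtain ⟨c, hc, hc'⟩ := hend' hne
        exact ⟨c, by linarith, by simp only [hkey c hc]; exact hc'⟩

/-- Forward path from an arbitrary point of the drawing. -/
theorem exists_path_of_mem_trace {v : T.V} {h θ : ℝ} (hz : cyl α h θ ∈ T.trace v) :
    ∃ g : ℝ → ℝ, Zigzag g ∧ g h = θ ∧
      (∀ a, h ≤ a → ‖T.pos T.root‖ < Real.exp (-a) →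
        ∃ u, T.IsAncestor u v ∧ cyl α a (g a) ∈ T.trace u) := by
  obtain ⟨hv, h1, h2⟩ := T.norm_of_mem_trace hα hz
  obtain ⟨θ₀, hθ₀⟩ := exists_cyl hα (T.pos_ne_zero hv)
  obtain ⟨g, hg, hgh, htr, -⟩ := T.exists_path hθ₀
  have hb : -Real.log ‖T.pos v‖ ≤ h := by
    rw [hθ₀, norm_cyl, norm_cyl, Real.exp_le_exp] at h2
    linarith
  have hr : ‖T.pos T.root‖ < Real.exp (-h) := by
    rw [norm_cyl] at h1
    exact ((isAncestor_root (T.parent v)).norm_le hα).trans_lt h1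
  obtain ⟨u, hu, hu'⟩ := htr h hb hr
  have := (path_unique hα hu (.refl v) hu' hz (by simp [norm_cyl])).2
  obtain ⟨-, m, hm⟩ := (cyl_eq_iff hα).1 this
  -- The path through `v` was lifted from some lift of `pos v`; a translation by `-m` periods makes
  -- it pass through the prescribed lift of the point.
  refine ⟨fun a => g a + ((-m : ℤ) : ℝ) * period α, hg.add_const _, by simp only [hm]; push_cast; ring,
    fun a ha ha' => ?_⟩
  obtain ⟨w, hw, hw'⟩ := htr a (hb.trans ha) ha'
  exact ⟨w, hw, by rw [cyl_add_period hα]; exact hw'⟩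

omit hα

theorem length_eq (hc : 0 < Real.cos α) :
    T.length = (Real.cos α)⁻¹ * ∑ v, (‖T.pos v‖ - ‖T.pos (T.parent v)‖) := by
  rw [length, Finset.mul_sum]
  exact Finset.sum_congr rfl fun v _ => by rw [arcLength_eq hc, T.arc_end]

/-- The arcs that meet the circle of radius `ρ`. -/
def arcsAt (ρ : ℝ) : Finset T.V := by
  classical exact Finset.univ.filter fun v => ρ ∈ Set.Ioc ‖T.pos (T.parent v)‖ ‖T.pos v‖

/-- An arc meets a circle in at most one point, and the radii that it meets form an interval whose
measure is its loss of norm. Exchanging sum and integral turns the length into a count over circles.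
-/
theorem lintegral_card_arcsAt (hα : 0 < Real.tan α) (hc : 0 < Real.cos α) :
    ∫⁻ ρ, ((T.arcsAt ρ).card : ℝ≥0∞) = ENNReal.ofReal (Real.cos α * T.length) := by
  classical
  have : (fun ρ => ((T.arcsAt ρ).card : ℝ≥0∞)) = fun ρ => ∑ v : T.V,
      (Set.Ioc ‖T.pos (T.parent v)‖ ‖T.pos v‖).indicator 1 ρ := by
    funext ρ
    simp only [arcsAt, Finset.card_filter, Set.indicator_apply, Pi.one_apply]
    push_cast
    rfl
  rw [this, MeasureTheory.lintegral_finsetSum _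
    fun v _ => measurable_one.indicator measurableSet_Ioc]
  rw [T.length_eq hc, mul_inv_cancel_left₀ hc.ne',
    ENNReal.ofReal_sum_of_nonneg fun v _ => sub_nonneg.2 (T.norm_parent_le hα v)]
  refine Finset.sum_congr rfl fun v _ => ?_
  rw [MeasureTheory.lintegral_indicator_one measurableSet_Ioc, Real.volume_Ioc]

end SpiralSubtree

end SpiralTrees
namespace SpiralTrees

/-! ### Spiral regions, angles and wedges in logarithmic coordinates -/

/-- A line in logarithmic coordinates is a curve that makes a constant angle with the direction to
the root. Only this inclusion is needed, because the emptiness hypothesis on the terminals is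
applied by contraposition. -/
theorem cyl_mem_spiralRegion {α : ℝ} (h0 : 0 < α) (h1 : α < Real.pi / 2) {h θ h' θ' : ℝ}
    (hθ : |θ' - θ| ≤ h' - h) : cyl α h' θ' ∈ spiralRegion α (cyl α h θ) := by
  have hc : 0 < Real.cos α := Real.cos_pos_of_mem_Ioo ⟨by linarith, h1⟩
  set w : ℂ := (-(h' - h) : ℝ) + (Real.tan α * (θ' - θ) : ℝ) * Complex.I with hw
  have hre : w.re = -(h' - h) := by simp [hw, -Complex.ofReal_mul, -Complex.ofReal_sub]
  have him : w.im = Real.tan α * (θ' - θ) := by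
    simp [hw, -Complex.ofReal_mul, -Complex.ofReal_sub]
  have hd : ∀ s : ℝ, HasDerivAt (fun s : ℝ => cyl α h θ * Complex.exp (s * w))
      (cyl α h θ * Complex.exp (s * w) * w) s := by
    intro s
    have h1 : HasDerivAt (fun s : ℝ => (s : ℂ) * w) (1 * w) s :=
      (Complex.ofRealCLM.hasDerivAt (x := s)).mul_const w
    simpa [mul_assoc] using (h1.cexp).const_mul (cyl α h θ)
  refine ⟨fun s => cyl α h θ * Complex.exp (s * w), ⟨?_, ∅, Set.finite_empty, ?_⟩, by simp, ?_⟩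
  · exact fun s _ => (hd s).continuousAt.continuousWithinAt
  · intro s _
    refine ⟨_, hd s, ?_⟩
    by_cases hw0 : w = 0
    · left; simp [hw0]
    right; right
    set γ := cyl α h θ * Complex.exp (s * w) with hγ
    have hγ0 : γ ≠ 0 := mul_ne_zero (cyl_ne_zero _ _ _) (Complex.exp_ne_zero _)
    have hin : inner ℝ (γ * w) (-γ) = (h' - h) * (‖γ‖ * ‖γ‖) := by
      rw [Complex.inner, Complex.norm_mul_self_eq_normSq, Complex.normSq_apply,
        ← neg_eq_iff_eq_neg.2 hre]
      simp
      ring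
    unfold InnerProductGeometry.angle
    rw [hin]
    -- The cosine of the constant angle is `(h' - h) / |w|`, where `|w|² = (h' - h)² + tan² α (θ' -
    -- θ)² ≤ sec² α (h' - h)²` by the cone condition.
    have hle : Real.cos α ≤ (h' - h) * (‖γ‖ * ‖γ‖) / (‖γ * w‖ * ‖-γ‖) := by
      have hwn : 0 < ‖w‖ := norm_pos_iff.2 hw0
      have hγn : 0 < ‖γ‖ := norm_pos_iff.2 hγ0
      have e : (h' - h) * (‖γ‖ * ‖γ‖) / (‖γ * w‖ * ‖-γ‖) = (h' - h) / ‖w‖ := by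
        rw [norm_mul γ w, norm_neg, div_eq_div_iff (by positivity) hwn.ne']; ring
      rw [e, le_div_iff₀ hwn]
      have hn : 0 ≤ h' - h := (abs_nonneg _).trans hθ
      refine le_of_sq_le_sq ?_ hn
      rw [mul_pow, ← Complex.normSq_eq_norm_sq, Complex.normSq_apply, hre, him]
      have h2 : (θ' - θ) ^ 2 ≤ (h' - h) ^ 2 := by
        rw [← sq_abs]; exact pow_le_pow_left₀ (abs_nonneg _) hθ 2
      have h3 : Real.cos α * Real.tan α = Real.sin α := by
        rw [mul_comm, Real.tan_mul_cos hc.ne']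
      have h4 := Real.sin_sq_add_cos_sq α
      have h5 : Real.cos α ^ 2 * (-(h' - h) * -(h' - h) +
          Real.tan α * (θ' - θ) * (Real.tan α * (θ' - θ))) =
          Real.cos α ^ 2 * (h' - h) ^ 2 + Real.sin α ^ 2 * (θ' - θ) ^ 2 := by
        rw [← h3]; ring
      rw [h5]
      nlinarith [sq_nonneg (Real.sin α)]
    calc _ ≤ Real.arccos (Real.cos α) := Real.arccos_le_arccos hle
      _ = α := Real.arccos_cos h0.le (by linarith)
  · simp only [cyl, ← Complex.exp_add, hw]
    congr 1
    push_cast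
    ring

theorem arg_cyl {α : ℝ} (h θ : ℝ) : ∃ m : ℤ, (cyl α h θ).arg = Real.tan α * θ + m * (2 * Real.pi) := by
  have h1 : (cyl α h θ).arg = toIocMod Real.two_pi_pos (-Real.pi) (Real.tan α * θ) := by
    rw [cyl, Complex.exp_add, ← Complex.ofReal_exp,
      Complex.arg_real_mul _ (Real.exp_pos _), Complex.arg_exp_mul_I]
  have h2 := toIocMod_add_toIocDiv_zsmul Real.two_pi_pos (-Real.pi) (Real.tan α * θ)
  refine ⟨-toIocDiv Real.two_pi_pos (-Real.pi) (Real.tan α * θ), ?_⟩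
  rw [h1]
  simp only [zsmul_eq_mul] at h2
  push_cast
  linarith

theorem ccwAngle_cyl {α : ℝ} (hα : 0 < Real.tan α) {h θ h' θ' : ℝ} (h1 : θ ≤ θ')
    (h2 : θ' < θ + period α) : ccwAngle (cyl α h θ) (cyl α h' θ') = Real.tan α * (θ' - θ) := by
  obtain ⟨m, hm⟩ := arg_cyl (α := α) h θ
  obtain ⟨m', hm'⟩ := arg_cyl (α := α) h' θ'
  have hp : Real.tan α * period α = 2 * Real.pi := by
    unfold period; field_simp
  unfold ccwAngle
  rw [toIcoMod_eq_iff]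
  refine ⟨⟨mul_nonneg hα.le (by linarith), ?_⟩, m' - m, ?_⟩
  · rw [zero_add, ← hp]
    exact mul_lt_mul_of_pos_left (by linarith) hα
  · rw [hm, hm', zsmul_eq_mul]; push_cast; ring

/-- Every scaled angle has a representative in a given period. -/
theorem exists_shift {α : ℝ} (hα : 0 < Real.tan α) (θ ψ : ℝ) :
    ∃ m : ℤ, θ ≤ ψ + m * period α ∧ ψ + m * period α < θ + period α := by
  obtain ⟨m, hm, -⟩ := existsUnique_add_zsmul_mem_Ico (period_pos hα) ψ θ
  exact ⟨m, by simpa using hm.1, by simpa using hm.2⟩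

theorem cyl_mem_wedge {α : ℝ} (hα : 0 < Real.tan α) {h θ h' θ' a ψ : ℝ} (h1 : θ ≤ θ')
    (h2 : θ' < θ + period α) : cyl α a ψ ∈ wedge (cyl α h θ) (cyl α h' θ') ↔
      ∃ m : ℤ, θ ≤ ψ + m * period α ∧ ψ + m * period α ≤ θ' := by
  obtain ⟨m, hm, hm'⟩ := exists_shift hα θ ψ
  have e : ccwAngle (cyl α h θ) (cyl α a ψ) = Real.tan α * (ψ + m * period α - θ) := by
    rw [← cyl_add_period hα a ψ m, ccwAngle_cyl hα hm hm']
  unfold wedge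
  rw [Set.mem_ofPred_eq, or_iff_right (cyl_ne_zero _ _ _), e, ccwAngle_cyl hα h1 h2,
    mul_le_mul_iff_right₀ hα]
  constructor
  · intro hle
    exact ⟨m, hm, by linarith⟩
  · rintro ⟨k, hk, hk'⟩
    have hp := period_pos hα
    -- Both `m` and `k` move `ψ` into the same half-open period starting at `θ`.
    have : m = k := by
      have h3 : ((m - k : ℤ) : ℝ) * period α < 1 * period α := by push_cast; linarith
      have h4 : ((k - m : ℤ) : ℝ) * period α < 1 * period α := by push_cast; linarith
      have h5 := lt_of_mul_lt_mul_right h3 hp.le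
      have h6 := lt_of_mul_lt_mul_right h4 hp.le
      norm_cast at h5 h6
      omega
    subst this
    linarith

theorem Ccw_cyl {α : ℝ} (hα : 0 < Real.tan α) {h₁ h₂ h₃ θ₁ θ₂ θ₃ : ℝ} (h12 : θ₁ < θ₂)
    (h23 : θ₂ < θ₃) (h31 : θ₃ < θ₁ + period α) :
    Ccw (cyl α h₁ θ₁) (cyl α h₂ θ₂) (cyl α h₃ θ₃) := by
  unfold Ccw
  rw [ccwAngle_cyl hα h12.le (by linarith), ccwAngle_cyl hα (h12.trans h23).le h31]
  exact ⟨mul_pos hα (by linarith), mul_lt_mul_of_pos_left (by linarith) hα⟩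

/-! ### Lifts of the terminals -/

section Lifts

variable {n : ℕ} [NeZero n]

/-- Reduction of an integer to a cyclic index. -/
def red (n : ℕ) [NeZero n] (a : ℤ) : Fin n :=
  ⟨(a % n).toNat, by
    have hn : (0 : ℤ) < n := by exact_mod_cast NeZero.pos n
    have h1 := Int.emod_lt_of_pos a hn
    have h2 := Int.emod_nonneg a hn.ne'
    omega⟩

theorem red_val (a : ℤ) : ((red n a).val : ℤ) = a % n := by
  have hn : (n : ℤ) ≠ 0 := by exact_mod_cast NeZero.ne n
  have := Int.emod_nonneg a hn
  simp only [red]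
  omega

theorem red_ext {a b : ℤ} : red n a = red n b ↔ a % n = b % n := by
  rw [Fin.ext_iff, ← @Nat.cast_inj ℤ, red_val, red_val]

theorem red_coe (i : Fin n) : red n i.val = i := by
  rw [Fin.ext_iff, ← @Nat.cast_inj ℤ, red_val]
  exact Int.emod_eq_of_lt (by positivity) (by exact_mod_cast i.2)

theorem red_add (a b : ℤ) : red n (a + b) = red n a + red n b := by
  rw [Fin.ext_iff, ← @Nat.cast_inj ℤ, red_val, Fin.val_add]
  push_cast
  rw [red_val, red_val, ← Int.add_emod]

theorem red_one : red n 1 = 1 := by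
  rw [Fin.ext_iff, ← @Nat.cast_inj ℤ, red_val]
  simp

theorem red_add_mul (a m : ℤ) : red n (a + n * m) = red n a := by
  rw [red_ext]; simp

theorem red_sub_val {a b : ℤ} (h : a ≤ b) (h' : b < a + n) :
    ((red n b - red n a).val : ℤ) = b - a := by
  have h1 : red n b - red n a = red n (b - a) := by
    rw [sub_eq_iff_eq_add, ← red_add, sub_add_cancel]
  rw [h1, red_val]
  exact Int.emod_eq_of_lt (by omega) (by omega)

/-- Every pair of cyclic indices is the reduction of a unique kind of integer interval. -/
theorem exists_red (i j : Fin n) : ∃ a b : ℤ, red n a = i ∧ red n b = j ∧ a ≤ b ∧ b < a + n := by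
  refine ⟨i.val, i.val + (j - i).val, red_coe i, ?_, by simp, by simp⟩
  rw [red_add, red_coe, red_coe, add_sub_cancel]

variable (α : ℝ) (t : Fin n → ℂ)

/-- The scaled angle of the lift `a`. -/
def liftAngle (a : ℤ) : ℝ :=
  ((t 0).arg + ccwAngle (t 0) (t (red n a))) / Real.tan α + (a / n : ℤ) * period α

/-- The logarithmic height of the lift `a`. -/
def liftHeight (a : ℤ) : ℝ := -Real.log ‖t (red n a)‖

/-- The coordinate of the lift `a` that is constant along right spirals. -/
def liftX (a : ℤ) : ℝ := liftAngle α t a - liftHeight t a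

/-- The coordinate of the lift `a` that is constant along left spirals. -/
def liftY (a : ℤ) : ℝ := liftAngle α t a + liftHeight t a

/-- The height of the join point of the lifts `a ≤ b`. -/
def joinHeight (a b : ℤ) : ℝ := (liftY α t b - liftX α t a) / 2

/-- The join point of the lifts `a ≤ b`. -/
def liftJoin (a b : ℤ) : ℂ := cyl α (joinHeight α t a b) ((liftX α t a + liftY α t b) / 2)

variable {α t}

theorem liftHeight_eq (a : ℤ) : liftHeight t a = (liftY α t a - liftX α t a) / 2 := by
  unfold liftX liftY; ring

theorem liftAngle_eq (a : ℤ) : liftAngle α t a = (liftX α t a + liftY α t a) / 2 := by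
  unfold liftX liftY; ring

theorem joinHeight_self (a : ℤ) : joinHeight α t a a = liftHeight t a := by
  rw [joinHeight, ← liftHeight_eq]

theorem liftHeight_add (a m : ℤ) : liftHeight t (a + n * m) = liftHeight t a := by
  rw [liftHeight, red_add_mul]; rfl

theorem liftAngle_add (a m : ℤ) : liftAngle α t (a + n * m) = liftAngle α t a + m * period α := by
  have hn : (n : ℤ) ≠ 0 := by exact_mod_cast NeZero.ne n
  unfold liftAngle
  rw [red_add_mul, Int.add_mul_ediv_left _ _ hn]
  push_cast
  ring

theorem liftX_add (a m : ℤ) : liftX α t (a + n * m) = liftX α t a + m * period α := by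
  rw [liftX, liftX, liftAngle_add, liftHeight_add]; ring

theorem liftY_add (a m : ℤ) : liftY α t (a + n * m) = liftY α t a + m * period α := by
  rw [liftY, liftY, liftAngle_add, liftHeight_add]; ring

/-! ### Monotonicity of the lifts, and join points -/

namespace IsInstance

variable (H : IsInstance α t)
include H

theorem tan_pos : 0 < Real.tan α := Real.tan_pos_of_pos_of_lt_pi_div_two H.alpha_pos H.alpha_lt

theorem cos_pos : 0 < Real.cos α :=
  Real.cos_pos_of_mem_Ioo ⟨by linarith [H.alpha_pos, Real.pi_pos], H.alpha_lt⟩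

theorem cyl_lift (a : ℤ) : t (red n a) = cyl α (liftHeight t a) (liftAngle α t a) := by
  unfold liftAngle
  rw [cyl_add_period H.tan_pos, cyl, mul_div_cancel₀ _ H.tan_pos.ne', liftHeight, neg_neg,
    Complex.exp_add, ← Complex.ofReal_exp, Real.exp_log (norm_pos_iff.2 (H.ne_root _))]
  have h1 := toIcoMod_add_toIcoDiv_zsmul Real.two_pi_pos 0 ((t (red n a)).arg - (t 0).arg)
  rw [zsmul_eq_mul] at h1
  have h2 : (t 0).arg + ccwAngle (t 0) (t (red n a)) = (t (red n a)).arg -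
      (toIcoDiv Real.two_pi_pos 0 ((t (red n a)).arg - (t 0).arg)) * (2 * Real.pi) := by
    unfold ccwAngle; linarith
  rw [h2]
  have h3 : Complex.exp (((t (red n a)).arg - (toIcoDiv Real.two_pi_pos 0
      ((t (red n a)).arg - (t 0).arg)) * (2 * Real.pi) : ℝ) * Complex.I) =
      Complex.exp ((t (red n a)).arg * Complex.I) := by
    rw [Complex.exp_eq_exp_iff_exists_int]
    refine ⟨-toIcoDiv Real.two_pi_pos 0 ((t (red n a)).arg - (t 0).arg), ?_⟩
    push_cast
    ring
  rw [h3, Complex.norm_mul_exp_arg_mul_I]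

/-- Inside one block of `n` indices this is the radial numbering of the terminals; between blocks, a
counterclockwise angle is less than `2π`, so it cannot make up for a whole period. -/
theorem liftAngle_mono : Monotone (liftAngle α t) := by
  intro a b hab
  have hn : (0 : ℤ) < n := by exact_mod_cast NeZero.pos n
  have hp := period_pos H.tan_pos
  have hdiv : a / n ≤ b / n := Int.ediv_le_ediv hn hab
  unfold liftAngle
  rcases hdiv.lt_or_eq with hlt | heq
  · have h1 := toIcoMod_mem_Ico Real.two_pi_pos 0 ((t (red n a)).arg - (t 0).arg)
    have h2 := toIcoMod_mem_Ico Real.two_pi_pos 0 ((t (red n b)).arg - (t 0).arg)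
    have h3 : ((a / n : ℤ) : ℝ) + 1 ≤ (b / n : ℤ) := by exact_mod_cast hlt
    have h4 : ((t 0).arg + ccwAngle (t 0) (t (red n a))) / Real.tan α ≤
        ((t 0).arg + ccwAngle (t 0) (t (red n b))) / Real.tan α + period α := by
      unfold period
      rw [← add_div]
      refine div_le_div_of_nonneg_right ?_ H.tan_pos.le
      unfold ccwAngle
      linarith [h1.2, h2.1]
    nlinarith
  · rw [heq]
    refine add_le_add_left (div_le_div_of_nonneg_right (add_le_add_right (H.radial ?_) _)
      H.tan_pos.le) _
    rw [Fin.le_def, ← @Nat.cast_le ℤ, red_val, red_val, Int.emod_def, Int.emod_def, heq]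
    linarith

/-- Lifts of one terminal differ by whole periods at equal height. For different terminals the
angles are weakly ordered; if `X` failed to increase, `b` would lie in the cone of `a`, and if `Y`
failed to increase, `a` would lie in the cone of `b`. -/
theorem lift_strict {a b : ℤ} (hab : a < b) :
    liftX α t a < liftX α t b ∧ liftY α t a < liftY α t b := by
  have hn : (0 : ℤ) < n := by exact_mod_cast NeZero.pos n
  by_cases hr : red n a = red n b
  · rw [red_ext] at hr
    obtain ⟨m, hm⟩ := Int.ModEq.dvd hr
    have hb : b = a + n * m := by omega
    have hm0 : 0 < m := by nlinarith
    have : (0 : ℝ) < m * period α := mul_pos (by exact_mod_cast hm0) (period_pos H.tan_pos)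
    rw [hb, liftX_add, liftY_add]
    constructor <;> linarith
  · have h1 := H.liftAngle_mono hab.le
    have h2 := H.empty _ _ (Ne.symm hr)
    have h3 := H.empty _ _ hr
    rw [H.cyl_lift a, H.cyl_lift b] at h2 h3
    unfold liftX liftY
    by_contra hcon
    rw [not_and_or, not_lt, not_lt] at hcon
    rcases hcon with hc | hc
    · exact h2 (cyl_mem_spiralRegion H.alpha_pos H.alpha_lt
        (abs_le.2 ⟨by linarith, by linarith⟩))
    · exact h3 (cyl_mem_spiralRegion H.alpha_pos H.alpha_lt
        (abs_le.2 ⟨by linarith, by linarith⟩))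

theorem liftX_strictMono : StrictMono (liftX α t) := fun _ _ h => (H.lift_strict h).1

theorem liftY_strictMono : StrictMono (liftY α t) := fun _ _ h => (H.lift_strict h).2

omit H in
theorem norm_liftJoin (a b : ℤ) : ‖liftJoin α t a b‖ = Real.exp (-joinHeight α t a b) :=
  norm_cyl _ _ _

theorem joinHeight_lt_left {a a' b : ℤ} (h : a' < a) :
    joinHeight α t a b < joinHeight α t a' b := by
  have := H.liftX_strictMono h
  unfold joinHeight; linarith

theorem joinHeight_lt_right {a b b' : ℤ} (h : b < b') :
    joinHeight α t a b < joinHeight α t a b' := by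
  have := H.liftY_strictMono h
  unfold joinHeight; linarith

theorem liftHeight_le_joinHeight {a b k : ℤ} (h : a ≤ k) (h' : k ≤ b) :
    liftHeight t k ≤ joinHeight α t a b := by
  have := H.liftX_strictMono.monotone h
  have := H.liftY_strictMono.monotone h'
  rw [liftHeight_eq (α := α)]
  unfold joinHeight; linarith

theorem liftHeight_lt_joinHeight {a b k : ℤ} (h : a ≤ k) (h' : k ≤ b) (hab : a < b) :
    liftHeight t k < joinHeight α t a b := by
  rcases h.eq_or_lt with rfl | h
  · rw [← joinHeight_self (α := α)]; exact H.joinHeight_lt_right hab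
  · exact (H.liftHeight_le_joinHeight le_rfl h').trans_lt (H.joinHeight_lt_left h)

/-- The right spiral from `a` meets the left spirals from all translates `b + n q` with `a ≤ b + n
q`, at heights that increase with `q`. As `b < a + n`, the first of them is `q = 0`. -/
theorem isSpiralIntersection_iff {a b : ℤ} (h : a ≤ b) (h' : b < a + n) {x : ℂ} :
    IsSpiralIntersection α (t (red n a)) (t (red n b)) x ↔ x = liftJoin α t a b := by
  have hp := period_pos H.tan_pos
  have hn : (0 : ℤ) < n := by exact_mod_cast NeZero.pos n
  have hY := H.liftY_strictMono.monotone h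
  have hX := H.liftX_strictMono.monotone h
  have hmem : liftJoin α t a b ∈ rightSpiral α (t (red n a)) '' Set.Ici 0 ∩
      leftSpiral α (t (red n b)) '' Set.Ici 0 := by
    constructor
    · refine ⟨joinHeight α t a b - liftHeight t a, ?_, ?_⟩
      · exact sub_nonneg.2 (H.liftHeight_le_joinHeight le_rfl h)
      · have := spiral_cyl α false (liftHeight t a) (liftAngle α t a)
          (joinHeight α t a b - liftHeight t a)
        rw [H.cyl_lift a]
        refine Eq.trans this ?_
        unfold liftJoin sgn joinHeight liftX liftY
        congr 1
        · ring
        · simp; ring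
    · refine ⟨joinHeight α t a b - liftHeight t b, ?_, ?_⟩
      · exact sub_nonneg.2 (H.liftHeight_le_joinHeight h le_rfl)
      · have := spiral_cyl α true (liftHeight t b) (liftAngle α t b)
          (joinHeight α t a b - liftHeight t b)
        rw [H.cyl_lift b]
        refine Eq.trans this ?_
        unfold liftJoin sgn joinHeight liftX liftY
        congr 1
        · ring
        · simp; ring
  have hall : ∀ y ∈ rightSpiral α (t (red n a)) '' Set.Ici 0 ∩
      leftSpiral α (t (red n b)) '' Set.Ici 0, ‖y‖ ≤ ‖liftJoin α t a b‖ ∧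
        (‖y‖ = ‖liftJoin α t a b‖ → y = liftJoin α t a b) := by
    rintro _ ⟨⟨s, hs, rfl⟩, s', hs', he⟩
    have e1 := spiral_cyl α false (liftHeight t a) (liftAngle α t a) s
    have e2 := spiral_cyl α true (liftHeight t b) (liftAngle α t b) s'
    simp only [spiral, if_true, Bool.false_eq_true, if_false, ← H.cyl_lift, sgn] at e1 e2
    rw [e2, e1, cyl_eq_iff H.tan_pos] at he
    obtain ⟨hh, m, hm⟩ := he
    have hY' : liftY α t (b + n * (-m)) = liftX α t a + 2 * (liftHeight t a + s) := by
      rw [liftY_add]; unfold liftX liftY; push_cast; linarith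
    have hs0 : 0 ≤ s := hs
    have hge : liftY α t a ≤ liftY α t (b + n * (-m)) := by
      rw [hY']; unfold liftX liftY; linarith
    have hbm : a ≤ b + n * (-m) := H.liftY_strictMono.le_iff_le.1 hge
    -- Otherwise `b + n * (-m) ≤ b - n < a`, against `hbm`.
    have hm1 : -m > -1 := by
      by_contra hcon
      nlinarith
    have hble : b ≤ b + n * (-m) := by nlinarith
    have hYY := H.liftY_strictMono.monotone hble
    rw [e1, norm_cyl, norm_liftJoin]
    refine ⟨Real.exp_le_exp.2 ?_, fun heq => ?_⟩
    · unfold joinHeight; linarith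
    · rw [Real.exp_eq_exp, neg_inj] at heq
      unfold liftJoin
      rw [heq]
      congr 1
      unfold joinHeight at heq
      unfold liftX at hY' heq ⊢
      linarith
  constructor
  · rintro ⟨hg, hx⟩
    exact (hall x hx).2 (le_antisymm (hall x hx).1 (hg.2 ⟨_, hmem, rfl⟩))
  · rintro rfl
    refine ⟨⟨⟨_, hmem, rfl⟩, ?_⟩, hmem⟩
    rintro _ ⟨y, hy, rfl⟩
    exact (hall y hy).1

theorem joinPoint_eq {a b : ℤ} (h : a ≤ b) (h' : b < a + n) :
    joinPoint α t (red n a) (red n b) = liftJoin α t a b :=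
  (H.isSpiralIntersection_iff h h').1
    (Classical.epsilon_spec ⟨_, (H.isSpiralIntersection_iff h h').2 rfl⟩)

theorem existsUnique_isSpiralIntersection (i j : Fin n) :
    ∃! x, IsSpiralIntersection α (t i) (t j) x := by
  obtain ⟨a, b, rfl, rfl, h, h'⟩ := exists_red i j
  exact ⟨_, (H.isSpiralIntersection_iff h h').2 rfl,
    fun y hy => (H.isSpiralIntersection_iff h h').1 hy⟩

/-- `b < a + n` gives strict inequalities for `X` and `Y` between `b` and the translate of `a`, and
the angle is their mean. Every wedge is thus strictly narrower than a period. -/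
theorem liftAngle_lt_add_period {a b : ℤ} (h' : b < a + n) :
    liftAngle α t b < liftAngle α t a + period α := by
  have h1 := H.lift_strict (a := b) (b := a + n * 1) (by linarith)
  rw [liftX_add, liftY_add] at h1
  rw [liftAngle_eq, liftAngle_eq]
  push_cast at h1
  linarith [h1.1, h1.2]

theorem cyl_mem_wedge_iff {a b : ℤ} (h : a ≤ b) (h' : b < a + n) {u ψ : ℝ} :
    cyl α u ψ ∈ wedge (t (red n a)) (t (red n b)) ↔
      ∃ m : ℤ, liftAngle α t a ≤ ψ + m * period α ∧ ψ + m * period α ≤ liftAngle α t b := by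
  rw [H.cyl_lift a, H.cyl_lift b]
  exact cyl_mem_wedge H.tan_pos (H.liftAngle_mono h) (H.liftAngle_lt_add_period h')

theorem joinPoint_mem_wedge (i j : Fin n) : joinPoint α t i j ∈ wedge (t i) (t j) := by
  obtain ⟨a, b, rfl, rfl, h, h'⟩ := exists_red i j
  rw [H.joinPoint_eq h h', liftJoin, H.cyl_mem_wedge_iff h h']
  have hY := H.liftY_strictMono.monotone h
  have hX := H.liftX_strictMono.monotone h
  refine ⟨0, ?_, ?_⟩ <;> rw [liftAngle_eq] <;> push_cast <;> linarith

theorem liftJoin_self (a : ℤ) : liftJoin α t a a = t (red n a) := by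
  rw [H.cyl_lift, liftJoin, joinHeight_self, liftAngle_eq]

theorem joinPoint_self (i : Fin n) : joinPoint α t i i = t i := by
  have hn : (0 : ℤ) < n := by exact_mod_cast NeZero.pos n
  rw [← red_coe i, H.joinPoint_eq le_rfl (by linarith), H.liftJoin_self]

end IsInstance

end Lifts

end SpiralTrees
namespace SpiralTrees

/-! ### Leftmost selections -/

/-- In the set `K` there is the graph of a `1`-Lipschitz function from `(h₀, a)` to `(h₁, b)`. -/
def Sel (K : Set (ℝ × ℝ)) (h₀ a h₁ b : ℝ) : Prop :=
  h₀ ≤ h₁ ∧ ∃ g : ℝ → ℝ, (∀ s u, |g s - g u| ≤ |s - u|) ∧ g h₀ = a ∧ g h₁ = b ∧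
    ∀ h, h₀ ≤ h → h ≤ h₁ → (h, g h) ∈ K

/-- The least end point at height `h` of a selection that starts at `(h₀, a)`. -/
def leftmost (K : Set (ℝ × ℝ)) (h₀ a h : ℝ) : ℝ := sInf {b | Sel K h₀ a h b}

/-- A set with finitely many points at each height (locally) in which one can always continue,
up to heights in `D`. -/
structure FlowSet (K : Set (ℝ × ℝ)) (D : Set ℝ) : Prop where
  finite : ∀ h M, {b | (h, b) ∈ K ∧ |b| ≤ M}.Finite
  forward : ∀ h a h', (h, a) ∈ K → h ≤ h' → h' ∈ D → ∃ b, Sel K h a h' b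

section Sel

variable {K : Set (ℝ × ℝ)} {D : Set ℝ} {h₀ h₁ h₂ a b c : ℝ}

theorem Sel.trans (H₁ : Sel K h₀ a h₁ b) (H₂ : Sel K h₁ b h₂ c) : Sel K h₀ a h₂ c := by
  obtain ⟨h01, g, hg, hga, hgb, hgK⟩ := H₁
  obtain ⟨h12, g', hg', hga', hgb', hgK'⟩ := H₂
  have key : ∀ s, h₁ ≤ s → (if s ≤ h₁ then g s else g' s) = g' s := by
    intro s hs
    split_ifs with h
    · rw [le_antisymm h hs, hgb, hga']
    · rfl
  refine ⟨h01.trans h12, fun s => if s ≤ h₁ then g s else g' s,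
    lipschitz_glue hg hg' (hgb.trans hga'.symm), by simp only [if_pos h01, hga],
    (key _ h12).trans hgb', fun h hh hh' => ?_⟩
  rcases le_total h h₁ with hle | hle
  · simp only [if_pos hle]; exact hgK h hh hle
  · simp only [key _ hle]; exact hgK' h hle hh'

theorem Sel.split (H : Sel K h₀ a h₂ c) (h01 : h₀ ≤ h₁) (h12 : h₁ ≤ h₂) :
    ∃ b, Sel K h₀ a h₁ b ∧ Sel K h₁ b h₂ c := by
  obtain ⟨-, g, hg, hga, hgb, hgK⟩ := H
  exact ⟨g h₁, ⟨h01, g, hg, hga, rfl, fun h e1 e2 => hgK h e1 (e2.trans h12)⟩,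
    ⟨h12, g, hg, rfl, hgb, fun h e1 e2 => hgK h (h01.trans e1) e2⟩⟩

theorem Sel.abs_sub_le (H : Sel K h₀ a h₁ b) : |b - a| ≤ h₁ - h₀ := by
  obtain ⟨h01, g, hg, rfl, rfl, -⟩ := H
  simpa [abs_of_nonneg (sub_nonneg.2 h01)] using hg h₁ h₀

theorem Sel.mem_right (H : Sel K h₀ a h₁ b) : (h₁, b) ∈ K := by
  obtain ⟨h01, g, hg, rfl, rfl, hK⟩ := H
  exact hK _ h01 le_rfl

/-- Two selections that change their order cross, so that one can switch. -/
theorem Sel.crossing {a' b' : ℝ} (H : Sel K h₀ a h₁ b) (H' : Sel K h₀ a' h₁ b') (ha : a ≤ a') :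
    ∃ c ≤ b', Sel K h₀ a h₁ c := by
  rcases le_or_gt b b' with hb | hb
  · exact ⟨b, hb, H⟩
  refine ⟨b', le_rfl, ?_⟩
  obtain ⟨h01, g, hg, rfl, rfl, hgK⟩ := H
  obtain ⟨-, g', hg', rfl, rfl, hgK'⟩ := H'
  have hcont : ∀ {f : ℝ → ℝ}, (∀ s u, |f s - f u| ≤ |s - u|) → Continuous f := fun hf =>
    (LipschitzWith.of_dist_le_mul (K := 1) fun a b => by
      simpa [Real.dist_eq] using hf a b).continuous
  obtain ⟨c, hc, hc'⟩ := intermediate_value_Icc' h01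
    ((hcont hg').sub (hcont hg)).continuousOn
    (show (0 : ℝ) ∈ Set.Icc (g' h₁ - g h₁) (g' h₀ - g h₀) from ⟨by linarith, by linarith⟩)
  have hgc : g c = g' c := by simp only [Pi.sub_apply] at hc'; linarith
  exact Sel.trans (h₁ := c) (b := g c)
    ⟨hc.1, g, hg, rfl, rfl, fun h e1 e2 => hgK h e1 (e2.trans hc.2)⟩
    ⟨hc.2, g', hg', hgc.symm, rfl, fun h e1 e2 => hgK' h (hc.1.trans e1) e2⟩

theorem leftmost_le (H : Sel K h₀ a h₁ b) : leftmost K h₀ a h₁ ≤ b := by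
  refine csInf_le ⟨a - (h₁ - h₀), fun c hc => ?_⟩ H
  have := (abs_le.1 (Sel.abs_sub_le hc)).1
  linarith

/-- The Lipschitz bound confines the possible end points to a bounded part of a locally finite set,
so the infimum is attained. -/
theorem FlowSet.sel_leftmost (F : FlowSet K D) (ha : (h₀, a) ∈ K) (h01 : h₀ ≤ h₁) (h1 : h₁ ∈ D) :
    Sel K h₀ a h₁ (leftmost K h₀ a h₁) := by
  have hfin : {b | Sel K h₀ a h₁ b}.Finite := by
    refine (F.finite h₁ (|a| + (h₁ - h₀))).subset fun b hb => ⟨hb.mem_right, ?_⟩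
    have h2 := Sel.abs_sub_le hb
    have h3 := abs_sub_abs_le_abs_sub b a
    linarith
  exact Set.Nonempty.csInf_mem (F.forward _ _ _ ha h01 h1) hfin

theorem FlowSet.leftmost_self (F : FlowSet K D) (ha : (h₀, a) ∈ K) (h0 : h₀ ∈ D) :
    leftmost K h₀ a h₀ = a := by
  have := (F.sel_leftmost ha le_rfl h0).abs_sub_le
  rw [sub_self] at this
  exact sub_eq_zero.1 (abs_eq_zero.1 (le_antisymm this (abs_nonneg _)))

/-- The order of two leftmost end points persists. Cut the optimal second selection at height `h`:
it is then at or to the right of the first leftmost value, and a continuation of the first selection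
that ended farther right would cross it and could switch. Used in one direction this preserves
order, in both directions it preserves coincidence. -/
theorem FlowSet.leftmost_mono_time (F : FlowSet K D) (hD : IsLowerSet D) {g₀ a' h : ℝ}
    (ha : (h₀, a) ∈ K) (ha' : (g₀, a') ∈ K) (h0 : h₀ ≤ h) (h0' : g₀ ≤ h) (hh : h ≤ h₁)
    (h1 : h₁ ∈ D) (hle : leftmost K h₀ a h ≤ leftmost K g₀ a' h) :
    leftmost K h₀ a h₁ ≤ leftmost K g₀ a' h₁ := by
  have hhD : h ∈ D := hD hh h1
  obtain ⟨c, hc, hc'⟩ := (F.sel_leftmost ha' (h0'.trans hh) h1).split h0' hh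
  have hS := F.sel_leftmost ha h0 hhD
  obtain ⟨d, hd⟩ := F.forward _ _ _ hS.mem_right hh h1
  obtain ⟨e, he, he'⟩ := hd.crossing hc' (hle.trans (leftmost_le hc))
  exact (leftmost_le (hS.trans he')).trans he

end Sel

/-! ### Coalescing families -/

section Coalescing

variable {n : ℕ} [NeZero n] {α : ℝ} {t : Fin n → ℂ}

/-- A family of functions, one for each lift in `S`, defined from the height of the lift on (up to
heights in `D`), that stay in the order of the lifts, stay together once they meet, and stay in the
cones of the lifts. -/
structure Coalescing (α : ℝ) (t : Fin n → ℂ) (S : Set ℤ) (D : Set ℝ) (L : ℤ → ℝ → ℝ) : Prop where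
  mono : ∀ a ∈ S, ∀ b ∈ S, a ≤ b → ∀ h ∈ D, liftHeight t a ≤ h → liftHeight t b ≤ h → L a h ≤ L b h
  perm : ∀ a ∈ S, ∀ b ∈ S, ∀ h, ∀ h' ∈ D, liftHeight t a ≤ h → liftHeight t b ≤ h → h ≤ h' →
    L a h = L b h → L a h' = L b h'
  lower : ∀ a ∈ S, ∀ h ∈ D, liftHeight t a ≤ h → liftY α t a - h ≤ L a h
  upper : ∀ a ∈ S, ∀ h ∈ D, liftHeight t a ≤ h → L a h ≤ liftX α t a + h

open Classical in
/-- The values at height `h` of the functions with indices in `[i, j]`. -/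
def valuesAt (t : Fin n → ℂ) (L : ℤ → ℝ → ℝ) (i j : ℤ) (h : ℝ) : Finset ℝ :=
  ((Finset.Icc i j).filter fun a => liftHeight t a ≤ h).image fun a => L a h

theorem mem_valuesAt {L : ℤ → ℝ → ℝ} {i j : ℤ} {h x : ℝ} :
    x ∈ valuesAt t L i j h ↔ ∃ a, (i ≤ a ∧ a ≤ j) ∧ liftHeight t a ≤ h ∧ L a h = x := by
  simp only [valuesAt, Finset.mem_image, Finset.mem_filter, Finset.mem_Icc, and_assoc]

/-- Order is established at the height of the lift that starts later: strict monotonicity of `X` and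
`Y` keeps that lift outside the cone of the other one, on the correct side. From there on
`FlowSet.leftmost_mono_time` applies. -/
theorem FlowSet.coalescing (H : IsInstance α t) {K : Set (ℝ × ℝ)} {D : Set ℝ} (F : FlowSet K D)
    (hD : IsLowerSet D) {S : Set ℤ} (hS : ∀ a ∈ S, (liftHeight t a, liftAngle α t a) ∈ K) :
    Coalescing α t S D fun a h => leftmost K (liftHeight t a) (liftAngle α t a) h where
  mono a ha b hb hab h hh h1 h2 := by
    rcases hab.eq_or_lt with rfl | hab
    · exact le_rfl
    obtain ⟨hX, hY⟩ := H.lift_strict hab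
    unfold liftX at hX
    unfold liftY at hY
    rcases le_total (liftHeight t a) (liftHeight t b) with hl | hl
    · refine F.leftmost_mono_time hD (hS a ha) (hS b hb) hl le_rfl h2 hh ?_
      have hb' := hD h2 hh
      rw [F.leftmost_self (hS b hb) hb']
      have := (abs_le.1 (F.sel_leftmost (hS a ha) hl hb').abs_sub_le).2
      linarith
    · refine F.leftmost_mono_time hD (hS a ha) (hS b hb) le_rfl hl h1 hh ?_
      have ha' := hD h1 hh
      rw [F.leftmost_self (hS a ha) ha']
      have := (abs_le.1 (F.sel_leftmost (hS b hb) hl ha').abs_sub_le).1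
      linarith
  perm a ha b hb h h' hh' h1 h2 hle heq :=
    le_antisymm (F.leftmost_mono_time hD (hS a ha) (hS b hb) h1 h2 hle hh' heq.le)
      (F.leftmost_mono_time hD (hS b hb) (hS a ha) h2 h1 hle hh' heq.ge)
  lower a ha h hh h1 := by
    have := (abs_le.1 (F.sel_leftmost (hS a ha) h1 hh).abs_sub_le).1
    unfold liftY; linarith
  upper a ha h hh h1 := by
    have := (abs_le.1 (F.sel_leftmost (hS a ha) h1 hh).abs_sub_le).2
    unfold liftX; linarith

variable {S : Set ℤ} {D : Set ℝ} {L : ℤ → ℝ → ℝ}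

/-- Finitely many coincidences between the two sides of the indices in `[i, j)` force all functions
of `[i, j]` to coincide later. -/
theorem Coalescing.eq_of_coincidences (C : Coalescing α t S D L) {i j : ℤ} (hij : i ≤ j)
    (hS : ∀ k, i ≤ k → k ≤ j → k ∈ S) {h : ℝ} (hh : h ∈ D)
    (halive : ∀ k, i ≤ k → k ≤ j → liftHeight t k ≤ h)
    (hco : ∀ k, i ≤ k → k < j → ∃ a ∈ S, ∃ b ∈ S, a ≤ k ∧ k < b ∧ ∃ h' ≤ h, liftHeight t a ≤ h' ∧
      liftHeight t b ≤ h' ∧ L a h' = L b h') : L i h = L j h := by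
  suffices ∀ d : ℕ, i + d ≤ j → L i h = L (i + d) h by
    have := this (j - i).toNat (by omega)
    rwa [show i + ((j - i).toNat : ℤ) = j by omega] at this
  intro d
  induction d with
  | zero => intro _; simp
  | succ d ih =>
    intro hd
    push_cast at hd
    rw [ih (by omega)]
    obtain ⟨a, ha, b, hb, hak, hkb, h', hh', h1, h2, heq⟩ := hco (i + d) (by omega) (by omega)
    have e := C.perm a ha b hb h' h hh h1 h2 hh' heq
    have k1 : i + (d : ℤ) ∈ S := hS _ (by omega) (by omega)
    have k2 : i + ((d + 1 : ℕ) : ℤ) ∈ S := hS _ (by push_cast; omega) (by push_cast; omega)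
    have a1 := halive (i + d) (by omega) (by omega)
    have a2 := halive (i + ((d + 1 : ℕ) : ℤ)) (by push_cast; omega) (by push_cast; omega)
    have m1 := C.mono a ha _ k1 hak h hh (h1.trans hh') a1
    have m2 := C.mono _ k1 _ k2 (by push_cast; omega) h hh a1 a2
    have m3 := C.mono _ k2 b hb (by push_cast; omega) h hh a2 (h2.trans hh')
    linarith

/-- Otherwise every gap `k | k+1` is closed at some height below the join height. By the maximum `m`
of finitely many such heights all functions coincide, in particular `L i m = L j m`; but `L i m ≤
X_i + m` and `Y_j - m ≤ L j m` then give `m ≥ joinHeight i j`. -/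
theorem Coalescing.exists_split (H : IsInstance α t) (C : Coalescing α t S D L) {i j : ℤ}
    (hij : i < j) (hS : ∀ k, i ≤ k → k ≤ j → k ∈ S) (hD : Set.Iio (joinHeight α t i j) ⊆ D) :
    ∃ k, i ≤ k ∧ k < j ∧ ∀ h < joinHeight α t i j, ∀ a b, i ≤ a → a ≤ k → k < b → b ≤ j →
      liftHeight t a ≤ h → liftHeight t b ≤ h → L a h < L b h := by
  by_contra hcon
  push Not at hcon
  have hch : ∀ k, ∃ h < joinHeight α t i j, i ≤ k → k < j → ∃ a b, i ≤ a ∧ a ≤ k ∧ k < b ∧ b ≤ j ∧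
      liftHeight t a ≤ h ∧ liftHeight t b ≤ h ∧ L b h ≤ L a h := by
    intro k
    by_cases hk : i ≤ k ∧ k < j
    · obtain ⟨h, hh, a, b, h1, h2, h3, h4, h5, h6, h7⟩ := hcon k hk.1 hk.2
      exact ⟨h, hh, fun _ _ => ⟨a, b, h1, h2, h3, h4, h5, h6, h7⟩⟩
    -- An arbitrary height below the join height, so that the maximum below can be taken over the
    -- whole interval `[i, j]`.
    · exact ⟨joinHeight α t i j - 1, by linarith, fun h1 h2 => absurd ⟨h1, h2⟩ hk⟩
  choose f hf hf' using hch
  have hne : (Finset.Icc i j).Nonempty := Finset.nonempty_Icc.2 hij.le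
  set m := (Finset.Icc i j).sup' hne fun k => max (f k) (liftHeight t k) with hm
  have hmlt : m < joinHeight α t i j := by
    rw [hm, Finset.sup'_lt_iff]
    intro k hk
    rw [Finset.mem_Icc] at hk
    exact max_lt (hf k) (H.liftHeight_lt_joinHeight hk.1 hk.2 hij)
  have hle : ∀ k, i ≤ k → k ≤ j → f k ≤ m ∧ liftHeight t k ≤ m := by
    intro k h1 h2
    have := Finset.le_sup' (fun k => max (f k) (liftHeight t k)) (Finset.mem_Icc.2 ⟨h1, h2⟩)
    exact ⟨(le_max_left _ _).trans this, (le_max_right _ _).trans this⟩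
  have hmD : m ∈ D := hD hmlt
  have heq := C.eq_of_coincidences hij.le hS hmD (fun k h1 h2 => (hle k h1 h2).2) fun k h1 h2 => by
    obtain ⟨a, b, e1, e2, e3, e4, e5, e6, e7⟩ := hf' k h1 h2
    have ha := hS a e1 (by omega)
    have hb := hS b (by omega) e4
    exact ⟨a, ha, b, hb, e2, e3, f k, (hle k h1 h2.le).1, e5, e6,
      le_antisymm (C.mono a ha b hb (by omega) _ (hD (hf k)) e5 e6) e7⟩
  have h1 := C.upper i (hS i le_rfl hij.le) m hmD (hle i le_rfl hij.le).2
  have h2 := C.lower j (hS j hij.le le_rfl) m hmD (hle j hij.le le_rfl).2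
  unfold joinHeight at hmlt
  linarith

theorem card_valuesAt_pos {i j : ℤ} (hij : i ≤ j) {h : ℝ} (hi : liftHeight t i ≤ h) :
    1 ≤ (valuesAt t L i j h).card :=
  Finset.card_pos.2 ⟨_, mem_valuesAt.2 ⟨i, ⟨le_rfl, hij⟩, hi, rfl⟩⟩

/-- The lower bound for the merging cost of a coalescing family. -/
theorem Coalescing.lower_bound (H : IsInstance α t) (C : Coalescing α t S D L) {G : ℤ → ℤ → ℝ}
    {lo hi : ℤ} (hG0 : ∀ i, G i i ≤ 0)
    (hG : ∀ i k j, lo ≤ i → i ≤ k → k < j → j ≤ hi → G i j ≤ G i k + G (k + 1) j +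
      (Real.exp (-joinHeight α t i k) - Real.exp (-joinHeight α t i j)) +
      (Real.exp (-joinHeight α t (k + 1) j) - Real.exp (-joinHeight α t i j)))
    (hS : ∀ k, lo ≤ k → k ≤ hi → k ∈ S) (d : ℕ) : ∀ i j : ℤ, lo ≤ i → i ≤ j → j ≤ hi → j - i ≤ d →
    Set.Iio (joinHeight α t i j) ⊆ D →
    ENNReal.ofReal (G i j) ≤ ∫⁻ ρ in Set.Ioi (Real.exp (-joinHeight α t i j)),
      ((valuesAt t L i j (-Real.log ρ)).card : ℝ≥0∞) := by
  induction d with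
  | zero =>
    intro i j _ h1 _ h2 _
    have : i = j := by push_cast at h2; omega
    subst this
    rw [ENNReal.ofReal_of_nonpos (hG0 i)]
    exact zero_le
  | succ d ih =>
    intro i j hlo hij hhi hd hD
    rcases hij.eq_or_lt with rfl | hij
    · rw [ENNReal.ofReal_of_nonpos (hG0 i)]
      exact zero_le
    push_cast at hd
    obtain ⟨k, hik, hkj, hsep⟩ := C.exists_split H hij
      (fun k h1 h2 => hS k (hlo.trans h1) (h2.trans hhi)) hD
    have hHk : joinHeight α t i k < joinHeight α t i j := H.joinHeight_lt_right hkj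
    have hHk' : joinHeight α t (k + 1) j < joinHeight α t i j := H.joinHeight_lt_left (by omega)
    -- Radii beyond the join point of the part are counted by induction. Between the radii of the
    -- two join points at least one value is present, because all lifts of the part have already
    -- started; this pays for the spiral segment joining them.
    have part : ∀ i' j', lo ≤ i' → i' ≤ j' → j' ≤ hi → j' - i' ≤ d →
        joinHeight α t i' j' < joinHeight α t i j →
        ENNReal.ofReal (G i' j' +
          (Real.exp (-joinHeight α t i' j') - Real.exp (-joinHeight α t i j))) ≤
        ∫⁻ ρ in Set.Ioi (Real.exp (-joinHeight α t i j)),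
          ((valuesAt t L i' j' (-Real.log ρ)).card : ℝ≥0∞) := by
      intro i' j' hlo' hij' hhi' hd' hlt
      have hexp := Real.exp_le_exp.2 (neg_le_neg hlt.le)
      rw [← Set.Ioc_union_Ioi_eq_Ioi hexp, MeasureTheory.lintegral_union measurableSet_Ioi
        (Set.Ioc_disjoint_Ioi le_rfl), add_comm (G i' j')]
      refine ENNReal.ofReal_add_le.trans (add_le_add ?_
        (ih i' j' hlo' hij' hhi' hd' ((Set.Iio_subset_Iio hlt.le).trans hD)))
      rw [← Real.volume_Ioc, ← MeasureTheory.setLIntegral_one]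
      refine MeasureTheory.setLIntegral_mono' measurableSet_Ioc fun ρ hρ => ?_
      have hρ0 : 0 < ρ := (Real.exp_pos _).trans hρ.1
      have : joinHeight α t i' j' ≤ -Real.log ρ := by
        have := Real.log_le_log hρ0 hρ.2
        rw [Real.log_exp] at this
        linarith
      exact_mod_cast card_valuesAt_pos hij' ((H.liftHeight_le_joinHeight le_rfl hij').trans this)
    have p1 := part i k hlo hik (by omega) (by omega) hHk
    have p2 := part (k + 1) j (by omega) (by omega) hhi (by omega) hHk'
    calc ENNReal.ofReal (G i j)
        ≤ ENNReal.ofReal ((G i k + (Real.exp (-joinHeight α t i k) -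
            Real.exp (-joinHeight α t i j))) + (G (k + 1) j +
            (Real.exp (-joinHeight α t (k + 1) j) - Real.exp (-joinHeight α t i j)))) :=
          ENNReal.ofReal_le_ofReal (by linarith [hG i k j hlo hik hkj hhi])
      _ ≤ _ := ENNReal.ofReal_add_le
      _ ≤ _ := add_le_add p1 p2
      _ ≤ _ := MeasureTheory.le_lintegral_add _ _
      _ ≤ _ := by
          refine MeasureTheory.setLIntegral_mono' measurableSet_Ioi fun ρ hρ => ?_
          have hρ0 : 0 < ρ := (Real.exp_pos _).trans hρ
          have hlt : -Real.log ρ < joinHeight α t i j := by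
            have := Real.log_lt_log (Real.exp_pos _) hρ
            rw [Real.log_exp] at this
            linarith
          -- Below the join height the two groups share no value by the choice of `k`, so their
          -- counts add.
          have hdisj : Disjoint (valuesAt t L i k (-Real.log ρ))
              (valuesAt t L (k + 1) j (-Real.log ρ)) := by
            rw [Finset.disjoint_left]
            intro x hx hx'
            obtain ⟨a, ⟨h1, h2⟩, h3, rfl⟩ := mem_valuesAt.1 hx
            obtain ⟨b, ⟨h1', h2'⟩, h3', h4⟩ := mem_valuesAt.1 hx'
            exact absurd h4 (hsep _ hlt a b h1 h2 (by omega) h2' h3 h3').ne'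
          have hsub : (valuesAt t L i k (-Real.log ρ)) ∪ (valuesAt t L (k + 1) j (-Real.log ρ)) ⊆
              valuesAt t L i j (-Real.log ρ) := by
            refine Finset.union_subset (fun x hx => ?_) fun x hx => ?_
            · obtain ⟨a, ⟨h1, h2⟩, h3, rfl⟩ := mem_valuesAt.1 hx
              exact mem_valuesAt.2 ⟨a, ⟨h1, by omega⟩, h3, rfl⟩
            · obtain ⟨a, ⟨h1, h2⟩, h3, rfl⟩ := mem_valuesAt.1 hx
              exact mem_valuesAt.2 ⟨a, ⟨by omega, h2⟩, h3, rfl⟩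
          have := Finset.card_le_card hsub
          rw [Finset.card_union_of_disjoint hdisj] at this
          exact_mod_cast this

/-- In a periodic coalescing family there is a place to cut. -/
theorem Coalescing.exists_cut (H : IsInstance α t) (C : Coalescing α t Set.univ Set.univ L)
    (hper : ∀ a h, liftHeight t a ≤ h → L (a + n) h = L a h + period α) :
    ∃ c, ∀ h a b, a ≤ c → c < b → liftHeight t a ≤ h → liftHeight t b ≤ h → L a h < L b h := by
  by_contra hcon
  push Not at hcon
  choose f a b ha hb h1 h2 h3 using hcon
  have hn : (0 : ℤ) ≤ n := by positivity
  have hne : (Finset.Icc (0 : ℤ) n).Nonempty := Finset.nonempty_Icc.2 hn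
  set m := (Finset.Icc (0 : ℤ) n).sup' hne fun k => max (f k) (liftHeight t k) with hm
  have hle : ∀ k, 0 ≤ k → k ≤ (n : ℤ) → f k ≤ m ∧ liftHeight t k ≤ m := by
    intro k h1 h2
    have := Finset.le_sup' (fun k => max (f k) (liftHeight t k)) (Finset.mem_Icc.2 ⟨h1, h2⟩)
    exact ⟨(le_max_left _ _).trans this, (le_max_right _ _).trans this⟩
  -- With all gaps between `0` and `n` closed, `L 0` would equal `L n`, its own translate by a
  -- period.
  have heq := C.eq_of_coincidences hn (fun _ _ _ => Set.mem_univ _) (Set.mem_univ m)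
    (fun k h1 h2 => (hle k h1 h2).2) fun k e1 e2 => ⟨a k, Set.mem_univ _, b k, Set.mem_univ _,
      ha k, hb k, f k, (hle k e1 e2.le).1, h1 k, h2 k, le_antisymm
        (C.mono _ (Set.mem_univ _) _ (Set.mem_univ _) ((ha k).trans (hb k).le) _ (Set.mem_univ _)
          (h1 k) (h2 k)) (h3 k)⟩
  have := hper 0 m (hle 0 le_rfl hn).2
  rw [zero_add] at this
  linarith [period_pos H.tan_pos]

end Coalescing

end SpiralTrees
-- The lifted drawing and its leftmost paths
namespace SpiralTrees

theorem exists_gap {S : Set ℝ} (hS : S.Finite) (x : ℝ) : ∃ ε > 0, ∀ b ∈ S, |b - x| < ε → b = x := by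
  have h1 : (S \ {x})ᶜ ∈ 𝓝 x :=
    (hS.subset Set.sdiff_subset).isClosed.isOpen_compl.mem_nhds (by simp)
  obtain ⟨ε, hε, h2⟩ := Metric.mem_nhds_iff.1 h1
  refine ⟨ε, hε, fun b hb hbx => ?_⟩
  by_contra hne
  exact h2 (show b ∈ Metric.ball x ε by rwa [Metric.mem_ball, Real.dist_eq]) ⟨hb, hne⟩

namespace SpiralSubtree

section General

variable {α : ℝ} {ι : Type} {t : ι → ℂ} (T : SpiralSubtree α t)

/-- The drawing in logarithmic coordinates. -/
def liftSet : Set (ℝ × ℝ) := {p | ∃ u, cyl α p.1 p.2 ∈ T.trace u}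

/-- The heights of the points that are farther from the origin than the root node. -/
def heights : Set ℝ := {h | ‖T.pos T.root‖ < Real.exp (-h)}

theorem isLowerSet_heights : IsLowerSet T.heights := fun _ _ hab hb =>
  lt_of_lt_of_le hb (Real.exp_le_exp.2 (neg_le_neg hab))

theorem heights_eq_univ (hT : T.IsSpiralTree) : T.heights = Set.univ :=
  Set.eq_univ_of_forall fun h => by
    change ‖T.pos T.root‖ < _
    rw [show T.pos T.root = 0 from hT, norm_zero]
    exact Real.exp_pos _

theorem mem_arcsAt {ρ : ℝ} {v : T.V} :
    v ∈ T.arcsAt ρ ↔ ‖T.pos (T.parent v)‖ < ρ ∧ ρ ≤ ‖T.pos v‖ := by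
  simp [arcsAt]

variable (hα : 0 < Real.tan α)
include hα

theorem liftSet_add {h b : ℝ} (hb : (h, b) ∈ T.liftSet) (m : ℤ) :
    (h, b + m * period α) ∈ T.liftSet := by
  obtain ⟨u, hu⟩ := hb
  exact ⟨u, by simp only [cyl_add_period hα]; exact hu⟩

theorem mem_arcsAt_of_mem_trace {h b : ℝ} {u : T.V} (hu : cyl α h b ∈ T.trace u) :
    u ∈ T.arcsAt (Real.exp (-h)) := by
  have := T.norm_of_mem_trace hα hu
  rw [norm_cyl] at this
  exact T.mem_arcsAt.2 this.2

/-- At a given height each of the finitely many arcs has at most one point, and each point has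
finitely many lifts in a bounded range. Continuation is the path to the root node, hence limited to
heights before that node. -/
theorem flowSet : FlowSet T.liftSet T.heights where
  finite h M := by
    have hp := period_pos hα
    have hZ : {z | ‖z‖ = Real.exp (-h) ∧ ∃ u, z ∈ T.trace u}.Finite := by
      have : {z | ‖z‖ = Real.exp (-h) ∧ ∃ u, z ∈ T.trace u} =
          ⋃ u : T.V, {z | ‖z‖ = Real.exp (-h) ∧ z ∈ T.trace u} := by
        ext z; simp
      rw [this]
      exact Set.finite_iUnion fun u => Set.Subsingleton.finite fun z hz z' hz' =>
        T.trace_unique hα hz.2 hz'.2 (hz.1.trans hz'.1.symm)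
    refine (hZ.biUnion fun z _ => (?_ : {b | cyl α h b = z ∧ |b| ≤ M}.Finite)).subset ?_
    · rcases Set.eq_empty_or_nonempty {b | cyl α h b = z ∧ |b| ≤ M} with he | ⟨b₀, hb₀, hb₀M⟩
      · rw [he]; exact Set.finite_empty
      obtain ⟨N, hN⟩ := exists_nat_gt (2 * M / period α)
      refine ((Set.finite_Icc (-(N : ℤ)) N).image fun m : ℤ => b₀ + m * period α).subset ?_
      rintro b ⟨hb, hbM⟩
      obtain ⟨-, m, hm⟩ := (cyl_eq_iff hα).1 (hb.trans hb₀.symm)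
      refine ⟨m, ?_, hm.symm⟩
      rw [div_lt_iff₀ hp] at hN
      rw [abs_le] at hbM hb₀M
      constructor
      · have : (-(N : ℝ)) < m := by
          refine lt_of_mul_lt_mul_right ?_ hp.le
          linarith
        exact_mod_cast this.le
      · have : (m : ℝ) < N := by
          refine lt_of_mul_lt_mul_right ?_ hp.le
          linarith
        exact_mod_cast this.le
    · rintro b ⟨⟨u, hu⟩, hbM⟩
      exact Set.mem_biUnion (show cyl α h b ∈ _ from ⟨norm_cyl _ _ _, u, hu⟩) ⟨rfl, hbM⟩
  forward h a h' := by
    rintro ⟨u, hu⟩ hh hD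
    obtain ⟨g, hg, hga, hgK⟩ := T.exists_path_of_mem_trace hα hu
    refine ⟨g h', hh, g, hg.lip, hga, rfl, fun s hs hs' => ?_⟩
    obtain ⟨w, -, hw⟩ := hgK s hs (T.isLowerSet_heights hs' hD)
    exact ⟨w, hw⟩

/-- The lifted drawing is invariant under translation by periods; translating optimal selections
forwards and backwards gives the two inequalities. -/
theorem leftmost_add {h₀ a h : ℝ} (ha : (h₀, a) ∈ T.liftSet) (hh : h₀ ≤ h) (hD : h ∈ T.heights) :
    leftmost T.liftSet h₀ (a + period α) h = leftmost T.liftSet h₀ a h + period α := by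
  have key : ∀ (m : ℤ) {a b : ℝ}, Sel T.liftSet h₀ a h b →
      Sel T.liftSet h₀ (a + m * period α) h (b + m * period α) := by
    rintro m a b ⟨h1, g, hg, rfl, rfl, hK⟩
    exact ⟨h1, fun s => g s + m * period α, fun s u => by simpa using hg s u, rfl, rfl,
      fun s hs hs' => T.liftSet_add hα (hK s hs hs') m⟩
  have F := T.flowSet hα
  have ha' : (h₀, a + period α) ∈ T.liftSet := by simpa using T.liftSet_add hα ha 1
  have e1 := leftmost_le (key 1 (F.sel_leftmost ha hh hD))
  have e2 := leftmost_le (key (-1) (F.sel_leftmost ha' hh hD))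
  have e3 : a + period α + ((-1 : ℤ) : ℝ) * period α = a := by push_cast; ring
  rw [e3] at e2
  push_cast at e1 e2
  rw [one_mul] at e1
  linarith

-- Points on one circle that lie on a common arc are equal, so choosing an arc for each value is
-- injective as soon as distinct values are distinct points of the plane.
omit hα in
theorem card_le_card_arcs {S : Finset ℝ} {U : Finset T.V} {h : ℝ} (hα : 0 < Real.tan α)
    (hinj : ∀ x ∈ S, ∀ y ∈ S, cyl α h x = cyl α h y → x = y)
    (hS : ∀ x ∈ S, ∃ u ∈ U, cyl α h x ∈ T.trace u) : S.card ≤ U.card := by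
  have : Nonempty T.V := ⟨T.root⟩
  choose! f hf hf' using hS
  refine Finset.card_le_card_of_injOn f hf fun x hx y hy hxy => hinj x hx y hy ?_
  refine T.trace_unique hα (hf' x hx) (hxy ▸ hf' y hy) (by simp [norm_cyl])

end General

/-! ### Lower bound for the length of a spiral tree -/

section Lower

variable {n : ℕ} [NeZero n] {α : ℝ} {t : Fin n → ℂ}

theorem card_valuesAt_le (H : IsInstance α t) {ι : Type} {s : ι → ℂ} (T : SpiralSubtree α s)
    {D : Set ℝ} {L : ℤ → ℝ → ℝ} {a b : ℤ}
    (hmem : ∀ k, a ≤ k → k ≤ b → ∀ h ∈ D, liftHeight t k ≤ h → (h, L k h) ∈ T.liftSet)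
    (hinj : ∀ h ∈ D, ∀ x ∈ valuesAt t L a b h, ∀ y ∈ valuesAt t L a b h,
      cyl α h x = cyl α h y → x = y) {h : ℝ} (hh : h ∈ D) :
    (valuesAt t L a b h).card ≤ (T.arcsAt (Real.exp (-h))).card := by
  refine T.card_le_card_arcs H.tan_pos (hinj h hh) fun x hx => ?_
  obtain ⟨k, ⟨h1, h2⟩, h3, rfl⟩ := mem_valuesAt.1 hx
  obtain ⟨u, hu⟩ := hmem k h1 h2 h hh h3
  exact ⟨u, T.mem_arcsAt_of_mem_trace H.tan_pos hu, hu⟩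

variable (T : SpiralSubtree α t)

/-- The leftmost path in the drawing from the lift `a` of a terminal. -/
def leftPath (a : ℤ) (h : ℝ) : ℝ := leftmost T.liftSet (liftHeight t a) (liftAngle α t a) h

variable {T}

theorem term_ne_root (H : IsInstance α t) (hT : T.IsSpiralTree) (i : Fin n) :
    T.term i ≠ T.root := fun h => by
  have := T.pos_term i
  rw [h, show T.pos T.root = 0 from hT] at this
  exact H.ne_root i this.symm

theorem lift_mem_liftSet (H : IsInstance α t) (hT : T.IsSpiralTree) (a : ℤ) :
    (liftHeight t a, liftAngle α t a) ∈ T.liftSet := by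
  refine ⟨T.term (red n a), ?_⟩
  rw [← H.cyl_lift, ← T.pos_term]
  exact T.pos_mem_trace H.tan_pos (term_ne_root H hT _)

theorem sel_leftPath (H : IsInstance α t) (hT : T.IsSpiralTree) {a : ℤ} {h : ℝ}
    (hh : liftHeight t a ≤ h) :
    Sel T.liftSet (liftHeight t a) (liftAngle α t a) h (T.leftPath a h) :=
  (T.flowSet H.tan_pos).sel_leftmost (lift_mem_liftSet H hT a) hh
    (by rw [T.heights_eq_univ hT]; trivial)

theorem coalescing_leftPath (H : IsInstance α t) (hT : T.IsSpiralTree) :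
    Coalescing α t Set.univ Set.univ T.leftPath := by
  have F := T.flowSet H.tan_pos
  rw [T.heights_eq_univ hT] at F
  exact F.coalescing H isLowerSet_univ fun a _ => lift_mem_liftSet H hT a

theorem leftPath_add (H : IsInstance α t) (hT : T.IsSpiralTree) (a : ℤ) {h : ℝ}
    (hh : liftHeight t a ≤ h) : T.leftPath (a + n) h = T.leftPath a h + period α := by
  have h1 := liftHeight_add (t := t) a 1
  have h2 := liftAngle_add (α := α) (t := t) a 1
  rw [mul_one] at h1 h2
  unfold leftPath
  rw [h1, h2]
  push_cast
  rw [one_mul, T.leftmost_add H.tan_pos (lift_mem_liftSet H hT a) hh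
    (by rw [T.heights_eq_univ hT]; trivial)]

/-- Lower bound for spiral trees, in terms of the merging cost of the leftmost paths. -/
theorem lower_bound_leftPath (H : IsInstance α t) (hT : T.IsSpiralTree) {G : ℤ → ℤ → ℝ}
    (hG0 : ∀ i, G i i ≤ 0)
    (hG : ∀ i k j : ℤ, i ≤ k → k < j → j < i + n → G i j ≤ G i k + G (k + 1) j +
      (Real.exp (-joinHeight α t i k) - Real.exp (-joinHeight α t i j)) +
      (Real.exp (-joinHeight α t (k + 1) j) - Real.exp (-joinHeight α t i j))) :
    ∃ c : ℤ, ENNReal.ofReal (G (c + 1) (c + n) + Real.exp (-joinHeight α t (c + 1) (c + n))) ≤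
      (∫⁻ ρ in Set.Ioi 0, ((valuesAt t T.leftPath (c + 1) (c + n) (-Real.log ρ)).card : ℝ≥0∞)) ∧
      ∀ h, ∀ x ∈ valuesAt t T.leftPath (c + 1) (c + n) h,
        ∀ y ∈ valuesAt t T.leftPath (c + 1) (c + n) h, cyl α h x = cyl α h y → x = y := by
  have C := coalescing_leftPath H hT
  have hn : (0 : ℤ) < n := by exact_mod_cast NeZero.pos n
  obtain ⟨c, hc⟩ := C.exists_cut H fun a h => leftPath_add H hT a
  refine ⟨c, ?_, ?_⟩
  · have hexp := (Real.exp_pos (-joinHeight α t (c + 1) (c + n))).le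
    rw [← Set.Ioc_union_Ioi_eq_Ioi hexp, MeasureTheory.lintegral_union measurableSet_Ioi
        (Set.Ioc_disjoint_Ioi le_rfl), add_comm (G _ _)]
    -- The disc inside the join point of the whole interval carries at least one path all the way to
    -- the origin and contributes its radius; outside it the bound for coalescing families applies.
    refine ENNReal.ofReal_add_le.trans (add_le_add ?_ ?_)
    · conv_lhs => rw [← sub_zero (Real.exp _), ← Real.volume_Ioc, ← MeasureTheory.setLIntegral_one]
      refine MeasureTheory.setLIntegral_mono' measurableSet_Ioc fun ρ hρ => ?_
      have : joinHeight α t (c + 1) (c + n) ≤ -Real.log ρ := by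
        have := Real.log_le_log hρ.1 hρ.2
        rw [Real.log_exp] at this
        linarith
      have hij : c + 1 ≤ c + n := by omega
      exact_mod_cast card_valuesAt_pos hij ((H.liftHeight_le_joinHeight le_rfl hij).trans this)
    · exact C.lower_bound H hG0 (fun i k j h1 h2 h3 h4 => hG i k j h2 h3 (by omega))
        (fun _ _ _ => Set.mem_univ _) n (c + 1) (c + n) le_rfl (by omega) le_rfl (by omega)
        (Set.subset_univ _)
  · have key : ∀ h, ∀ x ∈ valuesAt t T.leftPath (c + 1) (c + n) h,
        ∀ y ∈ valuesAt t T.leftPath (c + 1) (c + n) h, x < y + period α := by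
      intro h x hx y hy
      obtain ⟨a, ⟨a1, a2⟩, a3, rfl⟩ := mem_valuesAt.1 hx
      obtain ⟨b, ⟨b1, b2⟩, b3, rfl⟩ := mem_valuesAt.1 hy
      have h1 := C.mono a trivial _ trivial a2 (max h (liftHeight t (c + n)))
      rw [← leftPath_add H hT b b3]
      by_contra hcon
      push Not at hcon
      have e1 := liftHeight_add (t := t) b 1
      rw [mul_one] at e1
      by_cases hbc : a = b + n
      · omega
      have hlt : a < b + n := by omega
      have hle := C.mono a trivial (b + n) trivial hlt.le h trivial a3 (e1.trans_le b3)
      have e2 := hc h (a - n) b (by omega) (by omega)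
        (by have := liftHeight_add (t := t) (a - n) 1
            rw [mul_one, sub_add_cancel] at this
            linarith) b3
      have e3 := leftPath_add H hT (a - n) (h := h)
        (by have := liftHeight_add (t := t) (a - n) 1
            rw [mul_one, sub_add_cancel] at this
            linarith)
      rw [sub_add_cancel] at e3
      have e4 := leftPath_add H hT b b3
      linarith
    intro h x hx y hy hxy
    obtain ⟨-, m, hm⟩ := (cyl_eq_iff H.tan_pos).1 hxy
    have h1 := key h x hx y hy
    have h2 := key h y hy x hx
    have hp := period_pos H.tan_pos
    have h3 : (m : ℝ) * period α < 1 * period α := by linarith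
    have h4 : (-1 : ℝ) * period α < m * period α := by linarith
    have h5 := lt_of_mul_lt_mul_right h3 hp.le
    have h6 := lt_of_mul_lt_mul_right h4 hp.le
    have : m = 0 := by
      have h7 : m < 1 := by exact_mod_cast h5
      have h8 : -1 < m := by exact_mod_cast h6
      omega
    rw [hm, this]; simp

omit [NeZero n] in
theorem lintegral_arcsAt_Ioi (hα : 0 < Real.tan α) (hc : 0 < Real.cos α) :
    ∫⁻ ρ in Set.Ioi 0, ((T.arcsAt ρ).card : ℝ≥0∞) ≤ ENNReal.ofReal (Real.cos α * T.length) := by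
  rw [← T.lintegral_card_arcsAt hα hc]
  exact MeasureTheory.setLIntegral_le_lintegral _ _

theorem length_nonneg {ι : Type} {s : ι → ℂ} (T : SpiralSubtree α s) (hα : 0 < Real.tan α)
    (hc : 0 < Real.cos α) : 0 ≤ T.length := by
  rw [T.length_eq hc]
  exact mul_nonneg (inv_nonneg.2 hc.le)
    (Finset.sum_nonneg fun v _ => sub_nonneg.2 (T.norm_parent_le hα v))

theorem length_lower (H : IsInstance α t) (hT : T.IsSpiralTree) {G : ℤ → ℤ → ℝ}
    (hG0 : ∀ i, G i i ≤ 0)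
    (hG : ∀ i k j : ℤ, i ≤ k → k < j → j < i + n → G i j ≤ G i k + G (k + 1) j +
      (Real.exp (-joinHeight α t i k) - Real.exp (-joinHeight α t i j)) +
      (Real.exp (-joinHeight α t (k + 1) j) - Real.exp (-joinHeight α t i j))) :
    ∃ c : ℤ, G (c + 1) (c + n) + Real.exp (-joinHeight α t (c + 1) (c + n)) ≤
      Real.cos α * T.length := by
  obtain ⟨c, hc, hinj⟩ := lower_bound_leftPath H hT hG0 hG
  refine ⟨c, ?_⟩
  rw [← ENNReal.ofReal_le_ofReal_iff
    (mul_nonneg H.cos_pos.le (T.length_nonneg H.tan_pos H.cos_pos))]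
  refine hc.trans (le_trans ?_ (lintegral_arcsAt_Ioi H.tan_pos H.cos_pos))
  refine MeasureTheory.setLIntegral_mono' measurableSet_Ioi fun ρ hρ => ?_
  have := card_valuesAt_le H T (D := Set.univ)
    (fun k _ _ h _ h3 => (sel_leftPath H hT h3).mem_right) (fun h _ => hinj h) (h := -Real.log ρ)
    trivial
  rw [neg_neg, Real.exp_log hρ] at this
  exact_mod_cast this

end Lower

end SpiralSubtree

end SpiralTrees
namespace SpiralTrees

namespace SpiralSubtree

variable {n : ℕ} [NeZero n] {α : ℝ} {t : Fin n → ℂ}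

/-! ### Subtrees in a wedge -/

/-- A lifted path that starts in a lift of a wedge stays in this lift. -/
theorem path_stays_in_wedge (H : IsInstance α t) {a b : ℤ} (hab : a ≤ b) (hb : b < a + n)
    {g : ℝ → ℝ} (hg : Continuous g) {h₀ h₁ : ℝ} (h01 : h₀ ≤ h₁)
    (h0 : g h₀ ∈ Set.Icc (liftAngle α t a) (liftAngle α t b))
    (hw : ∀ h, h₀ ≤ h → h ≤ h₁ → cyl α h (g h) ∈ wedge (t (red n a)) (t (red n b))) :
    g h₁ ∈ Set.Icc (liftAngle α t a) (liftAngle α t b) := by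
  have hp := period_pos H.tan_pos
  have hlt := H.liftAngle_lt_add_period hb
  -- A wedge is narrower than a period, so its lifts are separated by open gaps; the gaps next to
  -- the chosen lift are excluded here.
  have gap : ∀ x, (∃ m : ℤ, liftAngle α t a ≤ x + m * period α ∧
      x + m * period α ≤ liftAngle α t b) →
      ¬ (liftAngle α t b < x ∧ x < liftAngle α t a + period α) ∧
      ¬ (liftAngle α t b - period α < x ∧ x < liftAngle α t a) := by
    rintro x ⟨m, h1, h2⟩
    have hm : (m : ℝ) ≤ -1 ∨ m = 0 ∨ (1 : ℝ) ≤ m := by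
      rcases lt_trichotomy m 0 with h | h | h
      · left; exact_mod_cast (by omega : m ≤ -1)
      · right; left; exact h
      · right; right; exact_mod_cast h
    rcases hm with h | h | h
    · have : (m : ℝ) * period α ≤ -1 * period α := mul_le_mul_of_nonneg_right h hp.le
      constructor <;> rintro ⟨h3, h4⟩ <;> linarith
    · rw [h] at h1 h2
      push_cast at h1 h2
      constructor <;> rintro ⟨h3, h4⟩ <;> linarith
    · have : 1 * period α ≤ (m : ℝ) * period α := mul_le_mul_of_nonneg_right h hp.le
      constructor <;> rintro ⟨h3, h4⟩ <;> linarith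
  constructor
  · by_contra hcon
    push Not at hcon
    -- A value inside the gap on the left that lies between `g h₁` and `g h₀`: the midpoint of the
    -- gap, unless the path stopped before reaching it. The path would have to take this value.
    set y := max (g h₁) ((liftAngle α t a + (liftAngle α t b - period α)) / 2) with hy
    have hy1 : y < liftAngle α t a := max_lt hcon (by linarith)
    have hy2 : liftAngle α t b - period α < y := lt_max_of_lt_right (by linarith)
    obtain ⟨c, hc, hcy⟩ := intermediate_value_Icc' h01 hg.continuousOn
      (show y ∈ Set.Icc (g h₁) (g h₀) from ⟨le_max_left _ _, by linarith [h0.1]⟩)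
    have := (H.cyl_mem_wedge_iff hab hb).1 (hw c hc.1 hc.2)
    rw [hcy] at this
    exact (gap y this).2 ⟨hy2, hy1⟩
  · by_contra hcon
    push Not at hcon
    set y := min (g h₁) ((liftAngle α t b + (liftAngle α t a + period α)) / 2) with hy
    have hy1 : liftAngle α t b < y := lt_min hcon (by linarith)
    have hy2 : y < liftAngle α t a + period α := min_lt_of_right_lt (by linarith)
    obtain ⟨c, hc, hcy⟩ := intermediate_value_Icc h01 hg.continuousOn
      (show y ∈ Set.Icc (g h₀) (g h₁) from ⟨by linarith [h0.2], min_le_left _ _⟩)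
    have := (H.cyl_mem_wedge_iff hab hb).1 (hw c hc.1 hc.2)
    rw [hcy] at this
    exact (gap y this).1 ⟨hy1, hy2⟩

/-- The index in `cyclicRange` of a lift. -/
def rangeIndex {a b k : ℤ} (hb : b < a + n) (h1 : a ≤ k) (h2 : k ≤ b) :
    {k : Fin n // k - red n a ≤ red n b - red n a} :=
  ⟨red n k, by
    rw [Fin.le_def, ← @Nat.cast_le ℤ, red_sub_val h1 (by omega), red_sub_val (h1.trans h2) hb]
    omega⟩

/-- The wedge replaces the cut of the spiral tree: it keeps all lifted paths in a strip narrower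
than a period, where distinct values are distinct points. The root node may be anywhere, so the
family is defined only up to its height, which must be shown to be at least the join height. -/
theorem length_lower_wedge (H : IsInstance α t) {G : ℤ → ℤ → ℝ}
    (hG0 : ∀ i, G i i ≤ 0)
    (hG : ∀ i k j : ℤ, i ≤ k → k < j → j < i + n → G i j ≤ G i k + G (k + 1) j +
      (Real.exp (-joinHeight α t i k) - Real.exp (-joinHeight α t i j)) +
      (Real.exp (-joinHeight α t (k + 1) j) - Real.exp (-joinHeight α t i j)))
    {a b : ℤ} (hab : a ≤ b) (hb : b < a + n)
    (T : SpiralSubtree α (cyclicRange t (red n a) (red n b)))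
    (hT : T.carrier ⊆ wedge (t (red n a)) (t (red n b))) : G a b ≤ Real.cos α * T.length := by
  have hα := H.tan_pos
  have hnn := mul_nonneg H.cos_pos.le (T.length_nonneg hα H.cos_pos)
  rcases hab.eq_or_lt with rfl | hlt
  · exact (hG0 a).trans hnn
  have hpos : ∀ k (h1 : a ≤ k) (h2 : k ≤ b), T.pos (T.term (rangeIndex hb h1 h2)) =
      cyl α (liftHeight t k) (liftAngle α t k) := by
    intro k h1 h2
    rw [T.pos_term, ← H.cyl_lift]
    rfl
  have hwedge : ∀ {h x : ℝ}, (h, x) ∈ T.liftSet →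
      cyl α h x ∈ wedge (t (red n a)) (t (red n b)) := by
    rintro h x ⟨u, hu⟩
    exact hT (Or.inr (Set.mem_iUnion.2 ⟨u, hu⟩))
  have hang : ∀ k, a ≤ k → k ≤ b →
      liftAngle α t k ∈ Set.Icc (liftAngle α t a) (liftAngle α t b) :=
    fun k h1 h2 => ⟨H.liftAngle_mono h1, H.liftAngle_mono h2⟩
  -- The paths of `a` and `b` both reach the root node, at lifts inside the same strip and hence at
  -- the same lift. That point lies in the cones of both lifts, which puts it at or beyond the join
  -- height.
  have hroot : ‖T.pos T.root‖ ≤ Real.exp (-joinHeight α t a b) := by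
    by_cases h0 : T.pos T.root = 0
    · rw [h0, norm_zero]; positivity
    have hend : ∀ k (h1 : a ≤ k) (h2 : k ≤ b), ∃ c x, liftHeight t k ≤ c ∧
        T.pos T.root = cyl α c x ∧ |x - liftAngle α t k| ≤ c - liftHeight t k ∧
        x ∈ Set.Icc (liftAngle α t a) (liftAngle α t b) := by
      intro k h1 h2
      obtain ⟨g, hg, hgh, htr, hend⟩ := T.exists_path (hpos k h1 h2)
      obtain ⟨c, hc, hc'⟩ := hend h0
      refine ⟨c, g c, hc, hc', ?_, ?_⟩
      · rw [← hgh, ← abs_of_nonneg (sub_nonneg.2 hc)]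
        exact hg.lip _ _
      · refine path_stays_in_wedge H hab hb hg.continuous hc (hgh ▸ hang k h1 h2) fun h e1 e2 => ?_
        rcases e2.lt_or_eq with e2 | rfl
        · obtain ⟨u, -, hu⟩ := htr h e1
            (by rw [hc', norm_cyl]; exact Real.exp_lt_exp.2 (by linarith))
          exact hwedge ⟨u, hu⟩
        · exact hT (Or.inl ⟨T.root, hc'⟩)
    obtain ⟨c, x, hc, hcx, hx, hxw⟩ := hend a le_rfl hab
    obtain ⟨c', x', hc', hcx', hx', hxw'⟩ := hend b hab le_rfl
    obtain ⟨rfl, m, hm⟩ := (cyl_eq_iff hα).1 (hcx.symm.trans hcx')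
    have hpp := period_pos hα
    have hl := H.liftAngle_lt_add_period (α := α) hb
    have h3 : (m : ℝ) * period α < 1 * period α := by linarith [hxw.2, hxw'.1]
    have h4 : (-1 : ℝ) * period α < m * period α := by linarith [hxw'.2, hxw.1]
    have h5 := lt_of_mul_lt_mul_right h3 hpp.le
    have h6 := lt_of_mul_lt_mul_right h4 hpp.le
    have h7 : m < 1 := by exact_mod_cast h5
    have h8 : -1 < m := by exact_mod_cast h6
    obtain rfl : m = 0 := by omega
    push_cast at hm
    rw [hcx, norm_cyl]
    refine Real.exp_le_exp.2 (neg_le_neg ?_)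
    rw [abs_le] at hx hx'
    unfold joinHeight liftX liftY
    linarith [hx.2, hx'.1]
  have hD : Set.Iio (joinHeight α t a b) ⊆ T.heights := fun h hh =>
    lt_of_le_of_lt hroot (Real.exp_lt_exp.2 (neg_lt_neg hh))
  have hmem : ∀ k ∈ Set.Icc a b, (liftHeight t k, liftAngle α t k) ∈ T.liftSet := by
    rintro k ⟨h1, h2⟩
    refine ⟨T.term (rangeIndex hb h1 h2), ?_⟩
    rw [← hpos k h1 h2]
    refine T.pos_mem_trace hα fun hr => ?_
    have := hD (H.liftHeight_lt_joinHeight h1 h2 hlt)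
    change ‖_‖ < _ at this
    rw [← hr, hpos k h1 h2, norm_cyl] at this
    exact lt_irrefl _ this
  have F := T.flowSet hα
  have C := F.coalescing H T.isLowerSet_heights hmem
  set L := fun a h => leftmost T.liftSet (liftHeight t a) (liftAngle α t a) h with hL
  have hLmem : ∀ k, a ≤ k → k ≤ b → ∀ h ∈ T.heights, liftHeight t k ≤ h →
      (h, L k h) ∈ T.liftSet ∧ L k h ∈ Set.Icc (liftAngle α t a) (liftAngle α t b) := by
    intro k h1 h2 h hh hk
    have hs := F.sel_leftmost (hmem k ⟨h1, h2⟩) hk hh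
    refine ⟨hs.mem_right, ?_⟩
    obtain ⟨-, g, hg, hga, hgb, hgK⟩ := hs
    change g h = L k h at hgb
    rw [← hgb]
    refine path_stays_in_wedge H hab hb ?_ hk (hga ▸ hang k h1 h2) fun s e1 e2 => hwedge (hgK s e1 e2)
    exact (LipschitzWith.of_dist_le_mul (K := 1) fun a b => by
      simpa [Real.dist_eq] using hg a b).continuous
  have hinj : ∀ h ∈ T.heights, ∀ x ∈ valuesAt t L a b h, ∀ y ∈ valuesAt t L a b h,
      cyl α h x = cyl α h y → x = y := by
    intro h hh x hx y hy hxy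
    obtain ⟨k, ⟨k1, k2⟩, k3, rfl⟩ := mem_valuesAt.1 hx
    obtain ⟨l, ⟨l1, l2⟩, l3, rfl⟩ := mem_valuesAt.1 hy
    have hxw := (hLmem k k1 k2 h hh k3).2
    have hxw' := (hLmem l l1 l2 h hh l3).2
    obtain ⟨-, m, hm⟩ := (cyl_eq_iff hα).1 hxy
    have hpp := period_pos hα
    have hl := H.liftAngle_lt_add_period (α := α) hb
    have h3 : (m : ℝ) * period α < 1 * period α := by linarith [hxw.2, hxw'.1]
    have h4 : (-1 : ℝ) * period α < m * period α := by linarith [hxw'.2, hxw.1]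
    have h5 := lt_of_mul_lt_mul_right h3 hpp.le
    have h6 := lt_of_mul_lt_mul_right h4 hpp.le
    have h7 : m < 1 := by exact_mod_cast h5
    have h8 : -1 < m := by exact_mod_cast h6
    obtain rfl : m = 0 := by omega
    rw [hm]; simp
  rw [← ENNReal.ofReal_le_ofReal_iff hnn, ← T.lintegral_card_arcsAt hα H.cos_pos]
  refine (C.lower_bound H hG0 (lo := a) (hi := b)
    (fun i k j h1 h2 h3 h4 => hG i k j h2 h3 (by omega)) (fun k h1 h2 => ⟨h1, h2⟩) n a b le_rfl hab
    le_rfl (by omega) hD).trans (le_trans ?_ (MeasureTheory.setLIntegral_le_lintegral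
    (Set.Ioi (Real.exp (-joinHeight α t a b))) _))
  refine MeasureTheory.setLIntegral_mono' measurableSet_Ioi fun ρ hρ => ?_
  have hρ0 : 0 < ρ := (Real.exp_pos _).trans hρ
  have hlt' : -Real.log ρ < joinHeight α t a b := by
    have := Real.log_lt_log (Real.exp_pos _) hρ
    rw [Real.log_exp] at this
    linarith
  have := card_valuesAt_le H T (fun k h1 h2 h hh h3 => (hLmem k h1 h2 h hh h3).1) hinj (hD hlt')
  rw [neg_neg, Real.exp_log hρ0] at this
  exact_mod_cast this

/-! ### Drawings that are not planar are not optimal -/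

/-- A lift of an arc through a given lift of one of its points. -/
theorem exists_trace_lift_through {ι : Type} {s : ι → ℂ} (T : SpiralSubtree α s)
    (hα : 0 < Real.tan α) {v : T.V} {h₀ θ₀ : ℝ} (hz : cyl α h₀ θ₀ ∈ T.trace v) :
    ∃ g : ℝ → ℝ, Zigzag g ∧ g h₀ = θ₀ ∧ ∃ h₁ ≤ h₀, ∀ z, z ∈ T.trace v ↔
      ∃ a, h₁ ≤ a ∧ ‖T.pos (T.parent v)‖ < Real.exp (-a) ∧ z = cyl α a (g a) := by
  obtain ⟨θ, g, hp, hg, hgθ, htr, -⟩ := T.exists_trace_lift hα (T.norm_of_mem_trace hα hz).1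
  obtain ⟨a, h1, h2, h3⟩ := (htr _).1 hz
  obtain ⟨rfl, m, hm⟩ := (cyl_eq_iff hα).1 h3
  refine ⟨fun a => g a + m * period α, hg.add_const _, hm.symm, _, h1, fun z => ?_⟩
  simp only [cyl_add_period hα]
  exact htr z

/-- Look just after a common point of two arcs. If they continue with equal slopes, every point of
one is also on the other, so one is redundant. If they separate, a leftmost path never takes the arc
of larger slope, because it could have switched to the other one. -/
theorem exists_avoided_arc (H : IsInstance α t) {T : SpiralSubtree α t} (hT : T.IsSpiralTree)
    (hnp : ¬ T.IsPlanar) : ∃ (w : T.V) (h₀ ε : ℝ), 0 < ε ∧ ∀ h, h₀ < h → h < h₀ + ε →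
      w ∈ T.arcsAt (Real.exp (-h)) ∧ ∀ k, liftHeight t k ≤ h →
        ∃ u, u ≠ w ∧ cyl α h (T.leftPath k h) ∈ T.trace u := by
  have hα := H.tan_pos
  obtain ⟨v, w, hvw, z, hzv, hzw⟩ : ∃ v w, v ≠ w ∧ ∃ z, z ∈ T.trace v ∧ z ∈ T.trace w := by
    by_contra hcon
    push Not at hcon
    refine hnp ⟨fun v w hvw => Set.disjoint_left.2 fun z h1 h2 => hcon v w hvw z h1 h2,
      fun v hv => T.arc_avoid v ?_⟩
    rw [show T.pos T.root = 0 from hT] at hv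
    exact hv
  have hz0 : z ≠ 0 := by
    rintro rfl
    exact T.arc_avoid v hzv
  obtain ⟨θ₀, hθ₀⟩ := exists_cyl hα hz0
  set h₀ := -Real.log ‖z‖ with hh₀
  rw [hθ₀] at hzv hzw
  obtain ⟨g, hg, hg0, h₁, hh₁, htr⟩ := T.exists_trace_lift_through hα hzv
  obtain ⟨g', hg', hg0', h₁', hh₁', htr'⟩ := T.exists_trace_lift_through hα hzw
  obtain ⟨δ, hδ, σ, hσ, hlin⟩ := hg.right h₀
  obtain ⟨δ', hδ', σ', hσ', hlin'⟩ := hg'.right h₀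
  -- heights just after `h₀` belong to both arcs
  obtain ⟨η, hη, hηv, hηw⟩ : ∃ η > 0, (∀ h, h₀ < h → h < h₀ + η →
      ‖T.pos (T.parent v)‖ < Real.exp (-h)) ∧ (∀ h, h₀ < h → h < h₀ + η →
      ‖T.pos (T.parent w)‖ < Real.exp (-h)) := by
    have hcont : Continuous fun h : ℝ => Real.exp (-h) := by fun_prop
    have hv' := (T.norm_of_mem_trace hα hzv).2.1
    have hw' := (T.norm_of_mem_trace hα hzw).2.1
    rw [norm_cyl] at hv' hw'
    obtain ⟨ε, hε, hb⟩ := Metric.eventually_nhds_iff.1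
      (((hcont.tendsto h₀).eventually (lt_mem_nhds hv')).and
        ((hcont.tendsto h₀).eventually (lt_mem_nhds hw')))
    refine ⟨ε, hε, fun h h1 h2 => (hb ?_).1, fun h h1 h2 => (hb ?_).2⟩ <;>
    · rw [Real.dist_eq, abs_lt]; constructor <;> linarith
  have hmem : ∀ h, h₀ < h → h < h₀ + η → cyl α h (g h) ∈ T.trace v := fun h h1 h2 =>
    (htr _).2 ⟨h, by linarith, hηv h h1 h2, rfl⟩
  have hmem' : ∀ h, h₀ < h → h < h₀ + η → cyl α h (g' h) ∈ T.trace w := fun h h1 h2 =>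
    (htr' _).2 ⟨h, by linarith, hηw h h1 h2, rfl⟩
  have hsel : ∀ {k h}, liftHeight t k ≤ h → ∃ u, cyl α h (T.leftPath k h) ∈ T.trace u :=
    fun hk => (sel_leftPath H hT hk).mem_right
  by_cases hσσ : σ = σ'
  -- Equal slopes: on this range the two arcs coincide, and points attributed to `w` can be
  -- attributed to `v`.
  · refine ⟨w, h₀, min η (min δ δ'), by positivity, fun h h1 h2 => ?_⟩
    have e1 : h < h₀ + η := h2.trans_le (by gcongr; exact min_le_left _ _)
    have e2 : h < h₀ + δ := h2.trans_le
      (by gcongr; exact (min_le_right _ _).trans (min_le_left _ _))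
    have e3 : h < h₀ + δ' := h2.trans_le
      (by gcongr; exact (min_le_right _ _).trans (min_le_right _ _))
    refine ⟨T.mem_arcsAt_of_mem_trace hα (hmem' h h1 e1), fun k hk => ?_⟩
    obtain ⟨u, hu⟩ := hsel hk
    by_cases huw : u = w
    · refine ⟨v, hvw, ?_⟩
      rw [huw] at hu
      rw [T.trace_unique hα hu (hmem' h h1 e1) (by simp [norm_cyl])]
      have l1 := hlin (h - h₀) (by linarith) (by linarith)
      have l2 := hlin' (h - h₀) (by linarith) (by linarith)
      rw [add_sub_cancel] at l1 l2
      rw [l2, ← hσσ, hg0', ← hg0, ← l1]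
      exact hmem h h1 e1
    · exact ⟨u, huw, hu⟩
  -- the two arcs separate
  clear hsel
  wlog hlt : σ < σ' generalizing v w g g' h₁ h₁' δ δ' σ σ'
  · exact this w v hvw.symm hzv hzw g' hg' hg0' h₁' hh₁' htr' g hg hg0 h₁ hh₁ htr δ' hδ' σ' hσ' hlin'
      δ hδ σ hσ hlin hηw hηv hmem' hmem (Ne.symm hσσ)
      (lt_of_le_of_ne (not_lt.1 hlt) (Ne.symm hσσ))
  have hp := period_pos hα
  -- `ε₁` isolates `θ₀` among the lifted points at height `h₀`; `ε₂` ensures that no terminal lies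
  -- at a height strictly between `h₀` and `h`, so a leftmost path present at `h` was already
  -- present at `h₀`.
  obtain ⟨ε₁, hε₁, hgap⟩ := exists_gap ((T.flowSet hα).finite h₀ (|θ₀| + 1)) θ₀
  obtain ⟨ε₂, hε₂, hgap₂⟩ := exists_gap (Set.finite_range fun i : Fin n => -Real.log ‖t i‖) h₀
  refine ⟨w, h₀, min (min η (min δ δ')) (min (min 1 ε₁ / 2) ε₂), by positivity, fun h h1 h2 => ?_⟩
  simp only [← min_add_add_left, lt_min_iff] at h2
  obtain ⟨⟨e1, e2, e3⟩, e4, e5⟩ := h2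
  have e6 : 2 * (h - h₀) < 1 := by linarith [min_le_left 1 ε₁]
  have e7 : 2 * (h - h₀) < ε₁ := by linarith [min_le_right 1 ε₁]
  refine ⟨T.mem_arcsAt_of_mem_trace hα (hmem' h h1 e1), fun k hk => ?_⟩
  have hs := sel_leftPath H hT hk
  obtain ⟨u, hu⟩ := hs.mem_right
  refine ⟨u, fun huw => ?_, hu⟩
  rw [huw] at hu
  obtain ⟨-, m, hm⟩ := (cyl_eq_iff hα).1
    (T.trace_unique hα hu (hmem' h h1 e1) (by simp [norm_cyl]))
  have l1 := hlin (h - h₀) (by linarith) (by linarith)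
  have l2 := hlin' (h - h₀) (by linarith) (by linarith)
  rw [add_sub_cancel] at l1 l2
  have hk0 : liftHeight t k ≤ h₀ := by
    by_contra hcon
    push Not at hcon
    have := hgap₂ (liftHeight t k) ⟨red n k, rfl⟩ (by rw [abs_lt]; constructor <;> linarith)
    linarith
  obtain ⟨c, hc, hc'⟩ := hs.split hk0 h1.le
  have hcd := hc'.abs_sub_le
  simp only at hm
  have hlip := hg'.lip h h₀
  rw [abs_of_pos (sub_pos.2 h1), hg0'] at hlip
  rw [abs_le] at hcd hlip
  -- The selection and the arc `w` agree at `h` up to `m` periods and each moves by at most `h -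
  -- h₀`. At `h₀` the selection was therefore within `2 (h - h₀) < ε₁` of a lift of the common
  -- point, hence exactly there.
  have hceq : c + (-m : ℤ) * period α = θ₀ := by
    refine hgap _ ⟨T.liftSet_add hα hc.mem_right (-m), ?_⟩ ?_
    · push_cast
      have := neg_abs_le θ₀
      have := le_abs_self θ₀
      rw [abs_le]; constructor <;> linarith [hcd.1, hcd.2, hlip.1, hlip.2]
    · push_cast
      rw [abs_lt]; constructor <;> linarith [hcd.1, hcd.2, hlip.1, hlip.2]
  push_cast at hceq
  -- Switching to `v` at the common point ends strictly farther left, contradicting leftmostness.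
  have hs2 : Sel T.liftSet h₀ c h (g h + m * period α) := by
    refine ⟨h1.le, fun s => g s + m * period α, fun s u => by simpa using hg.lip s u,
      by simp only [hg0]; linarith, rfl, fun s s1 s2 => ?_⟩
    refine T.liftSet_add hα ?_ m
    rcases s1.eq_or_lt with rfl | s1
    · exact ⟨v, by rw [hg0]; exact hzv⟩
    · exact ⟨v, hmem s s1 (by linarith)⟩
  have hle : T.leftPath k h ≤ _ := leftmost_le (hc.trans hs2)
  rw [hm, l1, l2, hg0, hg0'] at hle
  nlinarith [sub_pos.2 h1]

theorem length_lower_of_not_isPlanar (H : IsInstance α t) {T : SpiralSubtree α t}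
    (hT : T.IsSpiralTree) (hnp : ¬ T.IsPlanar) {G : ℤ → ℤ → ℝ} (hG0 : ∀ i, G i i ≤ 0)
    (hG : ∀ i k j : ℤ, i ≤ k → k < j → j < i + n → G i j ≤ G i k + G (k + 1) j +
      (Real.exp (-joinHeight α t i k) - Real.exp (-joinHeight α t i j)) +
      (Real.exp (-joinHeight α t (k + 1) j) - Real.exp (-joinHeight α t i j))) :
    ∃ c : ℤ, G (c + 1) (c + n) + Real.exp (-joinHeight α t (c + 1) (c + n)) <
      Real.cos α * T.length := by
  classical
  obtain ⟨w, h₀, ε, hε, hw⟩ := exists_avoided_arc H hT hnp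
  obtain ⟨c, hc, hinj⟩ := lower_bound_leftPath H hT hG0 hG
  refine ⟨c, ?_⟩
  set x := G (c + 1) (c + n) + Real.exp (-joinHeight α t (c + 1) (c + n)) with hx
  set I := Set.Ioo (Real.exp (-(h₀ + ε))) (Real.exp (-h₀)) with hI
  have hlt : Real.exp (-(h₀ + ε)) < Real.exp (-h₀) := Real.exp_lt_exp.2 (by linarith)
  have hI0 : I ⊆ Set.Ioi 0 := fun ρ hρ => (Real.exp_pos _).trans hρ.1
  have hnn := mul_nonneg H.cos_pos.le (T.length_nonneg H.tan_pos H.cos_pos)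
  have key : ENNReal.ofReal x + ENNReal.ofReal (Real.exp (-h₀) - Real.exp (-(h₀ + ε))) ≤
      ENNReal.ofReal (Real.cos α * T.length) := by
    have e : ENNReal.ofReal (Real.exp (-h₀) - Real.exp (-(h₀ + ε))) =
        ∫⁻ ρ in Set.Ioi 0, I.indicator 1 ρ := by
      rw [MeasureTheory.lintegral_indicator_one measurableSet_Ioo, MeasureTheory.Measure.restrict_apply
        measurableSet_Ioo, Set.inter_eq_left.2 hI0, Real.volume_Ioo]
    rw [e]
    refine (add_le_add_left hc _).trans ((MeasureTheory.le_lintegral_add _ _).trans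
      (le_trans ?_ (lintegral_arcsAt_Ioi H.tan_pos H.cos_pos)))
    refine MeasureTheory.setLIntegral_mono' measurableSet_Ioi fun ρ hρ => ?_
    have hρ0 : 0 < ρ := hρ
    by_cases hρI : ρ ∈ I
    · have h1 : h₀ < -Real.log ρ := by
        have := Real.log_lt_log hρ0 hρI.2
        rw [Real.log_exp] at this
        linarith
      have h2 : -Real.log ρ < h₀ + ε := by
        have := Real.log_lt_log (Real.exp_pos _) hρI.1
        rw [Real.log_exp] at this
        linarith
      obtain ⟨hwm, hwa⟩ := hw _ h1 h2
      -- On these radii the values inject into the arcs other than `w`, so the arc count exceeds the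
      -- value count by at least one.
      have := T.card_le_card_arcs (U := (T.arcsAt ρ).erase w) H.tan_pos (hinj (-Real.log ρ))
        fun y hy => by
          obtain ⟨k, -, k3, rfl⟩ := mem_valuesAt.1 hy
          obtain ⟨u, hu, hu'⟩ := hwa k k3
          refine ⟨u, Finset.mem_erase.2 ⟨hu, ?_⟩, hu'⟩
          have := T.mem_arcsAt_of_mem_trace H.tan_pos hu'
          rwa [neg_neg, Real.exp_log hρ0] at this
      rw [neg_neg, Real.exp_log hρ0] at hwm
      have h3 := Finset.card_erase_add_one hwm
      rw [Set.indicator_of_mem hρI, Pi.one_apply]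
      exact_mod_cast (by omega : (valuesAt t T.leftPath (c + 1) (c + n) (-Real.log ρ)).card + 1 ≤
        (T.arcsAt ρ).card)
    · rw [Set.indicator_of_notMem hρI, add_zero]
      have := card_valuesAt_le H T (D := Set.univ)
        (fun k _ _ h _ h3 => (sel_leftPath H hT h3).mem_right) (fun h _ => hinj h)
        (h := -Real.log ρ) trivial
      rw [neg_neg, Real.exp_log hρ0] at this
      exact_mod_cast this
  have hpos : 0 < Real.exp (-h₀) - Real.exp (-(h₀ + ε)) := by linarith
  have h1 := (ENNReal.ofReal_add_le (p := x)).trans key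
  rw [ENNReal.ofReal_le_ofReal_iff hnn] at h1
  linarith

end SpiralSubtree

end SpiralTrees
namespace SpiralTrees

/-! ### Counterclockwise order of directions -/

theorem ccwAngle_eq {x y : ℂ} {c : ℝ} (h0 : 0 ≤ c) (h1 : c < 2 * Real.pi) (m : ℤ)
    (h : y.arg - x.arg = c + m * (2 * Real.pi)) : ccwAngle x y = c := by
  unfold ccwAngle
  rw [toIcoMod_eq_iff]
  exact ⟨⟨h0, by simpa using h1⟩, m, by rw [h, zsmul_eq_mul]⟩

theorem ccwAngle_spec (x y : ℂ) : 0 ≤ ccwAngle x y ∧ ccwAngle x y < 2 * Real.pi ∧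
    ∃ m : ℤ, y.arg - x.arg = ccwAngle x y + m * (2 * Real.pi) := by
  have h := toIcoMod_mem_Ico Real.two_pi_pos 0 (y.arg - x.arg)
  rw [zero_add] at h
  refine ⟨h.1, h.2, toIcoDiv Real.two_pi_pos 0 (y.arg - x.arg), ?_⟩
  have := toIcoMod_add_toIcoDiv_zsmul Real.two_pi_pos 0 (y.arg - x.arg)
  rw [zsmul_eq_mul] at this
  exact this.symm

theorem Ccw.rotate {x y z : ℂ} (h : Ccw x y z) : Ccw y z x := by
  obtain ⟨h1, h2⟩ := h
  obtain ⟨-, -, m, hm⟩ := ccwAngle_spec x y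
  obtain ⟨-, h3, m', hm'⟩ := ccwAngle_spec x z
  have e1 : ccwAngle y z = ccwAngle x z - ccwAngle x y :=
    ccwAngle_eq (by linarith) (by linarith) (m' - m) (by push_cast; linarith)
  have e2 : ccwAngle y x = 2 * Real.pi - ccwAngle x y :=
    ccwAngle_eq (by linarith) (by linarith) (-m - 1) (by push_cast; linarith)
  rw [Ccw, e1, e2]
  constructor <;> linarith

theorem ccwAngle_mul_left {p x y : ℂ} (hp : p ≠ 0) (hx : x ≠ 0) (hy : y ≠ 0) :
    ccwAngle (p * x) (p * y) = ccwAngle x y := by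
  obtain ⟨h1, h2, m, hm⟩ := ccwAngle_spec x y
  obtain ⟨k, hk⟩ := Real.Angle.angle_eq_iff_two_pi_dvd_sub.1
    ((Complex.arg_mul_coe_angle hp hx).trans (Real.Angle.coe_add _ _).symm)
  obtain ⟨l, hl⟩ := Real.Angle.angle_eq_iff_two_pi_dvd_sub.1
    ((Complex.arg_mul_coe_angle hp hy).trans (Real.Angle.coe_add _ _).symm)
  exact ccwAngle_eq h1 h2 (m + l - k) (by push_cast; linarith)

/-- The branch cut of the argument runs through the half-plane of `c`, so an argument above `π / 2`
and one below `-π / 2` are treated separately; in the latter case `2π` is added. -/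
theorem Ccw_of_quadrants {a b c : ℂ} (ha : 0 < a.re) (ha' : a.im < 0) (hb : 0 < b.re)
    (hb' : 0 < b.im) (hc : c.re < 0) : Ccw a b c := by
  have a1 := (abs_lt.1 (Complex.abs_arg_lt_pi_div_two_iff.2 (Or.inl ha))).1
  have a2 := Complex.arg_neg_iff.2 ha'
  have b1 := (abs_lt.1 (Complex.abs_arg_lt_pi_div_two_iff.2 (Or.inl hb))).2
  have b2 : 0 < b.arg := by
    refine lt_of_le_of_ne (Complex.arg_nonneg_iff.2 hb'.le) fun h => ?_
    exact hb'.ne' (Complex.arg_eq_zero_iff.1 h.symm).2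
  have c1 : Real.pi / 2 < |c.arg| := by
    by_contra h
    exact absurd (Complex.abs_arg_le_pi_div_two_iff.1 (not_lt.1 h)) (not_le.2 hc)
  have c2 := Complex.neg_pi_lt_arg c
  have c3 := Complex.arg_le_pi c
  have e1 : ccwAngle a b = b.arg - a.arg :=
    ccwAngle_eq (by linarith) (by linarith) 0 (by push_cast; linarith)
  rw [Ccw, e1]
  rcases lt_abs.1 c1 with h | h
  · rw [ccwAngle_eq (x := a) (y := c) (c := c.arg - a.arg) (by linarith) (by linarith) 0
      (by push_cast; linarith)]
    constructor <;> linarith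
  · rw [ccwAngle_eq (x := a) (y := c) (c := c.arg - a.arg + 2 * Real.pi) (by linarith)
      (by linarith) (-1) (by push_cast; linarith)]
    constructor <;> linarith

/-- `exp s cos (T s) ≥ (1 + s)(1 - T² s² / 2)`, which exceeds `1` because `s T² < 1` and `s < 1`. It
says that a point slightly before a node on a spiral is displaced outwards, in the half-plane
opposite to the outgoing arc. -/
theorem exp_cos_gt_one {T s : ℝ} (hT : 0 < T) (hs : 0 < s) (hs' : s < 1 / (1 + T ^ 2)) :
    1 < Real.exp s * Real.cos (T * s) ∧ 0 < Real.sin (T * s) := by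
  rw [lt_div_iff₀ (by positivity)] at hs'
  have h1 := Real.add_one_le_exp s
  have h2 := Real.one_sub_sq_div_two_le_cos (x := T * s)
  have h3 : s < 1 := by nlinarith [mul_pos hs (pow_pos hT 2)]
  have h4 : s * T ^ 2 < 1 := by nlinarith
  have h5 : 0 < 1 - (T * s) ^ 2 / 2 := by nlinarith [mul_pos hs (pow_pos hT 2)]
  constructor
  · have h6 : (s + 1) * (1 - (T * s) ^ 2 / 2) ≤ Real.exp s * Real.cos (T * s) :=
      mul_le_mul h1 h2 h5.le (Real.exp_pos s).le
    have h7 : (s + 1) * (1 - (T * s) ^ 2 / 2) =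
        1 + s * (1 - (s * T ^ 2) * (s + 1) / 2) := by ring
    have h8 : (s * T ^ 2) * (s + 1) < 2 := by nlinarith [mul_pos hs (pow_pos hT 2)]
    nlinarith [mul_pos hs (show 0 < 1 - (s * T ^ 2) * (s + 1) / 2 by linarith)]
  · refine Real.sin_pos_of_pos_of_lt_pi (mul_pos hT hs) ?_
    have h9 : T * s < 1 := by nlinarith [sq_nonneg (T - 1), mul_pos hs hT]
    linarith [Real.pi_gt_three]

/-- The displacement along a spiral. -/
theorem cyl_add_sub_cyl (α h θ s σ : ℝ) : cyl α (h + s) (θ + σ * s) - cyl α h θ =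
    cyl α h θ * (Complex.exp ((-s : ℝ) + (Real.tan α * (σ * s) : ℝ) * Complex.I) - 1) := by
  rw [mul_sub, mul_one, cyl, cyl, ← Complex.exp_add]
  congr 2
  push_cast
  ring

theorem exp_sub_one_re (a b : ℝ) :
    (Complex.exp ((a : ℝ) + (b : ℝ) * Complex.I) - 1).re = Real.exp a * Real.cos b - 1 := by
  simp [Complex.exp_re]

theorem exp_sub_one_im (a b : ℝ) :
    (Complex.exp ((a : ℝ) + (b : ℝ) * Complex.I) - 1).im = Real.exp a * Real.sin b := by
  simp [Complex.exp_im]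

/-- Points on an incoming right spiral, an incoming left spiral and an outgoing spiral are seen in
counterclockwise order. -/
theorem Ccw_local {α : ℝ} (hα : 0 < Real.tan α) {h θ s₁ s₂ s₃ σ : ℝ} (h1 : 0 < s₁)
    (h1' : s₁ < 1 / (1 + Real.tan α ^ 2)) (h2 : 0 < s₂) (h2' : s₂ < 1 / (1 + Real.tan α ^ 2))
    (h3 : 0 < s₃) :
    Ccw (cyl α (h - s₁) (θ - 1 * s₁) - cyl α h θ) (cyl α (h - s₂) (θ - (-1) * s₂) - cyl α h θ)
      (cyl α (h + s₃) (θ + σ * s₃) - cyl α h θ) := by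
  have e1 := cyl_add_sub_cyl α h θ (-s₁) 1
  have e2 := cyl_add_sub_cyl α h θ (-s₂) (-1)
  have e3 := cyl_add_sub_cyl α h θ s₃ σ
  have r1 : h + -s₁ = h - s₁ ∧ θ + 1 * -s₁ = θ - 1 * s₁ := ⟨by ring, by ring⟩
  have r2 : h + -s₂ = h - s₂ ∧ θ + -1 * -s₂ = θ - (-1) * s₂ := ⟨by ring, by ring⟩
  rw [r1.1, r1.2] at e1
  rw [r2.1, r2.2] at e2
  rw [e1, e2, e3]
  obtain ⟨c1, d1⟩ := exp_cos_gt_one hα h1 h1'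
  obtain ⟨c2, d2⟩ := exp_cos_gt_one hα h2 h2'
  set A := Complex.exp ((- -s₁ : ℝ) + (Real.tan α * (1 * -s₁) : ℝ) * Complex.I) - 1 with hA
  set B := Complex.exp ((- -s₂ : ℝ) + (Real.tan α * (-1 * -s₂) : ℝ) * Complex.I) - 1 with hB
  set C := Complex.exp ((-s₃ : ℝ) + (Real.tan α * (σ * s₃) : ℝ) * Complex.I) - 1 with hC
  have hA1 : 0 < A.re := by
    rw [hA, exp_sub_one_re, neg_neg, show Real.tan α * (1 * -s₁) = -(Real.tan α * s₁) by ring,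
      Real.cos_neg]
    linarith
  have hA2 : A.im < 0 := by
    rw [hA, exp_sub_one_im, show Real.tan α * (1 * -s₁) = -(Real.tan α * s₁) by ring, Real.sin_neg]
    have := mul_pos (Real.exp_pos (- -s₁)) d1
    linarith
  have hB1 : 0 < B.re := by
    rw [hB, exp_sub_one_re, neg_neg, show Real.tan α * (-1 * -s₂) = Real.tan α * s₂ by ring]
    linarith
  have hB2 : 0 < B.im := by
    rw [hB, exp_sub_one_im, show Real.tan α * (-1 * -s₂) = Real.tan α * s₂ by ring]
    exact mul_pos (Real.exp_pos _) d2
  have hC1 : C.re < 0 := by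
    rw [hC, exp_sub_one_re]
    have : Real.exp (-s₃) < 1 := by rw [Real.exp_lt_one_iff]; linarith
    have := mul_le_of_le_one_right (Real.exp_pos (-s₃)).le (Real.cos_le_one (Real.tan α * (σ * s₃)))
    linarith
  have ne : ∀ {z : ℂ}, z.re ≠ 0 → z ≠ 0 := fun hz h => hz (by rw [h]; rfl)
  have := Ccw_of_quadrants hA1 hA2 hB1 hB2 hC1
  unfold Ccw at this ⊢
  rwa [ccwAngle_mul_left (cyl_ne_zero _ _ _) (ne hA1.ne') (ne hB1.ne'),
    ccwAngle_mul_left (cyl_ne_zero _ _ _) (ne hA1.ne') (ne hC1.ne)]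

/-! ### Leaf order of planar spiral trees -/

namespace SpiralSubtree

section General

variable {α : ℝ} {ι : Type} {t : ι → ℂ} {T : SpiralSubtree α t}

theorem LeafCcw.rotate {i j k : ι} (h : T.LeafCcw i j k) : T.LeafCcw j k i := by
  obtain ⟨m, a, b, c, ha, hb, hc, hab, hbc, hac, hev⟩ := h
  refine ⟨m, b, c, a, hb, hc, ha, hbc, hac.symm, hab.symm, ?_⟩
  filter_upwards [hev] with ε hε y hy z hz x hx h1 h2 h3
  exact (hε x hx y hy z hz h3 h1 h2).rotate

/-- After a common point, two paths to the root are the same. -/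
theorem eq_of_common (hα : 0 < Real.tan α) {u u₁ u₂ v₁ v₂ : T.V} {z z₁ z₂ : ℂ}
    (hz : z ∈ T.trace u) (h1 : T.IsAncestor u v₁) (h2 : T.IsAncestor u v₂)
    (hu1 : T.IsAncestor u₁ v₁) (hu2 : T.IsAncestor u₂ v₂) (hz1 : z₁ ∈ T.trace u₁)
    (hz2 : z₂ ∈ T.trace u₂) (h12 : ‖z₁‖ = ‖z₂‖) (hle : ‖z₁‖ ≤ ‖z‖) : z₁ = z₂ := by
  have key : ∀ {u₁ v₁ : T.V} {z₁ : ℂ}, T.IsAncestor u v₁ → T.IsAncestor u₁ v₁ → z₁ ∈ T.trace u₁ →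
      ‖z₁‖ ≤ ‖z‖ → T.IsAncestor u₁ u := by
    intro u₁ v₁ z₁ h1 hu1 hz1 hle
    rcases hu1.total h1 with h | h
    · exact h
    by_cases hne : u = u₁
    · rw [hne]; exact .refl _
    have e1 := (h.parent_of_ne hne).norm_le hα
    have e2 := (T.norm_of_mem_trace hα hz).2.2
    have e3 := (T.norm_of_mem_trace hα hz1).2.1
    linarith
  exact (path_unique hα (key h1 hu1 hz1 hle) (key h2 hu2 hz2 (h12 ▸ hle)) hz1 hz2 h12).2

/-- Two nodes have a lowest common ancestor. -/
theorem exists_lca (v w : T.V) : ∃ m, T.IsAncestor m v ∧ T.IsAncestor m w ∧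
    ∀ m', T.IsAncestor m' v → T.IsAncestor m' w → ‖T.pos m'‖ ≤ ‖T.pos m‖ := by
  obtain ⟨m, ⟨h1, h2⟩, hmax⟩ := Set.exists_max_image {m | T.IsAncestor m v ∧ T.IsAncestor m w}
    (fun m => ‖T.pos m‖) (Set.toFinite _) ⟨T.root, isAncestor_root v, isAncestor_root w⟩
  exact ⟨m, h1, h2, fun m' e1 e2 => hmax m' ⟨e1, e2⟩⟩

/-- The shape of an incoming arc near its end. -/
theorem incoming (hα : 0 < Real.tan α) {a m : T.V} (ha : a ≠ T.root) (hm : T.parent a = m)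
    {h θ : ℝ} (hp : T.pos m = cyl α h θ) : ∃ σ : ℝ, (σ = 1 ∨ σ = -1) ∧ ∃ δ > 0,
      (∀ s, 0 < s → s < δ → cyl α (h - s) (θ - σ * s) ∈ T.trace a) ∧
      ∀ x ∈ T.trace a, ‖x‖ < Real.exp (-(h - δ)) →
        ∃ s, 0 < s ∧ s < δ ∧ x = cyl α (h - s) (θ - σ * s) := by
  obtain ⟨θ₀, g, hpa, hg, hgθ, htr, hend⟩ := T.exists_trace_lift hα ha
  rw [hm, hp, norm_cyl] at htr
  rw [hm, hp] at hend
  obtain ⟨b, hb, hb'⟩ := hend (cyl_ne_zero _ _ _)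
  obtain ⟨rfl, q, hq⟩ := (cyl_eq_iff hα).1 hb'
  obtain ⟨δ, hδ, σ, hσ, hlin⟩ := hg.left h
  have hpt : ∀ s, 0 ≤ s → s ≤ δ → cyl α (h - s) (θ - σ * s) = cyl α (h - s) (g (h - s)) := by
    intro s h1 h2
    rw [hlin s h1 h2, ← cyl_add_period hα _ (g h - σ * s) q, hq]
    congr 1
    ring
  refine ⟨σ, hσ, min δ (h - -Real.log ‖T.pos a‖), lt_min hδ (by linarith), fun s h1 h2 => ?_,
    fun x hx hxn => ?_⟩
  · rw [lt_min_iff] at h2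
    rw [hpt s h1.le h2.1.le, htr]
    exact ⟨h - s, by linarith [h2.2], Real.exp_lt_exp.2 (by linarith), rfl⟩
  · obtain ⟨c, h1, h2, rfl⟩ := (htr x).1 hx
    rw [norm_cyl, Real.exp_lt_exp] at hxn
    rw [Real.exp_lt_exp] at h2
    have hlt : h - c < min δ (h - -Real.log ‖T.pos a‖) := by linarith
    refine ⟨h - c, by linarith, hlt, ?_⟩
    rw [hpt (h - c) (by linarith) (hlt.le.trans (min_le_left _ _)), sub_sub_cancel]

/-- The shape of the outgoing arc near its start. -/
theorem outgoing {m : T.V} (hm : m ≠ T.root) {h θ : ℝ} (hp : T.pos m = cyl α h θ) :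
    ∃ σ : ℝ, ∃ δ > 0, ∀ x ∈ T.trace m, Real.exp (-(h + δ)) < ‖x‖ →
      ∃ s, 0 ≤ s ∧ s < δ ∧ x = cyl α (h + s) (θ + σ * s) := by
  obtain ⟨g, hg, hgh, htr, -⟩ := T.trace_lift hm hp
  obtain ⟨δ, hδ, σ, hσ, hlin⟩ := hg.right h
  refine ⟨σ, δ, hδ, fun x hx hxn => ?_⟩
  obtain ⟨c, h1, h2, rfl⟩ := (htr x).1 hx
  rw [norm_cyl, Real.exp_lt_exp] at hxn
  refine ⟨c - h, by linarith, by linarith, ?_⟩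
  have := hlin (c - h) (by linarith) (by linarith)
  rw [add_sub_cancel] at this ⊢
  rw [this, hgh]

/-- In a planar drawing, two incoming arcs arrive on spirals of different kinds. -/
theorem incoming_ne (hP : T.IsPlanar) {a b : T.V} (hab : a ≠ b) {h θ σ σ' δ δ' : ℝ} (hδ : 0 < δ)
    (hδ' : 0 < δ') (h1 : ∀ s, 0 < s → s < δ → cyl α (h - s) (θ - σ * s) ∈ T.trace a)
    (h2 : ∀ s, 0 < s → s < δ' → cyl α (h - s) (θ - σ' * s) ∈ T.trace b) : σ ≠ σ' := by
  rintro rfl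
  have h3 : min δ δ' / 2 < min δ δ' := half_lt_self (lt_min hδ hδ')
  have h4 : 0 < min δ δ' / 2 := half_pos (lt_min hδ hδ')
  exact Set.disjoint_left.1 (hP.1 a b hab) (h1 _ h4 (h3.trans_le (min_le_left _ _)))
    (h2 _ h4 (h3.trans_le (min_le_right _ _)))

end General

variable {n : ℕ} [NeZero n] {α : ℝ} {t : Fin n → ℂ}

/-- Below a terminal that is not a leaf there is a leaf, which is another terminal. Its path passes
through the first one, which then lies in its cone and so in its spiral region. Planarity plays no
role. -/
theorem terminalsAreLeaves (H : IsInstance α t) {T : SpiralSubtree α t} (hT : T.IsSpiralTree) :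
    T.TerminalsAreLeaves := by
  have hα := H.tan_pos
  intro i w hw hwi
  obtain ⟨x, hwx, hx⟩ := exists_leaf hα w
  obtain ⟨j, rfl⟩ := T.leaf_term x hx
  have hij : i ≠ j := by
    rintro rfl
    exact IsAncestor.not_parent hα hw hwi hwx
  have hanc : T.IsAncestor (T.term i) (T.term j) := (hwi ▸ isAncestor_parent w).trans hwx
  have hi := H.cyl_lift i.val
  have hj := H.cyl_lift j.val
  rw [red_coe] at hi hj
  have hle := hanc.norm_le hα
  rw [T.pos_term, T.pos_term, hi, hj, norm_cyl, norm_cyl, Real.exp_le_exp, neg_le_neg_iff] at hle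
  obtain ⟨g, hg, hgh, htr, -⟩ := T.exists_path ((T.pos_term j).trans hj)
  obtain ⟨u, hu, hu'⟩ := htr (liftHeight t i.val) hle
    (by rw [show T.pos T.root = 0 from hT, norm_zero]; exact Real.exp_pos _)
  have hmem := T.pos_mem_trace hα (term_ne_root H hT i)
  rw [T.pos_term, hi] at hmem
  have heq := (path_unique hα hu hanc hu' hmem (by simp [norm_cyl])).2
  refine H.empty i j hij ?_
  rw [hi, hj, ← heq]
  refine cyl_mem_spiralRegion H.alpha_pos H.alpha_lt ?_
  rw [← hgh, ← abs_of_nonneg (sub_nonneg.2 hle)]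
  exact hg.lip _ _

/-- `g` is a lift of the path from the lift `a` of a terminal to the root. -/
structure IsPath (T : SpiralSubtree α t) (a : ℤ) (g : ℝ → ℝ) : Prop where
  lip : ∀ s u, |g s - g u| ≤ |s - u|
  start : g (liftHeight t a) = liftAngle α t a
  mem : ∀ h, liftHeight t a ≤ h →
    ∃ u, T.IsAncestor u (T.term (red n a)) ∧ cyl α h (g h) ∈ T.trace u

variable {T : SpiralSubtree α t}

theorem exists_isPath (H : IsInstance α t) (hT : T.IsSpiralTree) (a : ℤ) : ∃ g, T.IsPath a g := by
  obtain ⟨g, hg, hgh, htr, -⟩ := T.exists_path ((T.pos_term (red n a)).trans (H.cyl_lift a))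
  refine ⟨g, hg.lip, hgh, fun h hh => htr h hh ?_⟩
  rw [show T.pos T.root = 0 from hT, norm_zero]
  exact Real.exp_pos _

theorem IsPath.shift (H : IsInstance α t) {a : ℤ} {g : ℝ → ℝ} (hg : T.IsPath a g) (m : ℤ) :
    T.IsPath (a + n * m) fun h => g h + m * period α where
  lip s u := by simpa using hg.lip s u
  start := by rw [liftHeight_add, hg.start, liftAngle_add]
  mem h hh := by
    rw [liftHeight_add] at hh
    rw [red_add_mul]
    obtain ⟨u, hu, hu'⟩ := hg.mem h hh
    exact ⟨u, hu, by rwa [cyl_add_period H.tan_pos]⟩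

theorem IsPath.continuous {a : ℤ} {g : ℝ → ℝ} (hg : T.IsPath a g) : Continuous g :=
  (LipschitzWith.of_dist_le_mul (K := 1) fun a b => by
    simpa [Real.dist_eq] using hg.lip a b).continuous

theorem IsPath.bounds {a : ℤ} {g : ℝ → ℝ} (hg : T.IsPath a g) {h : ℝ} (hh : liftHeight t a ≤ h) :
    liftY α t a - h ≤ g h ∧ g h ≤ liftX α t a + h := by
  have := hg.lip h (liftHeight t a)
  rw [hg.start, abs_of_nonneg (sub_nonneg.2 hh), abs_le] at this
  unfold liftX liftY
  constructor <;> linarith [this.1, this.2]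

/-- The point at a given distance on the path from a terminal. -/
theorem IsPath.eq_of_mem (H : IsInstance α t) {a : ℤ} {g : ℝ → ℝ} (hg : T.IsPath a g) {h : ℝ}
    {u : T.V} {z : ℂ} (hu : T.IsAncestor u (T.term (red n a))) (hz : z ∈ T.trace u)
    (hzh : ‖z‖ = Real.exp (-h)) : liftHeight t a ≤ h ∧ cyl α h (g h) = z := by
  have hh : liftHeight t a ≤ h := by
    have h1 := (T.norm_of_mem_trace H.tan_pos hz).2.2.trans (hu.norm_le H.tan_pos)
    rw [hzh, T.pos_term, H.cyl_lift, norm_cyl, Real.exp_le_exp] at h1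
    linarith
  obtain ⟨u', hu', hz'⟩ := hg.mem h hh
  exact ⟨hh, (path_unique H.tan_pos hu' hu hz' hz (by rw [hzh, norm_cyl])).2⟩

/-- The order holds when the later path starts, by the cones. If it changed, the lifts would cross;
by planarity the crossing lies on one arc, and afterwards the two paths agree modulo the period. A
continuous difference with values in the multiples of the period cannot leave `0`. -/
theorem IsPath.le (H : IsInstance α t) (hP : T.IsPlanar) {a b : ℤ} (hab : a < b) {g g' : ℝ → ℝ}
    (hg : T.IsPath a g) (hg' : T.IsPath b g') {h : ℝ} (ha : liftHeight t a ≤ h)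
    (hb : liftHeight t b ≤ h) : g h ≤ g' h := by
  have hα := H.tan_pos
  by_contra hcon
  push Not at hcon
  obtain ⟨hX, hY⟩ := H.lift_strict hab
  set h₀ := max (liftHeight t a) (liftHeight t b) with hh₀
  have hstart : g h₀ < g' h₀ := by
    rcases le_total (liftHeight t a) (liftHeight t b) with hl | hl
    · have h1 := (hg.bounds hl).2
      rw [hh₀, max_eq_right hl, hg'.start]
      unfold liftX at h1 hX
      linarith
    · have h1 := (hg'.bounds hl).1
      rw [hh₀, max_eq_left hl, hg.start]
      unfold liftY at h1 hY
      linarith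
  have h0 : h₀ ≤ h := max_le ha hb
  obtain ⟨c, hc, hc'⟩ := intermediate_value_Icc h0 (hg.continuous.sub hg'.continuous).continuousOn
    (show (0 : ℝ) ∈ Set.Icc (g h₀ - g' h₀) (g h - g' h) from ⟨by linarith, by linarith⟩)
  simp only [Pi.sub_apply] at hc'
  obtain ⟨u, hu, hu1⟩ := hg.mem c ((le_max_left _ _).trans hc.1)
  obtain ⟨u', hu', hu1'⟩ := hg'.mem c ((le_max_right _ _).trans hc.1)
  rw [← sub_eq_zero.1 hc'] at hu1'
  have huu : u = u' := by
    by_contra hne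
    exact Set.disjoint_left.1 (hP.1 u u' hne) hu1 hu1'
  subst huu
  have hmod : ∀ s, c ≤ s → ∃ m : ℤ, g s = g' s + m * period α := by
    intro s hs
    obtain ⟨w, hw, hw1⟩ := hg.mem s (((le_max_left _ _).trans hc.1).trans hs)
    obtain ⟨w', hw', hw1'⟩ := hg'.mem s (((le_max_right _ _).trans hc.1).trans hs)
    refine ((cyl_eq_iff hα).1 (eq_of_common hα hu1 hu hu' hw hw' hw1 hw1' (by simp [norm_cyl]) ?_)).2
    rw [norm_cyl, norm_cyl]
    exact Real.exp_le_exp.2 (by linarith)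
  have hp := period_pos hα
  obtain ⟨m, hm⟩ := hmod h hc.2
  have hm0 : (0 : ℝ) < m := by
    by_contra hm0
    have := mul_nonpos_of_nonpos_of_nonneg (not_lt.1 hm0) hp.le
    linarith
  have hm1 : (1 : ℝ) ≤ m := by
    have : 0 < m := by exact_mod_cast hm0
    exact_mod_cast this
  have hm2 := mul_le_mul_of_nonneg_right hm1 hp.le
  -- The difference goes from `0` to at least one period, so it takes the value `period α / 2`,
  -- which is not a multiple of the period.
  obtain ⟨s, hs, hs'⟩ := intermediate_value_Icc hc.2
    (hg.continuous.sub hg'.continuous).continuousOn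
    (show period α / 2 ∈ Set.Icc (g c - g' c) (g h - g' h) from ⟨by linarith, by linarith⟩)
  simp only [Pi.sub_apply] at hs'
  obtain ⟨k, hk⟩ := hmod s hs.1
  have h1 : (k : ℝ) * period α = 1 / 2 * period α := by linarith
  have h2 := mul_right_cancel₀ hp.ne' h1
  have h3 : ((2 * k : ℤ) : ℝ) = (1 : ℤ) := by push_cast; linarith
  have h4 : 2 * k = 1 := by exact_mod_cast h3
  omega

/-- The lift of a cyclic index with values near a given cyclic index. -/
theorem lift_of_mem_window {i j : Fin n} {J : ℤ} (hJ : red n J = j) (h1 : (i.val : ℤ) - n < J)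
    (h2 : J < i.val) : J = j.val ∨ J = j.val - n := by
  have h3 : J % n = j.val := by rw [← red_val, hJ]
  have hi := i.2
  rcases le_or_gt 0 J with h | h
  · left
    rw [← h3, Int.emod_eq_of_lt h (by omega)]
  · right
    have h4 : (J + n) % n = j.val := by rw [Int.add_emod_right, h3]
    rw [Int.emod_eq_of_lt (by omega) (by omega)] at h4
    omega

/-- The leaf order at a node `m` that separates `i` and `j` and is not above `k`. -/
theorem leafCcw_of_not_isAncestor (H : IsInstance α t) (hT : T.IsSpiralTree) (hP : T.IsPlanar)
    {i j k : Fin n} (hijk : (i < j ∧ j < k) ∨ (j < k ∧ k < i) ∨ (k < i ∧ i < j)) {m a b : T.V}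
    (ha : a ≠ T.root) (hb : b ≠ T.root) (ham : T.parent a = m) (hbm : T.parent b = m)
    (hai : T.IsAncestor a (T.term i)) (hbj : T.IsAncestor b (T.term j)) (hab : a ≠ b)
    (hk : ¬ T.IsAncestor m (T.term k)) : T.LeafCcw i j k := by
  have hα := H.tan_pos
  have hpp := period_pos hα
  have hm : m ≠ T.root := fun h => hk (h ▸ isAncestor_root _)
  have hmi : T.IsAncestor m (T.term i) := (ham ▸ isAncestor_parent a).trans hai
  have hmj : T.IsAncestor m (T.term j) := (hbm ▸ isAncestor_parent b).trans hbj
  have hmm := T.pos_mem_trace hα hm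
  have hpath : ∀ l : Fin n, ∃ g, T.IsPath l.val g := fun l => exists_isPath H hT _
  obtain ⟨g, hg⟩ := hpath i
  set h := -Real.log ‖T.pos m‖ with hh
  have hnm : ‖T.pos m‖ = Real.exp (-h) := by
    rw [hh, neg_neg, Real.exp_log (norm_pos_iff.2 (T.pos_ne_zero hm))]
  obtain ⟨hih, hpm⟩ := hg.eq_of_mem H (by rwa [red_coe]) hmm hnm
  set θ := g h with hθ
  obtain ⟨σ, hσ, δ, hδ, hin, hin'⟩ := incoming hα ha ham hpm.symm
  obtain ⟨σ', hσ', δ', hδ', hjn, hjn'⟩ := incoming hα hb hbm hpm.symm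
  obtain ⟨τ, δ'', hδ'', hout⟩ := outgoing hm hpm.symm
  have hne := incoming_ne hP hab hδ hδ' hin hjn
  -- The branch of `i` arrives on a right spiral, from smaller angles. Otherwise the branch of `j`
  -- lies to its left just before `m`, the cyclic order places a lift of `k` between the two, and
  -- the path of `k` is squeezed into `m`, against `hk`.
  have hσ1 : σ = 1 := by
    by_contra hcon
    have hσm : σ = -1 := hσ.resolve_left hcon
    have hσp : σ' = 1 := by
      rcases hσ' with h | h
      · exact h
      · exact absurd (hσm.trans h.symm) hne
    subst hσm hσp
    obtain ⟨g₁, hg₁⟩ := hpath j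
    obtain ⟨hjh, hpm₁⟩ := hg₁.eq_of_mem H (by rwa [red_coe]) hmm hnm
    obtain ⟨-, q, hq⟩ := (cyl_eq_iff hα).1 (hpm.trans hpm₁.symm)
    have hg' := hg₁.shift H q
    set J : ℤ := j.val + n * q with hJ
    have hrJ : red n J = j := by rw [hJ, red_add_mul, red_coe]
    set g' : ℝ → ℝ := fun h => g₁ h + q * period α with hg'def
    have hθ' : g' h = θ := hq.symm
    -- the paths just before `m`
    set s := min (min δ δ') (period α / 4) / 2 with hs
    have hs0 : 0 < s := by positivity
    have hs1 : s < min (min δ δ') (period α / 4) := half_lt_self (by positivity)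
    rw [lt_min_iff, lt_min_iff] at hs1
    obtain ⟨⟨hs1, hs2⟩, hs3⟩ := hs1
    -- Both `f (h - s)` and `θ - κ * s` are within `s` of `θ`, and `s < period α / 4`; as they
    -- differ by a multiple of the period, they are equal.
    have near : ∀ {A : ℤ} {f : ℝ → ℝ} {v : T.V} {κ : ℝ}, T.IsPath A f →
        T.IsAncestor v (T.term (red n A)) → (κ = 1 ∨ κ = -1) → f h = θ →
        cyl α (h - s) (θ - κ * s) ∈ T.trace v →
        liftHeight t A ≤ h - s ∧ f (h - s) = θ - κ * s := by
      intro A f v κ hf hv hκ hfh hmem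
      obtain ⟨e1, e2⟩ := hf.eq_of_mem H hv hmem (norm_cyl _ _ _)
      refine ⟨e1, ?_⟩
      obtain ⟨-, r, hr⟩ := (cyl_eq_iff hα).1 e2
      have hl := hf.lip (h - s) h
      rw [show h - s - h = -s by ring, abs_neg, abs_of_pos hs0, hfh, abs_le] at hl
      have hr0 : r = 0 := by
        have h3 : (r : ℝ) * period α < 1 * period α := by
          rcases hκ with rfl | rfl <;> linarith [hl.1, hl.2]
        have h4 : (-1 : ℝ) * period α < r * period α := by
          rcases hκ with rfl | rfl <;> linarith [hl.1, hl.2]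
        have h5 := lt_of_mul_lt_mul_right h3 hpp.le
        have h6 := lt_of_mul_lt_mul_right h4 hpp.le
        have h7 : r < 1 := by exact_mod_cast h5
        have h8 : -1 < r := by exact_mod_cast h6
        omega
      rw [hr, hr0]; simp
    obtain ⟨i1, i2⟩ := near hg (by rwa [red_coe]) hσ rfl (hin s hs0 hs1)
    obtain ⟨j1, j2⟩ := near hg' (by rwa [hrJ]) hσ' hθ' (hjn s hs0 hs2)
    have hJne : ∀ q' : ℤ, J + n * q' ≠ i.val := by
      intro q' he
      have : red n (J + n * q') = red n i.val := by rw [he]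
      rw [red_add_mul, hrJ, red_coe] at this
      rcases hijk with h | h | h <;> omega
    have hJi : J < i.val := by
      rcases lt_trichotomy J i.val with h | h | h
      · exact h
      · exact absurd (by simpa using h) (hJne 0)
      · have := hg.le H hP h hg' i1 j1
        linarith
    have hiJ : (i.val : ℤ) - n < J := by
      rcases lt_trichotomy (J + n * 1) i.val with h' | h' | h'
      · have := (hg'.shift H 1).le H hP h' hg (h := h - s) (by rw [liftHeight_add]; exact j1) i1
        push_cast at this
        linarith
      · exact absurd h' (hJne 1)
      · omega
    -- The lift `J` lies in `(i - n, i)`, so it is `j` or `j - n`; in each case the cyclic order of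
    -- `i, j, k` provides a lift of `k` strictly between `J` and `i`.
    obtain ⟨K, hrK, hK1, hK2⟩ : ∃ K, red n K = k ∧ J < K ∧ K < i.val := by
      have hkm : red n ((k.val : ℤ) - n) = k := by
        have := red_add_mul (n := n) k.val (-1)
        rw [red_coe] at this
        rwa [show (k.val : ℤ) + n * (-1) = k.val - n by ring] at this
      rcases lift_of_mem_window hrJ hiJ hJi with e | e
      · refine ⟨k.val, red_coe k, ?_, ?_⟩ <;>
        · rcases hijk with h | h | h <;> omega
      · by_cases hki : k < i
        · exact ⟨k.val, red_coe k, by omega, by omega⟩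
        · refine ⟨k.val - n, hkm, ?_, ?_⟩ <;>
          · rcases hijk with h | h | h <;> omega
    obtain ⟨g₂, hg₂⟩ := exists_isPath H hT K
    have hjhs : liftHeight t J ≤ h := j1.trans (by linarith)
    -- The point `m` lies in the cones of `J` and `i`, so `Y_K - X_K < Y_i - X_J ≤ 2 h`: the path of
    -- `K` has started by height `h`.
    have hKh : liftHeight t K ≤ h := by
      have b1 := (hg.bounds hih).1
      have b2 := (hg'.bounds hjhs).2
      rw [hθ'] at b2
      have b3 := (H.lift_strict hK1).1
      have b4 := (H.lift_strict hK2).2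
      rw [liftHeight_eq (α := α)]
      linarith
    have l1 := hg'.le H hP hK1 hg₂ hjhs hKh
    have l2 := hg₂.le H hP hK2 hg hKh hih
    have l3 : g₂ h = θ := le_antisymm l2 (hθ' ▸ l1)
    obtain ⟨u, hu, hu'⟩ := hg₂.mem h hKh
    rw [l3, hpm] at hu'
    have : u = m := by
      by_contra hne
      exact Set.disjoint_left.1 (hP.1 u m hne) hu' hmm
    rw [this, hrK] at hu
    exact hk hu
  have hσ2 : σ' = -1 := by
    rcases hσ' with h | h
    · exact absurd (hσ1.trans h.symm) hne
    · exact h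
  subst hσ1 hσ2
  have ham' : a ≠ m := fun e => (T.norm_parent_lt hα ha).ne (by rw [ham, e])
  have hbm' : b ≠ m := fun e => (T.norm_parent_lt hα hb).ne (by rw [hbm, e])
  refine ⟨m, a, b, m, Or.inl ⟨ha, ham, hai⟩, Or.inl ⟨hb, hbm, hbj⟩, Or.inr ⟨rfl, hm, hk⟩, hab, hbm',
    ham', ?_⟩
  set r := 1 / (1 + Real.tan α ^ 2) with hr
  have hr0 : 0 < r := by positivity
  have hE : ∀ {x}, 0 < x → 0 < Real.exp (-(h - x)) - Real.exp (-h) := fun hx =>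
    sub_pos.2 (Real.exp_lt_exp.2 (by linarith))
  have hE' : 0 < Real.exp (-h) - Real.exp (-(h + δ'')) :=
    sub_pos.2 (Real.exp_lt_exp.2 (by linarith))
  -- The circle must be so small that it meets the three arcs only in their straight pieces next to
  -- `m`, and the incoming ones within the distance `r` required by `Ccw_local`.
  filter_upwards [self_mem_nhdsWithin, mem_nhdsWithin_of_mem_nhds (gt_mem_nhds (hE hδ)),
    mem_nhdsWithin_of_mem_nhds (gt_mem_nhds (hE hδ')),
    mem_nhdsWithin_of_mem_nhds (gt_mem_nhds (hE hr0)),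
    mem_nhdsWithin_of_mem_nhds (gt_mem_nhds hE')] with ε ε0 ε1 ε2 ε3 ε4 x hx y hy z hz h1 h2 h3
  have hnorm : ∀ {x : ℂ}, ‖x - T.pos m‖ = ε →
      ‖x‖ ≤ Real.exp (-h) + ε ∧ Real.exp (-h) - ε ≤ ‖x‖ := by
    intro x hx
    have e1 := norm_sub_norm_le x (T.pos m)
    have e2 := norm_sub_norm_le (T.pos m) x
    rw [norm_sub_rev] at e2
    rw [hx, hnm] at e1 e2
    constructor <;> linarith
  obtain ⟨s₁, p1, -, rfl⟩ := hin' x hx (by linarith [(hnorm h1).1])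
  obtain ⟨s₂, p2, -, rfl⟩ := hjn' y hy (by linarith [(hnorm h2).1])
  obtain ⟨s₃, p3, -, rfl⟩ := hout z hz (by linarith [(hnorm h3).2])
  have q1 := (hnorm h1).1
  have q2 := (hnorm h2).1
  rw [norm_cyl] at q1 q2
  have q1' : -(h - s₁) < -(h - r) := Real.exp_lt_exp.1 (by linarith)
  have q2' : -(h - s₂) < -(h - r) := Real.exp_lt_exp.1 (by linarith)
  have p3' : 0 < s₃ := by
    refine lt_of_le_of_ne p3 fun h0 => ?_
    rw [← h0, ← hpm] at h3
    simp only [mul_zero, add_zero, sub_self, norm_zero] at h3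
    exact (ne_of_gt ε0) h3.symm
  rw [← hpm]
  exact Ccw_local hα p1 (by linarith) p2 (by linarith) p3'

/-- The leaf order at the root. -/
theorem leafCcw_root (H : IsInstance α t) (hT : T.IsSpiralTree) (hP : T.IsPlanar)
    {i j k : Fin n} (hij : i < j) (hjk : j < k) {a b c : T.V}
    (ha : a ≠ T.root) (hb : b ≠ T.root) (hc : c ≠ T.root) (ham : T.parent a = T.root)
    (hbm : T.parent b = T.root) (hcm : T.parent c = T.root) (hai : T.IsAncestor a (T.term i))
    (hbj : T.IsAncestor b (T.term j)) (hck : T.IsAncestor c (T.term k)) (hab : a ≠ b) (hbc : b ≠ c)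
    (hac : a ≠ c) : T.LeafCcw i j k := by
  have hα := H.tan_pos
  refine ⟨T.root, a, b, c, Or.inl ⟨ha, ham, hai⟩, Or.inl ⟨hb, hbm, hbj⟩, Or.inl ⟨hc, hcm, hck⟩, hab,
    hbc, hac, ?_⟩
  obtain ⟨g, hg⟩ := exists_isPath H hT i.val
  obtain ⟨g', hg'⟩ := exists_isPath H hT j.val
  obtain ⟨g'', hg''⟩ := exists_isPath H hT k.val
  filter_upwards [self_mem_nhdsWithin] with ε ε0 x hx y hy z hz h1 h2 h3
  have ε0' : 0 < ε := ε0
  rw [show T.pos T.root = 0 from hT, sub_zero] at h1 h2 h3 ⊢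
  rw [sub_zero, sub_zero]
  have hεh : ε = Real.exp (-(-Real.log ε)) := by rw [neg_neg, Real.exp_log ε0']
  obtain ⟨e1, rfl⟩ := hg.eq_of_mem H (by rwa [red_coe]) hx (h1.trans hεh)
  obtain ⟨e2, rfl⟩ := hg'.eq_of_mem H (by rwa [red_coe]) hy (h2.trans hεh)
  obtain ⟨e3, rfl⟩ := hg''.eq_of_mem H (by rwa [red_coe]) hz (h3.trans hεh)
  set h := -Real.log ε
  have l1 := hg.le H hP (by exact_mod_cast hij) hg' e1 e2
  have l2 := hg'.le H hP (by exact_mod_cast hjk) hg'' e2 e3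
  -- The translate of `i` by one period follows `k`; this bounds the three angles within one turn.
  have l3 := hg''.le H hP (by have := k.2; omega) (hg.shift H 1) e3
    (by rw [liftHeight_add]; exact e1)
  push_cast at l3
  rw [one_mul] at l3
  refine Ccw_cyl hα (lt_of_le_of_ne l1 fun he => ?_) (lt_of_le_of_ne l2 fun he => ?_)
    (lt_of_le_of_ne l3 fun he => ?_)
  · rw [he] at hx
    exact Set.disjoint_left.1 (hP.1 a b hab) hx hy
  · rw [he] at hy
    exact Set.disjoint_left.1 (hP.1 b c hbc) hy hz
  · have := cyl_add_period hα h (g h) 1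
    push_cast at this
    rw [one_mul, ← he] at this
    rw [← this] at hx
    exact Set.disjoint_left.1 (hP.1 a c hac) hx hz

/-- Let `m` be the lowest common ancestor of `i` and `j`. If `m` is not above `k`, the pair `i, j`
is settled at `m`. If `k` shares a branch at `m` with `i` or `j`, a rotation of the triple reduces
to that case. Three different branches are possible only at the root. -/
theorem leafOrderFollows_of_isPlanar (H : IsInstance α t) (hT : T.IsSpiralTree)
    (hP : T.IsPlanar) : T.LeafOrderFollows := by
  have hα := H.tan_pos
  have hleaf := terminalsAreLeaves H hT
  have child : ∀ {m : T.V} {i j : Fin n}, i ≠ j → T.IsAncestor m (T.term i) →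
      T.IsAncestor m (T.term j) → ∃ a, a ≠ T.root ∧ T.parent a = m ∧ T.IsAncestor a (T.term i) := by
    intro m i j hij hi hj
    refine hi.exists_child ?_
    rintro rfl
    by_cases h : T.term i = T.term j
    · have e := congrArg T.pos h
      rw [T.pos_term, T.pos_term] at e
      refine H.empty i j hij ?_
      rw [e]
      have := H.cyl_lift j.val
      rw [red_coe] at this
      rw [this]
      exact cyl_mem_spiralRegion H.alpha_pos H.alpha_lt (by simp)
    · obtain ⟨w, h1, h2, -⟩ := hj.exists_child h
      exact hleaf i w h1 h2
  -- the case of a node that is above only two of the terminals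
  have low : ∀ {i j k : Fin n}, (i < j ∧ j < k) ∨ (j < k ∧ k < i) ∨ (k < i ∧ i < j) →
      (∃ m', T.IsAncestor m' (T.term i) ∧ T.IsAncestor m' (T.term j) ∧
        ∀ m, T.IsAncestor m (T.term i) → T.IsAncestor m (T.term j) → T.IsAncestor m (T.term k) →
          ‖T.pos m‖ < ‖T.pos m'‖) → T.LeafCcw i j k := by
    rintro i j k hijk ⟨m', h1, h2, h3⟩
    have hij : i ≠ j := by rcases hijk with h | h | h <;> omega
    obtain ⟨m, hi, hj, hmax⟩ := exists_lca (T.term i) (T.term j)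
    have hk : ¬ T.IsAncestor m (T.term k) := fun hk =>
      absurd (hmax m' h1 h2) (not_le.2 (h3 m hi hj hk))
    obtain ⟨a, ha, ham, hai⟩ := child hij hi hj
    obtain ⟨b, hb, hbm, hbj⟩ := child hij.symm hj hi
    refine leafCcw_of_not_isAncestor H hT hP hijk ha hb ham hbm hai hbj ?_ hk
    rintro rfl
    have := hmax a hai hbj
    have := T.norm_parent_lt hα ha
    rw [ham] at this
    linarith
  intro i j k hijk
  have hij : i ≠ j := by rcases hijk with h | h | h <;> omega
  have hjk : j ≠ k := by rcases hijk with h | h | h <;> omega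
  have hik : i ≠ k := by rcases hijk with h | h | h <;> omega
  obtain ⟨m, hi, hj, hmax⟩ := exists_lca (T.term i) (T.term j)
  by_cases hk : T.IsAncestor m (T.term k)
  swap
  · refine low hijk ⟨m, hi, hj, fun m' h1 h2 h3 => lt_of_not_ge fun hge => hk ?_⟩
    rcases hi.total h1 with h | h
    · exact h.trans h3
    · by_cases hne : m' = m
      · exact hne ▸ h3
      have := T.norm_parent_lt hα (v := m) (fun hr => hk (hr ▸ isAncestor_root _))
      have := (h.parent_of_ne hne).norm_le hα
      linarith
  obtain ⟨a, ha, ham, hai⟩ := child hij hi hj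
  obtain ⟨b, hb, hbm, hbj⟩ := child hij.symm hj hi
  obtain ⟨c, hc, hcm, hck⟩ := child hik.symm hk hi
  have lt_child : ∀ {v : T.V}, v ≠ T.root → T.parent v = m → ‖T.pos m‖ < ‖T.pos v‖ :=
    fun h1 h2 => h2 ▸ T.norm_parent_lt hα h1
  have hab : a ≠ b := by
    rintro rfl
    exact absurd (hmax a hai hbj) (not_le.2 (lt_child ha ham))
  by_cases hac : a = c
  · subst hac
    refine LeafCcw.rotate (low (i := k) (j := i) (k := j) ?_ ⟨a, hck, hai, fun m' h1 h2 h3 =>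
      (hmax m' h2 h3).trans_lt (lt_child ha ham)⟩)
    rcases hijk with h | h | h
    · exact Or.inr (Or.inl h)
    · exact Or.inr (Or.inr h)
    · exact Or.inl h
  by_cases hbc : b = c
  · subst hbc
    refine LeafCcw.rotate (LeafCcw.rotate (low (i := j) (j := k) (k := i) ?_ ⟨b, hbj, hck,
      fun m' h1 h2 h3 => (hmax m' h3 h1).trans_lt (lt_child hb hbm)⟩))
    rcases hijk with h | h | h
    · exact Or.inr (Or.inr h)
    · exact Or.inl h
    · exact Or.inr (Or.inl h)
  by_cases hm : m = T.root
  · subst hm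
    rcases hijk with h | h | h
    · exact leafCcw_root H hT hP h.1 h.2 ha hb hc ham hbm hcm hai hbj hck hab hbc hac
    · exact LeafCcw.rotate (LeafCcw.rotate
        (leafCcw_root H hT hP h.1 h.2 hb hc ha hbm hcm ham hbj hck hai hbc (Ne.symm hac) (Ne.symm hab)))
    · exact LeafCcw.rotate
        (leafCcw_root H hT hP h.1 h.2 hc ha hb hcm ham hbm hck hai hbj (Ne.symm hac) hab (Ne.symm hbc))
  -- Three incoming arcs at a node other than the root: two arrive on spirals of the same kind and
  -- overlap.
  · exfalso
    obtain ⟨θ, hp⟩ := exists_cyl hα (T.pos_ne_zero hm)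
    obtain ⟨σ₁, d1, δ₁, e1, f1, -⟩ := incoming hα ha ham hp
    obtain ⟨σ₂, d2, δ₂, e2, f2, -⟩ := incoming hα hb hbm hp
    obtain ⟨σ₃, d3, δ₃, e3, f3, -⟩ := incoming hα hc hcm hp
    have n1 := incoming_ne hP hab e1 e2 f1 f2
    have n2 := incoming_ne hP hbc e2 e3 f2 f3
    have n3 := incoming_ne hP hac e1 e3 f1 f3
    rcases d1 with rfl | rfl <;> rcases d2 with rfl | rfl <;> rcases d3 with rfl | rfl <;>
      first | exact n1 rfl | exact n2 rfl | exact n3 rfl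

end SpiralSubtree

end SpiralTrees
namespace SpiralTrees

/-! ### The recurrence -/

section Recurrence

variable {n : ℕ} [NeZero n]

theorem val_sub_red {a b : ℤ} (h : a ≤ b) (h' : b < a + n) :
    (red n b - red n a).val = (b - a).toNat := by
  have := red_sub_val (n := n) h h'
  omega

/-- The candidates for the split index, in terms of lifts. -/
theorem exists_split_iff {a b : ℤ} (h : a ≤ b) (h' : b < a + n) (p : Fin n → Prop) :
    (∃ k, k - red n a < red n b - red n a ∧ p k) ↔ ∃ k : ℤ, a ≤ k ∧ k < b ∧ p (red n k) := by
  constructor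
  · rintro ⟨k, hk, hpk⟩
    rw [Fin.lt_def, val_sub_red h h'] at hk
    refine ⟨a + (k - red n a).val, by omega, by omega, ?_⟩
    rwa [red_add, red_coe, add_sub_cancel]
  · rintro ⟨k, h1, h2, hpk⟩
    refine ⟨red n k, ?_, hpk⟩
    rw [Fin.lt_def, val_sub_red h1 (by omega), val_sub_red h h']
    omega

open Classical in
/-- The solution of a recurrence over cyclic intervals, by the length of the interval. -/
def intervalRec (c : Fin n → Fin n → Fin n → ℝ) : ℕ → ℤ → ℝ
  | 0, _ => 0
  | d + 1, a => (Finset.univ : Finset (Fin (d + 1))).inf' ⟨0, Finset.mem_univ _⟩ fun e =>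
      intervalRec c e a + intervalRec c (d - e) (a + e + 1) +
        c (red n a) (red n (a + e)) (red n (a + (d + 1 : ℕ)))
  termination_by d => d
  decreasing_by all_goals omega

theorem intervalRec_red (c : Fin n → Fin n → Fin n → ℝ) (d : ℕ) : ∀ a b : ℤ,
    red n a = red n b → intervalRec c d a = intervalRec c d b := by
  induction d using Nat.strong_induction_on with
  | _ d ih =>
    intro a b hab
    cases d with
    | zero => rw [intervalRec, intervalRec]
    | succ d =>
      rw [intervalRec, intervalRec]
      congr 1
      funext e
      have h1 : ∀ x : ℤ, red n (a + x) = red n (b + x) := fun x => by rw [red_add, red_add, hab]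
      rw [ih e (by omega) a b hab, hab, h1, h1, ih (d - e) (by omega) (a + e + 1) (b + e + 1)
        (by rw [add_assoc, add_assoc, h1])]

/-- Cyclic intervals are unrolled to integer intervals of length `d < n`. A split of an interval of
length `d + 1` refers only to lengths at most `d`, so existence and uniqueness follow by strong
induction on the length. -/
theorem existsUnique_recurrence (c : Fin n → Fin n → Fin n → ℝ) :
    ∃! F : Fin n → Fin n → ℝ, (∀ i, F i i = 0) ∧ ∀ i j, i ≠ j →
      IsLeast {x : ℝ | ∃ k : Fin n, k - i < j - i ∧ x = F i k + F (k + 1) j + c i k j} (F i j) := by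
  have hn : (0 : ℤ) < n := by exact_mod_cast NeZero.pos n
  set F : Fin n → Fin n → ℝ := fun i j => intervalRec c (j - i).val i.val with hF
  have hFred : ∀ (a : ℤ) (d : ℕ), d < n → F (red n a) (red n (a + d)) = intervalRec c d a := by
    intro a d hd
    simp only [hF]
    rw [val_sub_red (by omega) (by omega)]
    have : (a + (d : ℤ) - a).toNat = d := by omega
    rw [this]
    exact intervalRec_red c d _ _ (red_coe _)
  -- The recurrence restated for a starting lift `a` and a length `d + 1`, with the split given by
  -- its offset `e`.
  have key : ∀ F' : Fin n → Fin n → ℝ, (∀ i j, i ≠ j →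
      IsLeast {x : ℝ | ∃ k : Fin n, k - i < j - i ∧ x = F' i k + F' (k + 1) j + c i k j} (F' i j)) ↔
      ∀ (a : ℤ) (d : ℕ), d + 1 < n → IsLeast {x : ℝ | ∃ e : Fin (d + 1),
        x = F' (red n a) (red n (a + e)) + F' (red n (a + e + 1)) (red n (a + (d + 1 : ℕ))) +
          c (red n a) (red n (a + e)) (red n (a + (d + 1 : ℕ)))}
        (F' (red n a) (red n (a + (d + 1 : ℕ)))) := by
    intro F'
    have hset : ∀ (a : ℤ) (d : ℕ), d + 1 < n → {x : ℝ | ∃ k : Fin n,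
        k - red n a < red n (a + (d + 1 : ℕ)) - red n a ∧
        x = F' (red n a) k + F' (k + 1) (red n (a + (d + 1 : ℕ))) +
          c (red n a) k (red n (a + (d + 1 : ℕ)))} = {x : ℝ | ∃ e : Fin (d + 1),
        x = F' (red n a) (red n (a + e)) + F' (red n (a + e + 1)) (red n (a + (d + 1 : ℕ))) +
          c (red n a) (red n (a + e)) (red n (a + (d + 1 : ℕ)))} := by
      intro a d hd
      ext x
      simp only [Set.mem_ofPred_eq]
      rw [exists_split_iff (by omega) (by omega)]
      constructor
      · rintro ⟨k, h1, h2, hx⟩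
        refine ⟨⟨(k - a).toNat, by omega⟩, ?_⟩
        simp only
        rw [show a + ((k - a).toNat : ℤ) = k by omega, hx, red_add k 1, red_one]
      · rintro ⟨e, hx⟩
        refine ⟨a + e, by omega, by omega, ?_⟩
        rw [hx, red_add (a + e) 1, red_one]
    constructor
    · intro hF' a d hd
      rw [← hset a d hd]
      refine hF' _ _ fun h => ?_
      have h1 := val_sub_red (n := n) (a := a) (b := a + (d + 1 : ℕ)) (by omega) (by omega)
      rw [← h, sub_self, Fin.val_zero] at h1
      omega
    · intro hF' i j hij
      obtain ⟨a, b, rfl, rfl, h1, h2⟩ := exists_red i j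
      have hab : a ≠ b := fun h => hij (by rw [h])
      have h3 := hF' a (b - a - 1).toNat (by omega)
      rw [← hset a _ (by omega)] at h3
      rwa [show a + (((b - a - 1).toNat + 1 : ℕ) : ℤ) = b by omega] at h3
  refine ⟨F, ⟨fun i => ?_, (key F).2 fun a d hd => ?_⟩, fun F' hF' => ?_⟩
  · simp [hF, intervalRec]
  · have hval : ∀ e : Fin (d + 1), F (red n a) (red n (a + e)) +
        F (red n (a + e + 1)) (red n (a + (d + 1 : ℕ))) +
          c (red n a) (red n (a + e)) (red n (a + (d + 1 : ℕ))) =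
        intervalRec c e a + intervalRec c (d - e) (a + e + 1) +
          c (red n a) (red n (a + e)) (red n (a + (d + 1 : ℕ))) := by
      intro e
      have he := e.2
      rw [hFred a e (by omega),
        show a + ((d + 1 : ℕ) : ℤ) = a + e + 1 + ((d - e : ℕ) : ℤ) by push_cast; omega,
        hFred _ _ (by omega)]
    simp only [hval]
    rw [hFred a (d + 1) hd, intervalRec]
    constructor
    · obtain ⟨e, -, he⟩ := Finset.exists_mem_eq_inf' (s := (Finset.univ : Finset (Fin (d + 1))))
        ⟨0, Finset.mem_univ _⟩ fun e : Fin (d + 1) =>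
          intervalRec c e a + intervalRec c (d - e) (a + e + 1) +
            c (red n a) (red n (a + e)) (red n (a + (d + 1 : ℕ)))
      exact ⟨e, he⟩
    · rintro x ⟨e, rfl⟩
      exact Finset.inf'_le (fun e : Fin (d + 1) =>
          intervalRec c e a + intervalRec c (d - e) (a + e + 1) +
            c (red n a) (red n (a + e)) (red n (a + (d + 1 : ℕ)))) (Finset.mem_univ e)
  · have hall : ∀ (d : ℕ), d < n → ∀ a : ℤ, F' (red n a) (red n (a + d)) = intervalRec c d a := by
      intro d
      induction d using Nat.strong_induction_on with
      | _ d ih =>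
        intro hd a
        cases d with
        | zero => simp [intervalRec, hF'.1]
        | succ d =>
          have h1 := (key F').1 hF'.2 a d hd
          have hval : ∀ e : Fin (d + 1), F' (red n a) (red n (a + e)) +
              F' (red n (a + e + 1)) (red n (a + (d + 1 : ℕ))) +
              c (red n a) (red n (a + e)) (red n (a + (d + 1 : ℕ))) =
              intervalRec c e a + intervalRec c (d - e) (a + e + 1) +
              c (red n a) (red n (a + e)) (red n (a + (d + 1 : ℕ))) := by
            intro e
            have he := e.2
            rw [ih e (by omega) (by omega) a,
              show a + ((d + 1 : ℕ) : ℤ) = a + e + 1 + ((d - e : ℕ) : ℤ) by push_cast; omega,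
              ih (d - e) (by omega) (by omega)]
          simp only [hval] at h1
          rw [intervalRec]
          refine h1.unique ⟨?_, ?_⟩
          · obtain ⟨e, -, he⟩ := Finset.exists_mem_eq_inf'
              (s := (Finset.univ : Finset (Fin (d + 1)))) ⟨0, Finset.mem_univ _⟩
              fun e : Fin (d + 1) => intervalRec c e a + intervalRec c (d - e) (a + e + 1) +
                c (red n a) (red n (a + e)) (red n (a + (d + 1 : ℕ)))
            exact ⟨e, he⟩
          · rintro x ⟨e, rfl⟩
            exact Finset.inf'_le (fun e : Fin (d + 1) =>
              intervalRec c e a + intervalRec c (d - e) (a + e + 1) +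
                c (red n a) (red n (a + e)) (red n (a + (d + 1 : ℕ)))) (Finset.mem_univ e)
    funext i j
    obtain ⟨a, b, rfl, rfl, h1, h2⟩ := exists_red i j
    have := hall (b - a).toNat (by omega) a
    rw [← hFred a _ (by omega), show a + ((b - a).toNat : ℤ) = b by omega] at this
    exact this

variable {α : ℝ} {t : Fin n → ℂ}

theorem existsUnique_isRecurrence (α : ℝ) (t : Fin n → ℂ) : ∃! F, IsRecurrence α t F := by
  have := existsUnique_recurrence (n := n) fun i k j =>
    spiralDist α (joinPoint α t i k) (joinPoint α t i j) +
      spiralDist α (joinPoint α t (k + 1) j) (joinPoint α t i j)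
  simpa only [IsRecurrence, ← add_assoc] using this

/-- The length of a spiral segment between join points of heights `u ≤ v`. -/
def segCost (α u v : ℝ) : ℝ := (Real.cos α)⁻¹ * (Real.exp (-u) - Real.exp (-v))

theorem spiralDist_liftJoin {a b a' b' : ℤ}
    (h : joinHeight α t a b ≤ joinHeight α t a' b') :
    spiralDist α (liftJoin α t a b) (liftJoin α t a' b') =
      segCost α (joinHeight α t a b) (joinHeight α t a' b') := by
  rw [spiralDist, segCost, IsInstance.norm_liftJoin, IsInstance.norm_liftJoin, abs_of_nonneg]
  exact sub_nonneg.2 (Real.exp_le_exp.2 (neg_le_neg h))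

/-- The cost of splitting the interval `[a, b]` after `k`. -/
def splitCost (α : ℝ) (t : Fin n → ℂ) (F : Fin n → Fin n → ℝ) (a b k : ℤ) : ℝ :=
  F (red n a) (red n k) + F (red n (k + 1)) (red n b) +
    segCost α (joinHeight α t a k) (joinHeight α t a b) +
    segCost α (joinHeight α t (k + 1) b) (joinHeight α t a b)

theorem IsRecurrence.isLeast (H : IsInstance α t) {F : Fin n → Fin n → ℝ}
    (hF : IsRecurrence α t F) {a b : ℤ} (h : a < b) (h' : b < a + n) :
    IsLeast {x : ℝ | ∃ k, a ≤ k ∧ k < b ∧ x = splitCost α t F a b k} (F (red n a) (red n b)) := by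
  have hne : red n a ≠ red n b := fun he => by
    have h1 := val_sub_red (n := n) h.le h'
    rw [← he, sub_self, Fin.val_zero] at h1
    omega
  have := hF.2 _ _ hne
  simp only [exists_split_iff h.le h'] at this
  convert this using 2
  ext x
  refine exists_congr fun k => and_congr_right fun h1 => and_congr_right fun h2 => ?_
  have e : red n k + 1 = red n (k + 1) := by rw [red_add, red_one]
  rw [e, H.joinPoint_eq h.le h', H.joinPoint_eq h1 (by omega), H.joinPoint_eq (a := k + 1) (by omega)
    (by omega), spiralDist_liftJoin (H.joinHeight_lt_right h2).le,
    spiralDist_liftJoin (H.joinHeight_lt_left (by omega)).le, splitCost]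

/-- Multiplying by `cos α` turns segment lengths into differences of radii, the form in which the
counting bounds take their cost function. -/
theorem IsRecurrence.scaled (H : IsInstance α t) {F : Fin n → Fin n → ℝ}
    (hF : IsRecurrence α t F) : ∀ i k j : ℤ, i ≤ k → k < j → j < i + n →
      Real.cos α * F (red n i) (red n j) ≤
      Real.cos α * F (red n i) (red n k) + Real.cos α * F (red n (k + 1)) (red n j) +
      (Real.exp (-joinHeight α t i k) - Real.exp (-joinHeight α t i j)) +
      (Real.exp (-joinHeight α t (k + 1) j) - Real.exp (-joinHeight α t i j)) := by
  intro i k j h1 h2 h3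
  have h4 := (hF.isLeast H (h1.trans_lt h2) h3).2 ⟨k, h1, h2, rfl⟩
  have h5 := mul_le_mul_of_nonneg_left h4 H.cos_pos.le
  have hc := H.cos_pos.ne'
  refine h5.trans (le_of_eq ?_)
  unfold splitCost segCost
  field_simp

end Recurrence

/-! ### Construction of subtrees -/

namespace SpiralSubtree

variable {α : ℝ}

/-- The tree with a single node. -/
def single (α : ℝ) {ι : Type} [Nonempty ι] (p : ℂ) : SpiralSubtree α (fun _ : ι => p) where
  V := Unit
  fintypeV := inferInstance
  root := ()
  parent := id
  parent_root := rfl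
  parent_iterate _ := ⟨0, rfl⟩
  pos _ := p
  term _ := ()
  pos_term _ := rfl
  leaf_term _ _ := ⟨Classical.arbitrary ι, rfl⟩
  arc _ := []
  arc_root := rfl
  arc_end _ := rfl
  arc_ne v hv := absurd rfl hv
  arc_avoid _ := by simp [arcTrace]

/-- The same tree with another index type for the terminals. -/
def reindex {ι ι' : Type} {t : ι → ℂ} {t' : ι' → ℂ} (T : SpiralSubtree α t) (f : ι' → ι)
    (hf : Function.Surjective f) (h : ∀ i, t' i = t (f i)) : SpiralSubtree α t' :=
  { T with
    term := fun i => T.term (f i)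
    pos_term := fun i => by rw [T.pos_term, h]
    leaf_term := fun v hv => by
      obtain ⟨i, hi⟩ := T.leaf_term v hv
      obtain ⟨j, rfl⟩ := hf i
      exact ⟨j, hi⟩ }

section Join

variable {κ : Type} [Fintype κ] [Nonempty κ] {ι : κ → Type} {s : ∀ k, ι k → ℂ}
  (T : ∀ k, SpiralSubtree α (s k)) (p : ℂ) (arc : κ → List (Bool × ℝ≥0∞))

open Classical in
/-- Join subtrees at a new root node. -/
def join (h_end : ∀ k, arcEnd α ((T k).pos (T k).root) (arc k) = p)
    (h_ne : ∀ k, p ≠ (T k).pos (T k).root)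
    (h_avoid : ∀ k, (0 : ℂ) ∉ arcTrace α ((T k).pos (T k).root) (arc k)) :
    SpiralSubtree α (fun x : Σ k, ι k => s x.1 x.2) where
  V := Option (Σ k, (T k).V)
  fintypeV := inferInstance
  root := none
  parent
    | none => none
    | some ⟨k, v⟩ => if v = (T k).root then none else some ⟨k, (T k).parent v⟩
  parent_root := rfl
  parent_iterate
    | none => ⟨0, rfl⟩
    | some ⟨k, v⟩ => by
      obtain ⟨m, hm⟩ := (T k).parent_iterate v
      induction m generalizing v with
      | zero => exact ⟨1, by simp only [Function.iterate_one]; exact if_pos hm⟩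
      | succ m ih =>
        by_cases hv : v = (T k).root
        · exact ⟨1, by simp only [Function.iterate_one]; exact if_pos hv⟩
        · obtain ⟨l, hl⟩ := ih _ hm
          refine ⟨l + 1, ?_⟩
          rw [Function.iterate_succ_apply]
          simp only [if_neg hv]
          exact hl
  pos
    | none => p
    | some ⟨k, v⟩ => (T k).pos v
  term x := some ⟨x.1, (T x.1).term x.2⟩
  pos_term x := (T x.1).pos_term x.2
  leaf_term
    | none, h => by
      refine absurd (if_pos rfl) (h (some ⟨Classical.arbitrary κ, (T (Classical.arbitrary κ)).root⟩)
        (by simp))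
    | some ⟨k, v⟩, h => by
      obtain ⟨i, hi⟩ := (T k).leaf_term v fun w hw hwv =>
        h (some ⟨k, w⟩) (by simp) (by simp only [if_neg hw, hwv])
      exact ⟨⟨k, i⟩, by simp only [hi]⟩
  arc
    | none => []
    | some ⟨k, v⟩ => if v = (T k).root then arc k else (T k).arc v
  arc_root := rfl
  arc_end
    | none => rfl
    | some ⟨k, v⟩ => by
      by_cases hv : v = (T k).root
      · subst hv; simp only [if_true]; exact h_end k
      · simp only [if_neg hv]; exact (T k).arc_end v
  arc_ne
    | none, h => absurd rfl h
    | some ⟨k, v⟩, _ => by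
      by_cases hv : v = (T k).root
      · subst hv; simp only [if_true]; exact h_ne k
      · simp only [if_neg hv]; exact (T k).arc_ne v hv
  arc_avoid
    | none => by simp [arcTrace]
    | some ⟨k, v⟩ => by
      by_cases hv : v = (T k).root
      · subst hv; simp only [if_true]; exact h_avoid k
      · simp only [if_neg hv]; exact (T k).arc_avoid v

variable {T p arc} {h_end : ∀ k, arcEnd α ((T k).pos (T k).root) (arc k) = p}
  {h_ne : ∀ k, p ≠ (T k).pos (T k).root}
  {h_avoid : ∀ k, (0 : ℂ) ∉ arcTrace α ((T k).pos (T k).root) (arc k)}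

theorem length_join : (join T p arc h_end h_ne h_avoid).length =
    ∑ k, ((T k).length + arcLength α ((T k).pos (T k).root) (arc k)) := by
  classical
  change ∑ v : Option (Σ k, (T k).V), arcLength α _ _ = _
  rw [Fintype.sum_option, Fintype.sum_sigma]
  change arcLength α p [] + _ = _
  rw [arcLength, zero_add]
  refine Finset.sum_congr rfl fun k _ => ?_
  change ∑ v : (T k).V, arcLength α ((T k).pos v)
    (if v = (T k).root then arc k else (T k).arc v) = _
  rw [length, ← Finset.add_sum_erase _ _ (Finset.mem_univ (T k).root),
    ← Finset.add_sum_erase _ (fun v => arcLength α ((T k).pos v) ((T k).arc v))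
      (Finset.mem_univ (T k).root), if_pos rfl, (T k).arc_root, arcLength, zero_add, add_comm]
  congr 1
  exact Finset.sum_congr rfl fun v hv => by rw [if_neg (Finset.ne_of_mem_erase hv)]

theorem carrier_join_subset {S : Set ℂ} (hS : ∀ k, (T k).carrier ⊆ S) (hp : p ∈ S)
    (harc : ∀ k, arcTrace α ((T k).pos (T k).root) (arc k) ⊆ S) :
    (join T p arc h_end h_ne h_avoid).carrier ⊆ S := by
  classical
  rintro z (⟨v, rfl⟩ | hz)
  · match v with
    | none => exact hp
    | some ⟨k, v⟩ => exact hS k (Or.inl ⟨v, rfl⟩)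
  · obtain ⟨v, hv⟩ := Set.mem_iUnion.1 hz
    match v, hv with
    | none, hv => exact absurd hv (by simp [trace, join, arcTrace])
    | some ⟨k, v⟩, hv =>
      change z ∈ arcTrace α ((T k).pos v) (if v = (T k).root then arc k else (T k).arc v) at hv
      by_cases h : v = (T k).root
      · subst h
        rw [if_pos rfl] at hv
        exact harc k hv
      · rw [if_neg h] at hv
        exact hS k (Or.inr (Set.mem_iUnion.2 ⟨v, hv⟩))

end Join

end SpiralSubtree

/-! ### Trees in a wedge that realise the recurrence -/

section WedgeTree

variable {n : ℕ} [NeZero n] {α : ℝ} {t : Fin n → ℂ}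

/-- The single segment of kind `d` between heights `u` and `v`. -/
def segArc (d : Bool) (u v : ℝ) : List (Bool × ℝ≥0∞) := [(d, ENNReal.ofReal (v - u))]

theorem arcEnd_segArc {d : Bool} {u v θ : ℝ} (huv : u ≤ v) :
    arcEnd α (cyl α u θ) (segArc d u v) = cyl α v (θ + sgn d * (v - u)) := by
  simp only [segArc, arcEnd, segEnd, ENNReal.ofReal_ne_top, if_false,
    ENNReal.toReal_ofReal (sub_nonneg.2 huv), spiral_cyl, add_sub_cancel]

theorem mem_arcTrace_segArc {d : Bool} {u v θ : ℝ} {z : ℂ}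
    (hz : z ∈ arcTrace α (cyl α u θ) (segArc d u v)) :
    ∃ s, 0 ≤ s ∧ s ≤ v - u ∧ z = cyl α (u + s) (θ + sgn d * s) := by
  simp only [segArc, arcTrace, Set.union_empty] at hz
  obtain ⟨s, h1, h2, rfl⟩ := hz
  refine ⟨s, h1, ?_, spiral_cyl _ _ _ _ _⟩
  exact (ENNReal.ofReal_lt_ofReal_iff_of_nonneg h1).1 h2 |>.le

theorem arcLength_segArc (hc : 0 < Real.cos α) {d : Bool} {u v θ : ℝ} (huv : u ≤ v) :
    arcLength α (cyl α u θ) (segArc d u v) = segCost α u v := by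
  rw [arcLength_eq hc, arcEnd_segArc huv, norm_cyl, norm_cyl, segCost]

theorem zero_notMem_arcTrace_segArc {d : Bool} {u v θ : ℝ} :
    (0 : ℂ) ∉ arcTrace α (cyl α u θ) (segArc d u v) := fun h => by
  obtain ⟨s, -, -, h⟩ := mem_arcTrace_segArc h
  exact cyl_ne_zero _ _ _ h.symm

theorem arcEnd_right (H : IsInstance α t) {a k b : ℤ} (h : k ≤ b) :
    arcEnd α (liftJoin α t a k) (segArc false (joinHeight α t a k) (joinHeight α t a b)) =
      liftJoin α t a b := by
  have hY := H.liftY_strictMono.monotone h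
  rw [liftJoin, arcEnd_segArc (by unfold joinHeight; linarith), liftJoin]
  congr 1
  unfold joinHeight sgn
  simp
  ring

theorem arcEnd_left (H : IsInstance α t) {a k b : ℤ} (h : a ≤ k) :
    arcEnd α (liftJoin α t k b) (segArc true (joinHeight α t k b) (joinHeight α t a b)) =
      liftJoin α t a b := by
  have hY := H.liftX_strictMono.monotone h
  rw [liftJoin, arcEnd_segArc (by unfold joinHeight; linarith), liftJoin]
  congr 1
  unfold joinHeight sgn
  simp
  ring

theorem liftJoin_ne {a b a' b' : ℤ} (h : joinHeight α t a b < joinHeight α t a' b') :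
    liftJoin α t a' b' ≠ liftJoin α t a b := fun he => by
  have := congrArg norm he
  rw [IsInstance.norm_liftJoin, IsInstance.norm_liftJoin, Real.exp_eq_exp] at this
  linarith

/-- The points of the lifted sector between the rays of two lifts. -/
def sector (α : ℝ) (t : Fin n → ℂ) (a b : ℤ) : Set ℂ :=
  {z | ∃ h θ, liftAngle α t a ≤ θ ∧ θ ≤ liftAngle α t b ∧ z = cyl α h θ}

/-- A best split gives trees rooted at the join points of `[a, k]` and `[k+1, b]`. The first lies on
the right spiral from `a` and the second on the left spiral from `b`, and these meet at the join
point of `[a, b]`. Indexing terminals by integers and using a lifted sector avoids cyclic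
comparisons during the induction. -/
theorem exists_wedge_tree (H : IsInstance α t) {F : Fin n → Fin n → ℝ} (hF : IsRecurrence α t F)
    (d : ℕ) : ∀ a b : ℤ, a ≤ b → b < a + n → b - a ≤ d →
    ∃ T : SpiralSubtree α (fun k : {k : ℤ // a ≤ k ∧ k ≤ b} => t (red n k)),
      T.pos T.root = liftJoin α t a b ∧ T.carrier ⊆ sector α t a b ∧
      T.length = F (red n a) (red n b) := by
  induction d with
  | zero =>
    intro a b hab _ hd
    obtain rfl : a = b := by push_cast at hd; omega
    have : Nonempty {k : ℤ // a ≤ k ∧ k ≤ a} := ⟨⟨a, le_rfl, le_rfl⟩⟩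
    refine ⟨(SpiralSubtree.single α (t (red n a))).reindex (id : {k : ℤ // a ≤ k ∧ k ≤ a} → _)
      Function.surjective_id fun k => ?_, ?_, ?_, ?_⟩
    · have : (k : ℤ) = a := le_antisymm k.2.2 k.2.1
      rw [this]
    · exact (H.liftJoin_self a).symm
    · rintro z (⟨v, rfl⟩ | hz)
      · exact ⟨liftHeight t a, liftAngle α t a, le_rfl, le_rfl, H.cyl_lift a⟩
      · obtain ⟨v, hv⟩ := Set.mem_iUnion.1 hz
        exact absurd hv (Set.notMem_empty z)
    · rw [hF.1]
      simp [SpiralSubtree.length, SpiralSubtree.reindex, SpiralSubtree.single, arcLength]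
  | succ d ih =>
    intro a b hab hb hd
    rcases hab.eq_or_lt with rfl | hlt
    · exact ih a a le_rfl hb (by omega)
    push_cast at hd
    obtain ⟨k, h1, h2, hk⟩ := (hF.isLeast H hlt hb).1
    obtain ⟨T₁, r₁, c₁, l₁⟩ := ih a k h1 (by omega) (by omega)
    obtain ⟨T₂, r₂, c₂, l₂⟩ := ih (k + 1) b (by omega) (by omega) (by omega)
    have hR := H.joinHeight_lt_right (a := a) h2
    have hL := H.joinHeight_lt_left (b := b) (show a < k + 1 by omega)
    -- The two branches are indexed by the kind of their last arc: `true` is `[k+1, b]`, arriving on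
    -- a left spiral, and `false` is `[a, k]`, arriving on a right spiral.
    let lo : Bool → ℤ := fun x => bif x then k + 1 else a
    let hi : Bool → ℤ := fun x => bif x then b else k
    let ι : Bool → Type := fun x => {k' : ℤ // lo x ≤ k' ∧ k' ≤ hi x}
    let s : ∀ x, ι x → ℂ := fun x k' => t (red n k'.1)
    let T : ∀ x, SpiralSubtree α (s x) := fun x => match x with
      | true => (T₂ : SpiralSubtree α (s true))
      | false => (T₁ : SpiralSubtree α (s false))
    let arc : Bool → List (Bool × ℝ≥0∞) := fun x =>
      bif x then segArc true (joinHeight α t (k + 1) b) (joinHeight α t a b)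
      else segArc false (joinHeight α t a k) (joinHeight α t a b)
    have hend : ∀ x, arcEnd α ((T x).pos (T x).root) (arc x) = liftJoin α t a b
      | true => by
        change arcEnd α (T₂.pos T₂.root) _ = _
        rw [r₂]; exact arcEnd_left H (by omega)
      | false => by
        change arcEnd α (T₁.pos T₁.root) _ = _
        rw [r₁]; exact arcEnd_right H h2.le
    have hne : ∀ x, liftJoin α t a b ≠ (T x).pos (T x).root
      | true => by
        change _ ≠ T₂.pos T₂.root
        rw [r₂]; exact liftJoin_ne hL
      | false => by
        change _ ≠ T₁.pos T₁.root
        rw [r₁]; exact liftJoin_ne hR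
    have hav : ∀ x, (0 : ℂ) ∉ arcTrace α ((T x).pos (T x).root) (arc x)
      | true => by
        change _ ∉ arcTrace α (T₂.pos T₂.root) _
        rw [r₂]; exact zero_notMem_arcTrace_segArc
      | false => by
        change _ ∉ arcTrace α (T₁.pos T₁.root) _
        rw [r₁]; exact zero_notMem_arcTrace_segArc
    let f : {k' : ℤ // a ≤ k' ∧ k' ≤ b} → Σ x, ι x := fun k' =>
      if h : (k' : ℤ) ≤ k then ⟨false, ⟨k', k'.2.1, h⟩⟩ else ⟨true, ⟨k', (by omega : k + 1 ≤ (k' : ℤ)), k'.2.2⟩⟩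
    refine ⟨(SpiralSubtree.join T (liftJoin α t a b) arc hend hne hav).reindex f ?_ ?_, rfl, ?_, ?_⟩
    · rintro ⟨x, y⟩
      match x, y with
      | true, ⟨k', e1, e2⟩ =>
        change k + 1 ≤ k' at e1
        change k' ≤ b at e2
        refine ⟨⟨k', by omega, e2⟩, ?_⟩
        simp only [f]
        rw [dif_neg (by omega)]
      | false, ⟨k', e1, e2⟩ =>
        change a ≤ k' at e1
        change k' ≤ k at e2
        refine ⟨⟨k', e1, by omega⟩, ?_⟩
        simp only [f]
        rw [dif_pos e2]
    · intro k'
      have : (k' : ℤ) = (f k').2.1 := by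
        by_cases h : (k' : ℤ) ≤ k
        · rw [show f k' = ⟨false, ⟨k', k'.2.1, h⟩⟩ from dif_pos h]
        · rw [show f k' = ⟨true, ⟨k', (by omega : k + 1 ≤ (k' : ℤ)), k'.2.2⟩⟩ from dif_neg h]
      exact congrArg (fun x => t (red n x)) this
    -- Angles on the joining segments are between the angle of one end and that of the other;
    -- monotonicity of `X` and `Y` places both in the sector, so linear arithmetic suffices.
    · have hX : ∀ {x y : ℤ}, x ≤ y → liftX α t x ≤ liftX α t y := fun h =>
        H.liftX_strictMono.monotone h
      have hY : ∀ {x y : ℤ}, x ≤ y → liftY α t x ≤ liftY α t y := fun h =>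
        H.liftY_strictMono.monotone h
      have x1 := hX (show a ≤ k + 1 by omega)
      have x2 := hX hab
      have x3 := hX (show k + 1 ≤ b by omega)
      have y1 := hY h2.le
      have y2 := hY hab
      have y3 := hY h1
      refine SpiralSubtree.carrier_join_subset (h_end := hend) (h_ne := hne) (h_avoid := hav)
        (fun x => ?_) ?_ (fun x => ?_)
      · match x with
        | true =>
          refine Set.Subset.trans c₂ ?_
          rintro z ⟨h, θ, e1, e2, rfl⟩
          exact ⟨h, θ, (H.liftAngle_mono (by omega)).trans e1, e2, rfl⟩
        | false =>
          refine Set.Subset.trans c₁ ?_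
          rintro z ⟨h, θ, e1, e2, rfl⟩
          exact ⟨h, θ, e1, e2.trans (H.liftAngle_mono h2.le), rfl⟩
      · refine ⟨_, _, ?_, ?_, rfl⟩ <;> rw [liftAngle_eq] <;> linarith
      · match x with
        | true =>
          change arcTrace α (T₂.pos T₂.root) _ ⊆ _
          rw [r₂]
          intro z hz
          obtain ⟨σ, e1, e2, rfl⟩ := mem_arcTrace_segArc hz
          unfold joinHeight at e2
          refine ⟨_, _, ?_, ?_, rfl⟩ <;> rw [liftAngle_eq, sgn, if_pos rfl] <;> linarith
        | false =>
          change arcTrace α (T₁.pos T₁.root) _ ⊆ _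
          rw [r₁]
          intro z hz
          obtain ⟨σ, e1, e2, rfl⟩ := mem_arcTrace_segArc hz
          unfold joinHeight at e2
          refine ⟨_, _, ?_, ?_, rfl⟩ <;> rw [liftAngle_eq, sgn, if_neg Bool.false_ne_true] <;>
            linarith
    · change (SpiralSubtree.join T (liftJoin α t a b) arc hend hne hav).length = _
      rw [SpiralSubtree.length_join, Fintype.sum_bool]
      change T₂.length + arcLength α (T₂.pos T₂.root) _ +
        (T₁.length + arcLength α (T₁.pos T₁.root) _) = _
      rw [r₁, r₂, hk, l₁, l₂, splitCost]
      have e1 : arcLength α (liftJoin α t (k + 1) b) (arc true) = _ :=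
        arcLength_segArc H.cos_pos hL.le
      have e2 : arcLength α (liftJoin α t a k) (arc false) = _ :=
        arcLength_segArc H.cos_pos hR.le
      rw [e1, e2]
      ring

theorem isLeast_wedge (H : IsInstance α t) {F : Fin n → Fin n → ℝ} (hF : IsRecurrence α t F)
    (i j : Fin n) : IsLeast {l : ℝ | ∃ T : SpiralSubtree α (cyclicRange t i j),
      T.carrier ⊆ wedge (t i) (t j) ∧ T.length = l} (F i j) := by
  obtain ⟨a, b, rfl, rfl, h, h'⟩ := exists_red i j
  constructor
  · obtain ⟨T, -, hc, hl⟩ := exists_wedge_tree H hF (b - a).toNat a b h h' (by omega)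
    let f : {k : Fin n // k - red n a ≤ red n b - red n a} → {k : ℤ // a ≤ k ∧ k ≤ b} := fun k =>
      ⟨a + (k.1 - red n a).val, by omega, by
        have h1 := k.2
        rw [Fin.le_def, val_sub_red h h'] at h1
        omega⟩
    have hfk : ∀ k, red n (f k) = k.1 := fun k => by
      simp only [f]
      rw [red_add, red_coe, add_sub_cancel]
    refine ⟨T.reindex f (fun k => ?_) fun k => ?_, ?_, hl⟩
    · refine ⟨SpiralSubtree.rangeIndex h' k.2.1 k.2.2, Subtype.ext ?_⟩
      have h1 := k.2
      simp only [f, SpiralSubtree.rangeIndex]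
      rw [val_sub_red h1.1 (by omega)]
      omega
    · simp only [hfk]; rfl
    · refine Set.Subset.trans hc ?_
      rintro z ⟨u, θ, e1, e2, rfl⟩
      exact (H.cyl_mem_wedge_iff h h').2 ⟨0, by simpa using e1, by simpa using e2⟩
  · rintro l ⟨T, hT, rfl⟩
    have := T.length_lower_wedge H (G := fun i j => Real.cos α * F (red n i) (red n j))
      (fun i => by simp [hF.1]) (hF.scaled H) h h' hT
    exact le_of_mul_le_mul_left this H.cos_pos

/-- The length of an optimal spiral tree in terms of the recurrence. -/
def treeCost (α : ℝ) (t : Fin n → ℂ) (F : Fin n → Fin n → ℝ) : ℝ :=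
  ⨅ i : Fin n, (F i (i - 1) + spiralDist α (joinPoint α t i (i - 1)) 0)

theorem red_pred (a : ℤ) : red n (a + n - 1) = red n a - 1 := by
  rw [eq_sub_iff_add_eq, ← red_one, ← red_add]
  have := red_add_mul (n := n) a 1
  rw [mul_one] at this
  rw [sub_add_cancel]; exact this

theorem rootCost_eq (H : IsInstance α t) (F : Fin n → Fin n → ℝ) (a : ℤ) :
    F (red n a) (red n a - 1) + spiralDist α (joinPoint α t (red n a) (red n a - 1)) 0 =
      F (red n a) (red n (a + n - 1)) +
        (Real.cos α)⁻¹ * Real.exp (-joinHeight α t a (a + n - 1)) := by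
  have hn : (0 : ℤ) < n := by exact_mod_cast NeZero.pos n
  rw [← red_pred, H.joinPoint_eq (by omega) (by omega), spiralDist, IsInstance.norm_liftJoin, norm_zero,
    sub_zero, abs_of_pos (Real.exp_pos _)]

theorem treeCost_le (F : Fin n → Fin n → ℝ) (i : Fin n) :
    treeCost α t F ≤ F i (i - 1) + spiralDist α (joinPoint α t i (i - 1)) 0 :=
  ciInf_le (Set.finite_range _).bddBelow i

/-- The bound produces a cut `c`; the tree is charged as one that starts at terminal `c + 1` and
ends at `c + n`, which is one of the candidates in the minimum. -/
theorem treeCost_le_length (H : IsInstance α t) {F : Fin n → Fin n → ℝ} (hF : IsRecurrence α t F)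
    {T : SpiralSubtree α t} (hT : T.IsSpiralTree) : treeCost α t F ≤ T.length := by
  obtain ⟨c, hc⟩ := SpiralSubtree.length_lower H hT
    (G := fun i j => Real.cos α * F (red n i) (red n j)) (fun i => by simp [hF.1]) (hF.scaled H)
  refine (treeCost_le F (red n (c + 1))).trans ?_
  rw [rootCost_eq H, show c + 1 + (n : ℤ) - 1 = c + n by ring]
  have hcos := H.cos_pos
  rw [← mul_le_mul_iff_right₀ hcos, mul_add, mul_inv_cancel_left₀ hcos.ne']
  exact hc

theorem treeCost_lt_length (H : IsInstance α t) {F : Fin n → Fin n → ℝ} (hF : IsRecurrence α t F)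
    {T : SpiralSubtree α t} (hT : T.IsSpiralTree) (hnp : ¬ T.IsPlanar) :
    treeCost α t F < T.length := by
  obtain ⟨c, hc⟩ := SpiralSubtree.length_lower_of_not_isPlanar H hT hnp
    (G := fun i j => Real.cos α * F (red n i) (red n j)) (fun i => by simp [hF.1]) (hF.scaled H)
  refine (treeCost_le F (red n (c + 1))).trans_lt ?_
  rw [rootCost_eq H, show c + 1 + (n : ℤ) - 1 = c + n by ring]
  have hcos := H.cos_pos
  rw [← mul_lt_mul_iff_right₀ hcos, mul_add, mul_inv_cancel_left₀ hcos.ne']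
  exact hc

end WedgeTree

end SpiralTrees
namespace SpiralTrees

/-! ### Total correctness of programs -/

/-- Started in `s`, the program halts after at most `N` steps in a state that satisfies `Q`. -/
def Halts (P : Program) (s : State) (N : ℕ) (Q : State → Prop) : Prop :=
  ∃ s' c, Runs P s s' c ∧ c ≤ N ∧ Q s'

namespace Program

/-- The effect of a program without loops. -/
def exec : Program → State → State
  | skip, s => s
  | setInt a i j e, s => s.setInt a (i.eval s) (j.eval s) (e.eval s)
  | setReal a i j e, s => s.setReal a (i.eval s) (j.eval s) (e.eval s)
  | seq P Q, s => Q.exec (P.exec s)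
  | cond b P Q, s => haveI := Classical.dec (b.holds s); if b.holds s then P.exec s else Q.exec s
  | loop _ _, s => s

theorem exec_seq (P Q : Program) (s : State) : (seq P Q).exec s = Q.exec (P.exec s) := rfl

theorem exec_cond_of_holds {b : Test} {s : State} (h : b.holds s) (P Q : Program) :
    (cond b P Q).exec s = P.exec s := if_pos h

theorem exec_cond_of_not_holds {b : Test} {s : State} (h : ¬ b.holds s) (P Q : Program) :
    (cond b P Q).exec s = Q.exec s := if_neg h

/-- The program has no loops. -/
def loopFree : Program → Bool
  | skip | setInt _ _ _ _ | setReal _ _ _ _ => true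
  | seq P Q | cond _ P Q => P.loopFree && Q.loopFree
  | loop _ _ => false

/-- A bound for the number of steps of a program without loops. -/
def bound : Program → ℕ
  | skip => 1
  | setInt _ i j e => i.cost + j.cost + e.cost + 1
  | setReal _ i j e => i.cost + j.cost + e.cost + 1
  | seq P Q => P.bound + Q.bound + 1
  | cond b P Q => b.cost + (P.bound + Q.bound) + 1
  | loop _ _ => 0

/-- The integer arrays that a program writes. -/
def intWrites : Program → List ℕ
  | skip | setReal _ _ _ _ => []
  | setInt a _ _ _ => [a]
  | seq P Q | cond _ P Q => P.intWrites ++ Q.intWrites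
  | loop _ P => P.intWrites

/-- The real arrays that a program writes. -/
def realWrites : Program → List ℕ
  | skip | setInt _ _ _ _ => []
  | setReal a _ _ _ => [a]
  | seq P Q | cond _ P Q => P.realWrites ++ Q.realWrites
  | loop _ P => P.realWrites

/-- The states agree on all arrays that the program does not write. -/
def Frame (P : Program) (s s' : State) : Prop :=
  (∀ a, a ∉ P.intWrites → s'.int a = s.int a) ∧ ∀ a, a ∉ P.realWrites → s'.real a = s.real a

end Program

theorem Runs.frame {P : Program} {s s' : State} {c : ℕ} (h : Runs P s s' c) : P.Frame s s' := by
  induction h with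
  | skip | loop_false _ => exact ⟨fun _ _ => rfl, fun _ _ => rfl⟩
  | setInt s a i j e =>
    refine ⟨fun b hb => ?_, fun _ _ => rfl⟩
    have : b ≠ a := by simpa [Program.intWrites] using hb
    funext x y
    exact if_neg fun h => this h.1
  | setReal s a i j e =>
    refine ⟨fun _ _ => rfl, fun b hb => ?_⟩
    have : b ≠ a := by simpa [Program.realWrites] using hb
    funext x y
    exact if_neg fun h => this h.1
  | seq _ _ ih ih' =>
    exact ⟨fun b hb => (ih'.1 b fun h => hb (List.mem_append_right _ h)).trans
        (ih.1 b fun h => hb (List.mem_append_left _ h)),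
      fun b hb => (ih'.2 b fun h => hb (List.mem_append_right _ h)).trans
        (ih.2 b fun h => hb (List.mem_append_left _ h))⟩
  | cond_true _ _ ih =>
    exact ⟨fun b hb => ih.1 b fun h => hb (List.mem_append_left _ h),
      fun b hb => ih.2 b fun h => hb (List.mem_append_left _ h)⟩
  | cond_false _ _ ih =>
    exact ⟨fun b hb => ih.1 b fun h => hb (List.mem_append_right _ h),
      fun b hb => ih.2 b fun h => hb (List.mem_append_right _ h)⟩
  | loop_true _ _ _ ih ih' =>
    exact ⟨fun b hb => (ih'.1 b hb).trans (ih.1 b hb), fun b hb => (ih'.2 b hb).trans (ih.2 b hb)⟩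

theorem Program.exists_runs_exec {P : Program} (hP : P.loopFree = true) (s : State) :
    ∃ c ≤ P.bound, Runs P s (P.exec s) c := by
  induction P generalizing s with
  | skip => exact ⟨_, le_rfl, Runs.skip s⟩
  | setInt a i j e => exact ⟨_, le_rfl, Runs.setInt s a i j e⟩
  | setReal a i j e => exact ⟨_, le_rfl, Runs.setReal s a i j e⟩
  | seq P Q ih ih' =>
    simp only [loopFree, Bool.and_eq_true] at hP
    obtain ⟨c, hc, h⟩ := ih hP.1 s
    obtain ⟨d, hd, h'⟩ := ih' hP.2 (P.exec s)
    exact ⟨_, by simp only [bound]; omega, Runs.seq h h'⟩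
  | cond b P Q ih ih' =>
    simp only [loopFree, Bool.and_eq_true] at hP
    by_cases hb : b.holds s
    · obtain ⟨c, hc, h⟩ := ih hP.1 s
      refine ⟨b.cost + c + 1, by simp only [bound]; omega, ?_⟩
      rw [exec, if_pos hb]
      exact Runs.cond_true hb h
    · obtain ⟨c, hc, h⟩ := ih' hP.2 s
      refine ⟨b.cost + c + 1, by simp only [bound]; omega, ?_⟩
      rw [exec, if_neg hb]
      exact Runs.cond_false hb h
  | loop => simp [loopFree] at hP

namespace Halts

variable {P R : Program} {s : State} {N M : ℕ} {Q Q' : State → Prop}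

theorem mono (h : Halts P s N Q) (hN : N ≤ M) (hQ : ∀ s', P.Frame s s' → Q s' → Q' s') :
    Halts P s M Q' := by
  obtain ⟨s', c, h1, h2, h3⟩ := h
  exact ⟨s', c, h1, h2.trans hN, hQ s' h1.frame h3⟩

theorem exec (hP : P.loopFree = true) (h : Q (P.exec s)) : Halts P s P.bound Q := by
  obtain ⟨c, hc, h'⟩ := Program.exists_runs_exec hP s
  exact ⟨_, c, h', hc, h⟩

theorem seq (h : Halts P s N Q) (h' : ∀ s', P.Frame s s' → Q s' → Halts R s' M Q') :
    Halts (Program.seq P R) s (N + M + 1) Q' := by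
  obtain ⟨s', c, h1, h2, h3⟩ := h
  obtain ⟨s'', d, h4, h5, h6⟩ := h' s' h1.frame h3
  exact ⟨s'', _, Runs.seq h1 h4, by omega, h6⟩

/-- The invariant carries an iteration counter, and the test can succeed only while the counter is
below `N`. This gives termination and the step bound together. -/
theorem loop {b : Test} {Inv : ℕ → State → Prop} (h0 : Inv 0 s)
    (hstep : ∀ k s', P.Frame s s' → Inv k s' → b.holds s' → k < N ∧ Halts P s' M (Inv (k + 1))) :
    Halts (Program.loop b P) s (N * (b.cost + M + 1) + (b.cost + 1))
      fun s' => ∃ k, Inv k s' ∧ ¬ b.holds s' := by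
  suffices H : ∀ m k s', N - k ≤ m → P.Frame s s' → Inv k s' →
      Halts (Program.loop b P) s' (m * (b.cost + M + 1) + (b.cost + 1))
        fun s' => ∃ k, Inv k s' ∧ ¬ b.holds s' from
    H N 0 s (by omega) ⟨fun _ _ => rfl, fun _ _ => rfl⟩ h0
  intro m
  induction m with
  | zero =>
    intro k s' hk hf hi
    have hb : ¬ b.holds s' := fun hb => by have := (hstep k s' hf hi hb).1; omega
    exact ⟨s', _, Runs.loop_false hb, by omega, k, hi, hb⟩
  | succ m ih =>
    intro k s' hk hf hi
    by_cases hb : b.holds s'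
    · obtain ⟨h1, s₁, c, h2, h3, h4⟩ := hstep k s' hf hi hb
      have hf' := h2.frame
      obtain ⟨s₂, d, h5, h6, h7⟩ := ih (k + 1) s₁ (by omega)
        ⟨fun a ha => (hf'.1 a ha).trans (hf.1 a ha), fun a ha => (hf'.2 a ha).trans (hf.2 a ha)⟩ h4
      refine ⟨s₂, _, Runs.loop_true hb h2 h5, ?_, h7⟩
      rw [Nat.succ_mul]
      omega
    · exact ⟨s', _, Runs.loop_false hb, by omega, k, hi, hb⟩

end Halts

namespace State

variable (s : State) (a i j v a' i' j' : ℕ) (x : ℝ)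

theorem int_setInt : (s.setInt a i j v).int a' i' j' =
    if a' = a ∧ i' = i ∧ j' = j then v else s.int a' i' j' := rfl

theorem real_setInt : (s.setInt a i j v).real = s.real := rfl

theorem int_setReal : (s.setReal a i j x).int = s.int := rfl

theorem real_setReal : (s.setReal a i j x).real a' i' j' =
    if a' = a ∧ i' = i ∧ j' = j then x else s.real a' i' j' := by
  unfold setReal
  simp only
  split_ifs <;> rfl

end State

end SpiralTrees
namespace SpiralTrees

/-! ### The program: lifts of the terminals -/

namespace Program

/-- The integer variable in cell `(0, 0)` of an array. -/
abbrev var (a : ℕ) : IntExpr := .cell a (.const 0) (.const 0)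

abbrev setVar (a : ℕ) (e : IntExpr) : Program := .setInt a (.const 0) (.const 0) e

abbrev alphaExpr : RealExpr := .cell 0 (.const 0) (.const 0)

abbrev tanExpr : RealExpr := .div (.sin alphaExpr) (.cos alphaExpr)

/-- `π` is obtained as the polar angle of `-1`; constants are natural numbers, so `-1` is the real
difference `0 - 1`. -/
abbrev twoPiExpr : RealExpr :=
  .mul (.ofInt (.const 2))
    (.polarAngle (.sub (.ofInt (.const 0)) (.ofInt (.const 1))) (.ofInt (.const 0)))

abbrev argExpr (i : IntExpr) : RealExpr :=
  .polarAngle (.cell 1 i (.const 0)) (.cell 1 i (.const 1))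

abbrev logExpr (i : IntExpr) : RealExpr :=
  .log (.sqrt (.add (.mul (.cell 1 i (.const 0)) (.cell 1 i (.const 0)))
    (.mul (.cell 1 i (.const 1)) (.cell 1 i (.const 1)))))

abbrev gapExpr : RealExpr := .cell 4 (.const 0) (.const 0)

abbrev angleExpr : RealExpr := .div (.add (argExpr (.const 0)) gapExpr) tanExpr

/-- The counterclockwise angle from terminal `0` to the current terminal. -/
def gapStep : Program :=
  .seq (.setReal 4 (.const 0) (.const 0) (.sub (argExpr (var 9)) (argExpr (.const 0))))
    (.cond (.ltReal gapExpr (.ofInt (.const 0)))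
      (.setReal 4 (.const 0) (.const 0) (.add gapExpr twoPiExpr)) .skip)

/-- The coordinates of the two lifts of the current terminal. -/
def coordStep : Program :=
  .seq (.setReal 7 (var 9) (.const 0) (.add angleExpr (logExpr (var 9))))
  (.seq (.setReal 8 (var 9) (.const 0) (.sub angleExpr (logExpr (var 9))))
  (.seq (.setReal 7 (.add (var 0) (var 9)) (.const 0)
      (.add (.cell 7 (var 9) (.const 0)) (.div twoPiExpr tanExpr)))
  (.seq (.setReal 8 (.add (var 0) (var 9)) (.const 0)
      (.add (.cell 8 (var 9) (.const 0)) (.div twoPiExpr tanExpr)))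
  (setVar 9 (.add (var 9) (.const 1))))))

def liftProgram : Program := .loop (.ltInt (var 9) (var 0)) (.seq gapStep coordStep)

end Program

open Program

variable {n : ℕ} [NeZero n] {α : ℝ} {t : Fin n → ℂ}

variable (α t) in
/-- The state holds the input. -/
structure HasInput (s : State) : Prop where
  size : s.int 0 0 0 = n
  alpha : s.real 0 0 0 = α
  re : ∀ i : Fin n, s.real 1 i 0 = (t i).re
  im : ∀ i : Fin n, s.real 1 i 1 = (t i).im

variable (α t) in
/-- The state holds the coordinates of the lifts `0, …, m - 1` and `n, …, n + m - 1`. -/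
structure HasLifts (m : ℕ) (s : State) : Prop where
  size : s.int 0 0 0 = n
  alpha : s.real 0 0 0 = α
  fst : ∀ a < m, s.real 7 a 0 = liftX α t a
  snd : ∀ a < m, s.real 8 a 0 = liftY α t a
  fst_add : ∀ a < m, s.real 7 (n + a) 0 = liftX α t (n + a : ℕ)
  snd_add : ∀ a < m, s.real 8 (n + a) 0 = liftY α t (n + a : ℕ)

theorem hasInput_inputState : HasInput α t (inputState α t) where
  size := by simp [inputState]
  alpha := by simp [inputState]
  re i := by simp [inputState]
  im i := by simp [inputState]

/-- Arguments lie in `(-π, π]`, so their difference lies in `(-2π, 2π)` and one conditional addition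
of `2π` normalises it. -/
theorem ccwAngle_eq_ite (x y : ℂ) : ccwAngle x y =
    if y.arg - x.arg < 0 then y.arg - x.arg + 2 * Real.pi else y.arg - x.arg := by
  have h1 := Complex.neg_pi_lt_arg x
  have h2 := Complex.arg_le_pi x
  have h3 := Complex.neg_pi_lt_arg y
  have h4 := Complex.arg_le_pi y
  unfold ccwAngle
  split_ifs with h
  · rw [← toIcoMod_add_right, toIcoMod_eq_self]
    constructor <;> linarith
  · rw [toIcoMod_eq_self]
    constructor <;> linarith

theorem liftHeight_natCast {a : ℕ} (ha : a < n) : liftHeight t a = -Real.log ‖t ⟨a, ha⟩‖ := by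
  rw [liftHeight, show red n a = ⟨a, ha⟩ from red_coe ⟨a, ha⟩]

theorem liftAngle_natCast {a : ℕ} (ha : a < n) :
    liftAngle α t a = ((t 0).arg + ccwAngle (t 0) (t ⟨a, ha⟩)) / Real.tan α := by
  rw [liftAngle, show red n a = ⟨a, ha⟩ from red_coe ⟨a, ha⟩,
    Int.ediv_eq_zero_of_lt (by omega) (by omega)]
  simp

attribute [local simp] Program.exec IntExpr.eval RealExpr.eval Test.holds State.int_setInt
  State.real_setInt State.int_setReal State.real_setReal

theorem arg_neg_one_zero : Complex.arg ⟨-1, 0⟩ = Real.pi := by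
  rw [show (⟨-1, 0⟩ : ℂ) = -1 by apply Complex.ext <;> simp, Complex.arg_neg_one]

theorem exec_gapStep {s : State} (H : HasInput α t s) (h9 : s.int 9 0 0 < n) :
    (gapStep.exec s).real 4 0 0 = ccwAngle (t 0) (t ⟨s.int 9 0 0, h9⟩) := by
  have e1 := H.re ⟨s.int 9 0 0, h9⟩
  have e2 := H.im ⟨s.int 9 0 0, h9⟩
  have e3 := H.re 0
  have e4 := H.im 0
  simp only [Fin.val_zero] at e1 e2 e3 e4
  rw [ccwAngle_eq_ite]
  by_cases hδ : (t ⟨s.int 9 0 0, h9⟩).arg - (t 0).arg < 0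
  · rw [if_pos hδ]
    rw [sub_neg] at hδ
    simp [gapStep, e1, e2, e3, e4, hδ, arg_neg_one_zero]
  · rw [if_neg hδ]
    rw [sub_neg] at hδ
    simp [gapStep, e1, e2, e3, e4, hδ]

theorem norm_eq_sqrt_mul (z : ℂ) : ‖z‖ = Real.sqrt (z.re * z.re + z.im * z.im) := by
  rw [Complex.norm_def, Complex.normSq_apply]

/-- The height is `-log |t i|`, so `X` is the angle plus the logarithm and `Y` the angle minus it.
Row `n + i` adds one period; since `i < n`, rows of the two blocks never overwrite each other. -/
theorem coordStep_spec {s : State} (H : HasInput α t s) (h9 : s.int 9 0 0 < n)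
    (h4 : s.real 4 0 0 = ccwAngle (t 0) (t ⟨s.int 9 0 0, h9⟩)) (hl : HasLifts α t (s.int 9 0 0) s) :
    (coordStep.exec s).int 9 0 0 = s.int 9 0 0 + 1 ∧
      HasLifts α t (s.int 9 0 0 + 1) (coordStep.exec s) := by
  have e1 := H.re ⟨s.int 9 0 0, h9⟩
  have e2 := H.im ⟨s.int 9 0 0, h9⟩
  have e3 := H.re 0
  have e4 := H.im 0
  simp only [Fin.val_zero] at e1 e2 e3 e4
  generalize hi : s.int 9 0 0 = i at *
  have eX : liftX α t i = ((t 0).arg + ccwAngle (t 0) (t ⟨i, h9⟩)) / Real.tan α +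
      Real.log ‖t ⟨i, h9⟩‖ := by
    rw [liftX, liftAngle_natCast h9, liftHeight_natCast h9, sub_neg_eq_add]
  have eY : liftY α t i = ((t 0).arg + ccwAngle (t 0) (t ⟨i, h9⟩)) / Real.tan α -
      Real.log ‖t ⟨i, h9⟩‖ := by
    rw [liftY, liftAngle_natCast h9, liftHeight_natCast h9, sub_eq_add_neg]
  have eX' : liftX α t (n + i : ℕ) = liftX α t i + period α := by
    have := liftX_add (α := α) (t := t) i 1
    rw [show ((n + i : ℕ) : ℤ) = i + n * 1 by push_cast; ring, this, Int.cast_one, one_mul]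
  have eY' : liftY α t (n + i : ℕ) = liftY α t i + period α := by
    have := liftY_add (α := α) (t := t) i 1
    rw [show ((n + i : ℕ) : ℤ) = i + n * 1 by push_cast; ring, this, Int.cast_one, one_mul]
  have hne : n ≠ 0 := NeZero.ne n
  rw [period, Real.tan_eq_sin_div_cos] at eX' eY'
  rw [Real.tan_eq_sin_div_cos, norm_eq_sqrt_mul] at eX eY
  refine ⟨by simp [coordStep, hi], ⟨?_, ?_, ?_, ?_, ?_, ?_⟩⟩
  · simp [coordStep, H.size]
  · simp [coordStep, H.alpha]
  · intro a ha
    by_cases hai : a = i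
    · subst hai
      simp [coordStep, H.size, H.alpha, hi, e1, e2, e3, e4, h4, eX, hne]
    · have hn : a ≠ n + i := by omega
      simp [coordStep, H.size, H.alpha, hi, hn, hai]
      exact hl.fst a (by omega)
  · intro a ha
    by_cases hai : a = i
    · subst hai
      simp [coordStep, H.size, H.alpha, hi, e1, e2, e3, e4, h4, eY, hne]
    · have hn : a ≠ n + i := by omega
      simp [coordStep, H.size, H.alpha, hi, hn, hai]
      exact hl.snd a (by omega)
  · intro a ha
    by_cases hai : a = i
    · subst hai
      rw [eX', eX]
      simp [coordStep, H.size, H.alpha, hi, e1, e2, e3, e4, h4, arg_neg_one_zero]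
    · have hn : n + a ≠ i := by omega
      simp [coordStep, H.size, H.alpha, hi, hn, hai]
      simpa using hl.fst_add a (by omega)
  · intro a ha
    by_cases hai : a = i
    · subst hai
      rw [eY', eY]
      simp [coordStep, H.size, H.alpha, hi, e1, e2, e3, e4, h4, arg_neg_one_zero]
    · have hn : n + a ≠ i := by omega
      simp [coordStep, H.size, H.alpha, hi, hn, hai]
      simpa using hl.snd_add a (by omega)

omit [NeZero n] in
theorem HasInput.of_frame {P : Program} {s s' : State} (H : HasInput α t s) (h : P.Frame s s')
    (h0 : 0 ∉ P.intWrites) (h1 : 0 ∉ P.realWrites) (h2 : 1 ∉ P.realWrites) : HasInput α t s' where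
  size := by rw [h.1 0 h0, H.size]
  alpha := by rw [h.2 0 h1, H.alpha]
  re i := by rw [h.2 1 h2, H.re]
  im i := by rw [h.2 1 h2, H.im]

theorem HasLifts.of_frame {P : Program} {s s' : State} {m : ℕ} (H : HasLifts α t m s)
    (h : P.Frame s s') (h0 : 0 ∉ P.intWrites) (h1 : 0 ∉ P.realWrites) (h2 : 7 ∉ P.realWrites)
    (h3 : 8 ∉ P.realWrites) : HasLifts α t m s' where
  size := by rw [h.1 0 h0, H.size]
  alpha := by rw [h.2 0 h1, H.alpha]
  fst := by rw [h.2 7 h2]; exact H.fst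
  snd := by rw [h.2 8 h3]; exact H.snd
  fst_add := by rw [h.2 7 h2]; exact H.fst_add
  snd_add := by rw [h.2 8 h3]; exact H.snd_add

def liftCost : ℕ := gapStep.bound + coordStep.bound + 10

theorem halts_liftProgram {s : State} (H : HasInput α t s) (h9 : s.int 9 0 0 = 0) :
    Halts liftProgram s (n * liftCost + liftCost) (HasLifts α t n) := by
  have h0 : HasLifts α t 0 s := by constructor <;> simp [H.size, H.alpha]
  refine (Halts.loop (N := n) (M := gapStep.bound + coordStep.bound + 1)
    (Inv := fun k s => s.int 9 0 0 = k ∧ k ≤ n ∧ HasLifts α t k s) ⟨h9, Nat.zero_le n, h0⟩ ?_).mono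
    ?_ ?_
  · rintro k s' hf ⟨h1, h2, h3⟩ hb
    have H' := H.of_frame hf (by decide) (by decide) (by decide)
    replace hb : s'.int 9 0 0 < s'.int 0 0 0 := hb
    rw [H'.size] at hb
    refine ⟨h1 ▸ hb, (Halts.exec (by decide)
      (Q := fun s'' => s''.real 4 0 0 = ccwAngle (t 0) (t ⟨s'.int 9 0 0, hb⟩))
      (exec_gapStep H' hb)).seq fun s'' hf' h4 =>
      Halts.exec (by decide) ?_⟩
    have h9' : s''.int 9 0 0 = s'.int 9 0 0 := by rw [hf'.1 9 (by decide)]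
    have := coordStep_spec (H'.of_frame hf' (by decide) (by decide) (by decide)) (h9' ▸ hb)
      (by simpa only [h9'] using h4)
      (by rw [h9', h1]; exact h3.of_frame hf' (by decide) (by decide) (by decide) (by decide))
    rw [h9', h1] at this
    exact ⟨this.1, h1 ▸ hb, this.2⟩
  · have : (Test.ltInt (var 9) (var 0)).cost = 7 := rfl
    rw [this, liftCost]
    ring_nf
    omega
  · rintro s' hf ⟨k, ⟨h1, h2, h3⟩, hb⟩
    replace hb : ¬ s'.int 9 0 0 < s'.int 0 0 0 := hb
    rw [h3.size] at hb
    obtain rfl : k = n := by omega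
    exact h3

theorem HasLifts.fst_of_lt {s : State} (H : HasLifts α t n s) {a : ℕ} (ha : a < 2 * n) :
    s.real 7 a 0 = liftX α t a := by
  rcases lt_or_ge a n with h | h
  · exact H.fst a h
  · obtain ⟨b, rfl⟩ := Nat.exists_eq_add_of_le h
    exact H.fst_add b (by omega)

theorem HasLifts.snd_of_lt {s : State} (H : HasLifts α t n s) {a : ℕ} (ha : a < 2 * n) :
    s.real 8 a 0 = liftY α t a := by
  rcases lt_or_ge a n with h | h
  · exact H.snd a h
  · obtain ⟨b, rfl⟩ := Nat.exists_eq_add_of_le h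
    exact H.snd_add b (by omega)

end SpiralTrees
namespace SpiralTrees

/-! ### The program: the table of the recurrence -/

namespace Program

/-- The distance from the root of the join point of two lifts. -/
abbrev radiusExpr (i j : IntExpr) : RealExpr :=
  .exp (.div (.sub (.cell 7 i (.const 0)) (.cell 8 j (.const 0))) (.ofInt (.const 2)))

abbrev secExpr : RealExpr := .div (.ofInt (.const 1)) (.cos alphaExpr)

/-- The cost of splitting the interval from `i` to `j` after `k`. -/
abbrev splitExpr (i j k : IntExpr) : RealExpr :=
  .add (.add (.add (.cell 9 i k) (.cell 9 (.add k (.const 1)) j))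
    (.mul secExpr (.sub (radiusExpr i k) (radiusExpr i j))))
    (.mul secExpr (.sub (radiusExpr (.add k (.const 1)) j) (radiusExpr i j)))

/-- Cell `10` holds the length `d` of the interval, cell `11` its first lift, and cell `12` the
offset of the split. -/
abbrev endExpr : IntExpr := .add (var 11) (var 10)

abbrev cutExpr : IntExpr := .add (var 11) (var 12)

def minStep : Program :=
  .seq (.cond (.ltReal (splitExpr (var 11) endExpr cutExpr) (.cell 9 (var 11) endExpr))
      (.seq (.setReal 9 (var 11) endExpr (splitExpr (var 11) endExpr cutExpr))
        (.setInt 5 (var 11) endExpr cutExpr))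
      .skip)
    (setVar 12 (.add (var 12) (.const 1)))

/-- The split after the first lift supplies an initial value for the comparison. The loop tests
offset `0` again, which changes nothing as the comparison is strict. -/
def minInit : Program :=
  .seq (.setReal 9 (var 11) endExpr (splitExpr (var 11) endExpr (var 11)))
    (.seq (.setInt 5 (var 11) endExpr (var 11)) (setVar 12 (.const 0)))

def entryProgram : Program :=
  .seq minInit (.seq (.loop (.ltInt (var 12) (var 10)) minStep)
    (setVar 11 (.add (var 11) (.const 1))))

/-- Among the lifts `0, …, 2n - 1` every cyclic interval has a representative starting below `n`;
the others serve as the right parts of splits. -/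
def diagonalProgram : Program :=
  .seq (setVar 11 (.const 0)) (.seq (.loop (.ltInt endExpr (.add (var 0) (var 0))) entryProgram)
    (setVar 10 (.add (var 10) (.const 1))))

def tableProgram : Program :=
  .seq (setVar 10 (.const 1)) (.loop (.ltInt (var 10) (var 0)) diagonalProgram)

end Program

open Program

variable {n : ℕ} [NeZero n] {α : ℝ} {t : Fin n → ℂ} {F : Fin n → Fin n → ℝ}

variable (α t F) in
/-- The state holds a solution of the recurrence for the interval from `a` to `b`, together with
a position at which to split the interval. -/
def IsEntry (s : State) (a b : ℕ) : Prop :=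
  s.real 9 a b = F (red n a) (red n b) ∧ (a < b → a ≤ s.int 5 a b ∧ s.int 5 a b < b ∧
    F (red n a) (red n b) = splitCost α t F a b (s.int 5 a b))

variable (α t F) in
/-- All entries for intervals of length less than `d` are there, and those of length `d` that
start before `m`. -/
def HasTable (d m : ℕ) (s : State) : Prop :=
  ∀ a b : ℕ, a ≤ b → b < 2 * n → b < a + n → (b < a + d ∨ b = a + d ∧ a < m) → IsEntry α t F s a b

variable (α t F) in
/-- The entry for the interval from `a` to `b` is the best one among the first `e` positions. -/
def IsCandidate (s : State) (a b e : ℕ) : Prop :=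
  (a ≤ s.int 5 a b ∧ s.int 5 a b < b ∧ s.real 9 a b = splitCost α t F a b (s.int 5 a b)) ∧
    ∀ k : ℕ, a ≤ k → k < a + e → s.real 9 a b ≤ splitCost α t F a b k

theorem HasTable.of_eq {d m : ℕ} {s s' : State} (H : HasTable α t F d m s)
    (h : s'.real 9 = s.real 9) (h' : s'.int 5 = s.int 5) : HasTable α t F d m s' := by
  intro a b h1 h2 h3 h4
  have := H a b h1 h2 h3 h4
  rwa [IsEntry, ← h, ← h'] at this

attribute [local simp] Program.exec IntExpr.eval RealExpr.eval Test.holds State.int_setInt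
  State.real_setInt State.int_setReal State.real_setReal

theorem eval_radiusExpr {s : State} (H : HasLifts α t n s) {i j : IntExpr}
    (hi : i.eval s < 2 * n) (hj : j.eval s < 2 * n) :
    (radiusExpr i j).eval s = Real.exp (-joinHeight α t (i.eval s : ℕ) (j.eval s : ℕ)) := by
  simp only [RealExpr.eval, IntExpr.eval, H.fst_of_lt hi, H.snd_of_lt hj, joinHeight]
  congr 1
  push_cast
  ring

theorem eval_secExpr {m : ℕ} {s : State} (H : HasLifts α t m s) :
    secExpr.eval s = (Real.cos α)⁻¹ := by
  simp [H.alpha]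

theorem eval_splitExpr {s : State} (H : HasLifts α t n s) {i j k : IntExpr} {a b c : ℕ}
    (hi : i.eval s = a) (hj : j.eval s = b) (hk : k.eval s = c) (h1 : a ≤ c) (h2 : c < b)
    (h3 : b < 2 * n) (h4 : s.real 9 a c = F (red n a) (red n c))
    (h5 : s.real 9 (c + 1) b = F (red n (c + 1 : ℕ)) (red n b)) :
    (splitExpr i j k).eval s = splitCost α t F a b c := by
  have e : (IntExpr.add k (.const 1)).eval s = c + 1 := by simp [hk]
  rw [splitExpr, RealExpr.eval, RealExpr.eval, RealExpr.eval, RealExpr.eval, RealExpr.eval,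
    RealExpr.eval, RealExpr.eval, RealExpr.eval, RealExpr.eval, eval_secExpr H,
    eval_radiusExpr H (by omega) (by omega), eval_radiusExpr H (by omega) (by omega),
    eval_radiusExpr H (by omega) (by omega), e, hi, hj, hk, h4, h5, splitCost, segCost, segCost]
  push_cast
  ring

section Entry

variable {s : State} {a d e : ℕ}

theorem splitExpr_of_hasTable (H : HasLifts α t n s) (hT : HasTable α t F d a s) (hd : d < n)
    (had : a + d < 2 * n) (ha : s.int 11 0 0 = a) (hs : s.int 10 0 0 = d) {k : IntExpr} {c : ℕ}
    (hk : k.eval s = c) (h1 : a ≤ c) (h2 : c < a + d) :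
    (splitExpr (var 11) endExpr k).eval s = splitCost α t F a (a + d : ℕ) c :=
  eval_splitExpr H (by simp [ha]) (by simp [ha, hs]) hk h1 h2 had
    (hT a c h1 (by omega) (by omega) (Or.inl h2)).1
    (hT (c + 1) (a + d) (by omega) had (by omega) (Or.inl (by omega))).1

theorem minInit_spec (H : HasLifts α t n s) (hT : HasTable α t F d a s) (hd : d < n)
    (hd0 : 0 < d) (had : a + d < 2 * n) (ha : s.int 11 0 0 = a) (hs : s.int 10 0 0 = d) :
    (minInit.exec s).int 12 0 0 = 0 ∧ HasTable α t F d a (minInit.exec s) ∧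
      IsCandidate α t F (minInit.exec s) a (a + d) 0 := by
  have hv := splitExpr_of_hasTable H hT hd had ha hs (k := var 11) (c := a) (by simp [ha]) le_rfl
    (by omega)
  generalize hE : splitExpr (var 11) endExpr (var 11) = E at hv
  refine ⟨by simp [minInit], fun a' b' h1 h2 h3 h4 => ?_, ⟨?_, ?_, ?_⟩, fun k hk hk' => by omega⟩
  · have hne : ¬ (a' = a ∧ b' = a + d) := by omega
    have := hT a' b' h1 h2 h3 h4
    simpa [IsEntry, minInit, hE, ha, hs, hne] using this
  · simp [minInit, ha, hs]
  · simp [minInit, ha, hs, hd0]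
  · simp [minInit, ha, hs, hE, hv]

theorem minStep_spec (H : HasLifts α t n s) (hT : HasTable α t F d a s) (hd : d < n)
    (had : a + d < 2 * n) (ha : s.int 11 0 0 = a) (hs : s.int 10 0 0 = d) (he : s.int 12 0 0 = e)
    (hed : e < d) (hc : IsCandidate α t F s a (a + d) e) :
    (minStep.exec s).int 12 0 0 = e + 1 ∧ HasTable α t F d a (minStep.exec s) ∧
      IsCandidate α t F (minStep.exec s) a (a + d) (e + 1) := by
  have hv := splitExpr_of_hasTable H hT hd had ha hs (k := cutExpr) (c := a + e)
    (by simp [ha, he]) (by omega) (by omega)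
  obtain ⟨⟨c1, c2, c3⟩, c4⟩ := hc
  unfold minStep
  generalize hE : splitExpr (var 11) endExpr cutExpr = E at hv
  by_cases hlt : splitCost α t F a (a + d : ℕ) (a + e : ℕ) < s.real 9 a (a + d)
  · have hb : Test.holds s (.ltReal E (.cell 9 (var 11) endExpr)) := by
      simpa [ha, hs, hv] using hlt
    rw [exec_seq, exec_cond_of_holds hb]
    refine ⟨by simp [he], fun a' b' h1 h2 h3 h4 => ?_, ⟨?_, ?_, ?_⟩, fun k hk hk' => ?_⟩
    · have hne : ¬ (a' = a ∧ b' = a + d) := by omega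
      have := hT a' b' h1 h2 h3 h4
      simpa [IsEntry, ha, hs, hne] using this
    · simp [ha, hs, he]
    · simp [ha, hs, he, hed]
    · simp only [Program.exec, IntExpr.eval, State.int_setInt, State.int_setReal, State.real_setInt,
        State.real_setReal, ha, hs, he, hv]
      simp
    · have : splitCost α t F a (a + d : ℕ) (a + e : ℕ) ≤ splitCost α t F a (a + d : ℕ) k := by
        rcases (show k < a + e ∨ k = a + e by omega) with h | rfl
        · exact hlt.le.trans (c4 k hk h)
        · exact le_rfl
      simpa [ha, hs, he, hv] using this
  · have hb : ¬ Test.holds s (.ltReal E (.cell 9 (var 11) endExpr)) := by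
      simpa [ha, hs, hv] using hlt
    rw [exec_seq, exec_cond_of_not_holds hb]
    refine ⟨by simp [he], fun a' b' h1 h2 h3 h4 => ?_, ⟨?_, ?_, ?_⟩, fun k hk hk' => ?_⟩
    · have := hT a' b' h1 h2 h3 h4
      simpa [IsEntry] using this
    · simpa using c1
    · simpa using c2
    · simpa using c3
    · have : s.real 9 a (a + d) ≤ splitCost α t F a (a + d : ℕ) k := by
        rcases (show k < a + e ∨ k = a + e by omega) with h | rfl
        · exact c4 k hk h
        · exact not_lt.1 hlt
      simpa using this

/-- After all `d` offsets the stored value is the cost of an admissible split and at most the cost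
of every other one, which characterises `F`. -/
theorem IsCandidate.isEntry (H : IsInstance α t) (hF : IsRecurrence α t F) (hd0 : 0 < d)
    (hd : d < n) (hc : IsCandidate α t F s a (a + d) d) : IsEntry α t F s a (a + d) := by
  obtain ⟨⟨c1, c2, c3⟩, c4⟩ := hc
  have hl := hF.isLeast H (a := a) (b := (a + d : ℕ)) (by push_cast; omega) (by push_cast; omega)
  have : s.real 9 a (a + d) = F (red n a) (red n (a + d : ℕ)) := by
    refine le_antisymm ?_ (hl.2 ⟨s.int 5 a (a + d), by omega, by omega, c3⟩)
    obtain ⟨k, h1, h2, h3⟩ := hl.1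
    rw [h3]
    lift k to ℕ using by omega
    exact c4 k (by omega) (by omega)
  exact ⟨this, fun _ => ⟨c1, c2, this ▸ c3⟩⟩

def stepCost : ℕ := minInit.bound + minStep.bound + 40

theorem halts_entryProgram (HI : IsInstance α t) (hF : IsRecurrence α t F) (H : HasLifts α t n s)
    (hT : HasTable α t F d a s) (hd : d < n) (hd0 : 0 < d) (had : a + d < 2 * n)
    (ha : s.int 11 0 0 = a) (hs : s.int 10 0 0 = d) :
    Halts entryProgram s (n * stepCost + stepCost) fun s' =>
      s'.int 11 0 0 = a + 1 ∧ HasTable α t F d (a + 1) s' := by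
  refine Halts.mono (Halts.seq (Halts.exec (by decide)
    (Q := fun s => s.int 12 0 0 = 0 ∧ HasTable α t F d a s ∧ IsCandidate α t F s a (a + d) 0)
    (minInit_spec H hT hd hd0 had ha hs))
    fun s₁ f₁ ⟨h1, h2, h3⟩ => Halts.seq (Halts.loop (N := n) (M := minStep.bound)
      (Inv := fun e s => s.int 12 0 0 = e ∧ e ≤ d ∧ HasTable α t F d a s ∧
        IsCandidate α t F s a (a + d) e) ⟨h1, Nat.zero_le d, h2, h3⟩ ?_)
      fun s₂ f₂ hi => Halts.exec (by decide)
        (Q := fun s' => s'.int 11 0 0 = a + 1 ∧ HasTable α t F d (a + 1) s') ?_) ?_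
    fun s' _ h => h
  · rintro e s' f ⟨e1, e2, e3, e4⟩ hb
    replace hb : s'.int 12 0 0 < s'.int 10 0 0 := hb
    have H' := (H.of_frame f₁ (by decide) (by decide) (by decide) (by decide)).of_frame f
      (by decide) (by decide) (by decide) (by decide)
    have ha' : s'.int 11 0 0 = a := by rw [f.1 11 (by decide), f₁.1 11 (by decide), ha]
    have hs' : s'.int 10 0 0 = d := by rw [f.1 10 (by decide), f₁.1 10 (by decide), hs]
    rw [e1, hs'] at hb
    refine ⟨by omega, Halts.exec (by decide) ?_⟩
    have := minStep_spec H' e3 hd had ha' hs' e1 hb e4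
    exact ⟨this.1, hb, this.2⟩
  · obtain ⟨e, ⟨e1, e2, e3, e4⟩, hb⟩ := hi
    replace hb : ¬ s₂.int 12 0 0 < s₂.int 10 0 0 := hb
    have ha' : s₂.int 11 0 0 = a := by rw [f₂.1 11 (by decide), f₁.1 11 (by decide), ha]
    have hs' : s₂.int 10 0 0 = d := by rw [f₂.1 10 (by decide), f₁.1 10 (by decide), hs]
    rw [e1, hs'] at hb
    obtain rfl : e = d := by omega
    have hE := e4.isEntry HI hF hd0 hd
    have hT' : HasTable α t F e (a + 1) s₂ := fun a' b' h1 h2 h3 h4 => by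
      by_cases h : a' = a ∧ b' = a + e
      · rw [h.1, h.2]; exact hE
      · exact e3 a' b' h1 h2 h3 (by omega)
    refine ⟨by simp [ha'], hT'.of_eq rfl ?_⟩
    funext x y
    simp
  · have h1 : (Test.ltInt (var 12) (var 10)).cost = 7 := rfl
    have h2 : (setVar 11 ((var 11).add (IntExpr.const 1))).bound = 8 := rfl
    rw [h1, h2, stepCost]
    have : n * (7 + minStep.bound + 1) ≤ n * (minInit.bound + minStep.bound + 40) :=
      Nat.mul_le_mul_left n (by omega)
    omega

theorem halts_diagonalProgram (HI : IsInstance α t) (hF : IsRecurrence α t F)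
    (H : HasLifts α t n s) (hT : HasTable α t F d 0 s) (hd : d < n) (hd0 : 0 < d)
    (hs : s.int 10 0 0 = d) :
    Halts diagonalProgram s (2 * n * (n * stepCost + stepCost + 40) + 40) fun s' =>
      s'.int 10 0 0 = d + 1 ∧ HasTable α t F (d + 1) 0 s' := by
  refine Halts.mono (Halts.seq (Halts.exec (Q := fun s' => s'.int 11 0 0 = 0) (by decide) (by simp))
    fun s₁ f₁ h1 => Halts.seq (Halts.loop (N := 2 * n) (M := n * stepCost + stepCost)
      (Inv := fun a s => s.int 11 0 0 = a ∧ a + d ≤ 2 * n ∧ HasTable α t F d a s)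
        ⟨h1, by omega, hT.of_eq (f₁.2 9 (by decide)) (f₁.1 5 (by decide))⟩ ?_)
      fun s₂ f₂ hi => Halts.exec (by decide)
        (Q := fun s' => s'.int 10 0 0 = d + 1 ∧ HasTable α t F (d + 1) 0 s') ?_) ?_
    fun s' _ h => h
  · rintro a s' f ⟨e1, e2, e3⟩ hb
    replace hb : s'.int 11 0 0 + s'.int 10 0 0 < s'.int 0 0 0 + s'.int 0 0 0 := hb
    have H' := (H.of_frame f₁ (by decide) (by decide) (by decide) (by decide)).of_frame f
      (by decide) (by decide) (by decide) (by decide)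
    have hs' : s'.int 10 0 0 = d := by rw [f.1 10 (by decide), f₁.1 10 (by decide), hs]
    rw [e1, hs', H'.size] at hb
    refine ⟨by omega, (halts_entryProgram HI hF H' e3 hd hd0 (by omega) e1 hs').mono le_rfl ?_⟩
    rintro s'' - ⟨g1, g2⟩
    exact ⟨g1, by omega, g2⟩
  · obtain ⟨a, ⟨e1, e2, e3⟩, hb⟩ := hi
    replace hb : ¬ s₂.int 11 0 0 + s₂.int 10 0 0 < s₂.int 0 0 0 + s₂.int 0 0 0 := hb
    have hs' : s₂.int 10 0 0 = d := by rw [f₂.1 10 (by decide), f₁.1 10 (by decide), hs]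
    have h0 : s₂.int 0 0 0 = n := by rw [f₂.1 0 (by decide), f₁.1 0 (by decide), H.size]
    rw [e1, hs', h0] at hb
    have hT' : HasTable α t F (d + 1) 0 s₂ := fun a' b' h1 h2 h3 h4 =>
      e3 a' b' h1 h2 h3 (by omega)
    refine ⟨by simp [hs'], hT'.of_eq rfl ?_⟩
    funext x y
    simp
  · have h1 : (Test.ltInt endExpr ((var 0).add (var 0))).cost = 15 := rfl
    have h2 : (setVar 10 ((var 10).add (IntExpr.const 1))).bound = 8 := rfl
    have h3 : (setVar 11 (IntExpr.const 0)).bound = 4 := rfl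
    rw [h1, h2, h3]
    have : 2 * n * (15 + (n * stepCost + stepCost) + 1) ≤
        2 * n * (n * stepCost + stepCost + 40) := Nat.mul_le_mul_left _ (by omega)
    omega

theorem halts_tableProgram (HI : IsInstance α t) (hF : IsRecurrence α t F)
    (H : HasLifts α t n s) (h9 : ∀ a, s.real 9 a a = 0) :
    Halts tableProgram s (n * (2 * n * (n * stepCost + stepCost + 40) + 60) + 60)
      (HasTable α t F n 0) := by
  have hn := NeZero.pos n
  refine Halts.mono (Halts.seq (Halts.exec (Q := fun s' => s'.int 10 0 0 = 1) (by decide) (by simp))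
    fun s₁ f₁ h1 => (Halts.loop (N := n) (M := 2 * n * (n * stepCost + stepCost + 40) + 40)
      (Inv := fun k s => s.int 10 0 0 = k + 1 ∧ k + 1 ≤ n ∧ HasTable α t F (k + 1) 0 s)
        ⟨h1, by omega, ?_⟩ ?_)) ?_ ?_
  -- Before the first diagonal only the singletons are needed, and their entries are the initial
  -- zeros of the array.
  · intro a b e1 e2 e3 e4
    obtain rfl : a = b := by omega
    exact ⟨by rw [f₁.2 9 (by decide), h9, hF.1], fun h => absurd h (lt_irrefl _)⟩
  · rintro k s' f ⟨e1, e2, e3⟩ hb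
    replace hb : s'.int 10 0 0 < s'.int 0 0 0 := hb
    have H' := (H.of_frame f₁ (by decide) (by decide) (by decide) (by decide)).of_frame f
      (by decide) (by decide) (by decide) (by decide)
    rw [e1, H'.size] at hb
    refine ⟨by omega, (halts_diagonalProgram HI hF H' e3 hb (by omega) e1).mono le_rfl ?_⟩
    rintro s'' - ⟨g1, g2⟩
    exact ⟨g1, hb, g2⟩
  · have h1 : (Test.ltInt (var 10) (var 0)).cost = 7 := rfl
    have h3 : (setVar 10 (IntExpr.const 1)).bound = 4 := rfl
    rw [h1, h3]
    have : n * (7 + (2 * n * (n * stepCost + stepCost + 40) + 40) + 1) ≤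
        n * (2 * n * (n * stepCost + stepCost + 40) + 60) := Nat.mul_le_mul_left _ (by omega)
    omega
  · rintro s' f ⟨k, ⟨e1, e2, e3⟩, hb⟩
    replace hb : ¬ s'.int 10 0 0 < s'.int 0 0 0 := hb
    have h0 : s'.int 0 0 0 = n := by rw [f.1 0 (by decide), H.size]
    rw [e1, h0] at hb
    obtain rfl : n = k + 1 := by omega
    exact e3

end Entry

end SpiralTrees
namespace SpiralTrees

/-! ### Tables that describe a tree of joins

Node `0` is the root; a node `u ≥ 1` stands for the interval from `fst u` to `lst u` of lifts and
lies at their join point. -/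

structure Layout where
  fst : ℕ → ℕ
  lst : ℕ → ℕ
  parent : ℕ → ℕ
  kind : ℕ → ℕ
  term : ℕ → ℕ

namespace Layout

variable {n : ℕ} [NeZero n] (α : ℝ) (t : Fin n → ℂ) (F : Fin n → Fin n → ℝ)

/-- The height of a node other than the root. -/
def height (L : Layout) (u : ℕ) : ℝ := joinHeight α t (L.fst u) (L.lst u)

/-- The position of a node. -/
def pos (L : Layout) (u : ℕ) : ℂ := if u = 0 then 0 else liftJoin α t (L.fst u) (L.lst u)

/-- The length of the arc from a node to its parent. -/
def arcCost (L : Layout) (u : ℕ) : ℝ :=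
  (Real.cos α)⁻¹ * (‖L.pos α t u‖ - ‖L.pos α t (L.parent u)‖)

/-- The length of an optimal subtree for the interval of a node. -/
def subtreeCost (L : Layout) (u : ℕ) : ℝ := F (red n (L.fst u)) (red n (L.lst u))

/-- The node `u` has no children so far, where the nodes below `v` have been processed. -/
def Active (L : Layout) (v u : ℕ) : Prop := v ≤ u ∧ 1 ≤ u ∨ 1 ≤ u ∧ L.fst u = L.lst u

/-- The cost of a tree for the terminals that starts at the lift `a`. -/
def _root_.SpiralTrees.rootCost (a : ℕ) : ℝ :=
  F (red n a) (red n (a + n - 1 : ℕ)) +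
    (Real.cos α)⁻¹ * Real.exp (-joinHeight α t a (a + n - 1 : ℕ))

/-- Nodes `0, …, c - 1` have been created, and nodes `0, …, v - 1` have been processed. -/
structure IsPartial (L : Layout) (a v c : ℕ) : Prop where
  one_le : 1 ≤ v
  le : v ≤ c
  range : ∀ u, 1 ≤ u → u < c → a ≤ L.fst u ∧ L.fst u ≤ L.lst u ∧ L.lst u < a + n
  parent_zero : L.parent 0 = 0
  one_lt : 1 < c
  parent_one : L.parent 1 = 0
  kind_one : L.kind 1 = 0
  child : ∀ u, 2 ≤ u → u < c → 1 ≤ L.parent u ∧ L.parent u < u ∧ L.parent u < v ∧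
    (L.kind u = 0 ∧ L.fst u = L.fst (L.parent u) ∧ L.lst u < L.lst (L.parent u) ∨
      L.kind u = 1 ∧ L.lst u = L.lst (L.parent u) ∧ L.fst (L.parent u) < L.fst u)
  -- A split creates two nodes and lowers the total weight `2 (lst - fst)` of the unprocessed
  -- intervals by two. Thus never more than `2n` nodes exist, which bounds the number of iterations.
  size : c + ∑ u ∈ Finset.Ico v c, 2 * (L.lst u - L.fst u) = 2 * n
  -- Arcs already drawn plus optimal costs of the intervals still to be unfolded: a split along a
  -- minimiser of the recurrence leaves the sum unchanged.
  cost : ∑ u ∈ Finset.Ico 1 c, L.arcCost α t u + ∑ u ∈ Finset.Ico v c, L.subtreeCost F u =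
    rootCost α t F a
  disjoint : ∀ u w, u < w → w < c → L.Active v u → L.Active v w →
    L.lst u < L.fst w ∨ L.lst w < L.fst u
  cover : ∀ k, a ≤ k → k < a + n → ∃ u, u < c ∧ L.Active v u ∧ L.fst u ≤ k ∧ k ≤ L.lst u
  term : ∀ u, 1 ≤ u → u < v → L.fst u = L.lst u → L.term (L.fst u % n) = u
  inner : ∀ u, 1 ≤ u → u < v → L.fst u < L.lst u → ∃ w, 2 ≤ w ∧ w < c ∧ L.parent w = u

/-- The layouts agree on the nodes below `c`. -/
structure Agree (L L' : Layout) (c : ℕ) : Prop where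
  fst : ∀ u < c, L'.fst u = L.fst u
  lst : ∀ u < c, L'.lst u = L.lst u
  parent : ∀ u < c, L'.parent u = L.parent u
  kind : ∀ u < c, L'.kind u = L.kind u

variable {α t F} {L L' : Layout} {a v c k : ℕ}

theorem IsPartial.parent_lt (h : L.IsPartial α t F a v c) {u : ℕ} (h1 : 1 ≤ u) (hu : u < c) :
    L.parent u < u := by
  rcases h1.eq_or_lt with rfl | h1
  · rw [h.parent_one]; exact one_pos
  · exact (h.child u h1 hu).2.1

theorem Agree.pos (hA : Agree L L' c) {u : ℕ} (hu : u < c) : L'.pos α t u = L.pos α t u := by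
  rw [Layout.pos, Layout.pos, hA.fst u hu, hA.lst u hu]

theorem Agree.arcCost (hA : Agree L L' c) (h : L.IsPartial α t F a v c) {u : ℕ} (h1 : 1 ≤ u)
    (hu : u < c) : L'.arcCost α t u = L.arcCost α t u := by
  rw [Layout.arcCost, Layout.arcCost, hA.parent u hu, hA.pos hu,
    hA.pos ((h.parent_lt h1 hu).trans hu)]

theorem Agree.subtreeCost (hA : Agree L L' c) {u : ℕ} (hu : u < c) :
    L'.subtreeCost F u = L.subtreeCost F u := by
  rw [Layout.subtreeCost, Layout.subtreeCost, hA.fst u hu, hA.lst u hu]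

theorem IsPartial.init (ha : L.fst 1 = a) (hb : L.lst 1 = a + n - 1) (h0 : L.parent 0 = 0)
    (h1 : L.parent 1 = 0) (hk : L.kind 1 = 0) : L.IsPartial α t F a 1 2 := by
  have hn := NeZero.pos n
  refine ⟨le_rfl, by omega, ?_, h0, by omega, h1, hk, ?_, ?_, ?_, ?_, ?_, ?_, ?_⟩
  · intro u hu hu'
    obtain rfl : u = 1 := by omega
    omega
  · intro u hu hu'; omega
  · rw [Finset.sum_Ico_succ_top le_rfl, Finset.Ico_self, Finset.sum_empty]; omega
  · rw [Finset.sum_Ico_succ_top le_rfl, Finset.Ico_self, Finset.sum_empty,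
      Finset.sum_Ico_succ_top le_rfl, Finset.Ico_self, Finset.sum_empty, arcCost, h1, pos,
      if_neg one_ne_zero, pos, if_pos rfl, IsInstance.norm_liftJoin, norm_zero, subtreeCost, ha, hb,
      rootCost]
    ring
  · intro u w h2 h3 h4 h5
    obtain ⟨-, h⟩ | ⟨h, -⟩ := h4 <;> omega
  · intro k h2 h3
    exact ⟨1, by omega, Or.inl ⟨le_rfl, le_rfl⟩, by omega, by omega⟩
  · intro u h2 h3; omega
  · intro u h2 h3; omega

/-- Processing a leaf. -/
theorem IsPartial.leaf (h : L.IsPartial α t F a v c) (hF : ∀ i, F i i = 0) (hv : v < c)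
    (hA : Agree L L' c) (hl : L.fst v = L.lst v) (ht : L'.term (L.fst v % n) = v)
    (ht' : ∀ i, i ≠ L.fst v % n → L'.term i = L.term i) : L'.IsPartial α t F a (v + 1) c := by
  have hact : ∀ u < c, L'.Active (v + 1) u ↔ L.Active v u := fun u hu => by
    unfold Active
    rw [hA.fst u hu, hA.lst u hu]
    constructor
    · rintro (⟨h1, h2⟩ | h1)
      · exact Or.inl ⟨by omega, h2⟩
      · exact Or.inr h1
    · rintro (⟨h1, h2⟩ | h1)
      · rcases h1.eq_or_lt with rfl | h1
        · exact Or.inr ⟨h2, hl⟩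
        · exact Or.inl ⟨h1, h2⟩
      · exact Or.inr h1
  have hv1 := h.one_le
  have h1c := h.one_lt
  refine ⟨by omega, hv, ?_, ?_, h1c, ?_, ?_, ?_, ?_, ?_, ?_, ?_, ?_, ?_⟩
  · intro u hu hu'
    rw [hA.fst u hu', hA.lst u hu']; exact h.range u hu hu'
  · rw [hA.parent 0 (by omega), h.parent_zero]
  · rw [hA.parent 1 h1c, h.parent_one]
  · rw [hA.kind 1 h1c, h.kind_one]
  · intro u hu hu'
    obtain ⟨h1, h2, h3, h4⟩ := h.child u hu hu'
    rw [hA.parent u hu', hA.kind u hu', hA.fst u hu', hA.lst u hu', hA.fst _ (by omega),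
      hA.lst _ (by omega)]
    exact ⟨h1, h2, by omega, h4⟩
  · have := h.size
    rw [Finset.sum_eq_sum_Ico_succ_bot hv, hl] at this
    rw [Finset.sum_congr rfl fun u hu => by
      rw [hA.fst u (Finset.mem_Ico.1 hu).2, hA.lst u (Finset.mem_Ico.1 hu).2]]
    omega
  · have := h.cost
    rw [Finset.sum_eq_sum_Ico_succ_bot hv, subtreeCost, hl, hF, zero_add] at this
    rw [Finset.sum_congr rfl fun u hu =>
      hA.arcCost h (Finset.mem_Ico.1 hu).1 (Finset.mem_Ico.1 hu).2,
      Finset.sum_congr (s₁ := Finset.Ico (v + 1) c) rfl fun u hu =>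
        hA.subtreeCost (Finset.mem_Ico.1 hu).2, this]
  · intro u w h1 h2 h3 h4
    rw [hA.fst u (by omega), hA.fst w h2, hA.lst u (by omega), hA.lst w h2]
    exact h.disjoint u w h1 h2 ((hact u (by omega)).1 h3) ((hact w h2).1 h4)
  · intro k h1 h2
    obtain ⟨u, h3, h4, h5⟩ := h.cover k h1 h2
    exact ⟨u, h3, (hact u h3).2 h4, by rwa [hA.fst u h3, hA.lst u h3]⟩
  · intro u h1 h2 h3
    rw [hA.fst u (by omega), hA.lst u (by omega)] at h3
    rw [hA.fst u (by omega)]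
    rcases (Nat.lt_succ_iff.1 h2).eq_or_lt with rfl | h2
    · exact ht
    · rw [ht', h.term u h1 h2 h3]
      -- Different leaves stand for different lifts in a window of `n` consecutive indices, so their
      -- residues differ and no entry of `term` is overwritten.
      have h4 := h.disjoint u v h2 hv (Or.inr ⟨h1, h3⟩) (Or.inl ⟨le_rfl, hv1⟩)
      have h5 := h.range u h1 (by omega)
      have h6 := h.range v hv1 hv
      intro h7
      have h8 : L.fst u ≡ L.fst v [MOD n] := h7
      rcases le_total (L.fst u) (L.fst v) with h9 | h9
      · have := Nat.le_of_dvd (by omega) ((Nat.modEq_iff_dvd' h9).1 h8)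
        omega
      · have := Nat.le_of_dvd (by omega) ((Nat.modEq_iff_dvd' h9).1 h8.symm)
        omega
  · intro u h1 h2 h3
    rw [hA.fst u (by omega), hA.lst u (by omega)] at h3
    have h4 : u < v := by
      rcases (Nat.lt_succ_iff.1 h2).eq_or_lt with rfl | h2
      · omega
      · exact h2
    obtain ⟨w, h5, h6, h7⟩ := h.inner u h1 h4 h3
    exact ⟨w, h5, h6, by rw [hA.parent w h6, h7]⟩

/-- Processing an inner node. -/
theorem IsPartial.split (h : L.IsPartial α t F a v c) (hv : v < c)
    (hA : Agree L L' c) (hk : L.fst v ≤ k) (hk' : k < L.lst v)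
    (hc : F (red n (L.fst v)) (red n (L.lst v)) = splitCost α t F (L.fst v) (L.lst v) k)
    (e1 : L'.fst c = L.fst v) (e2 : L'.lst c = k) (e3 : L'.parent c = v) (e4 : L'.kind c = 0)
    (e5 : L'.fst (c + 1) = k + 1) (e6 : L'.lst (c + 1) = L.lst v) (e7 : L'.parent (c + 1) = v)
    (e8 : L'.kind (c + 1) = 1) (ht : L'.term = L.term) : L'.IsPartial α t F a (v + 1) (c + 2) := by
  have hv1 := h.one_le
  have h1c := h.one_lt
  have hvr := h.range v hv1 hv
  have hact : ∀ u < c, L'.Active (v + 1) u → L.Active v u ∧ u ≠ v := fun u hu => by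
    unfold Active
    rw [hA.fst u hu, hA.lst u hu]
    rintro (⟨h1, h2⟩ | h1)
    · exact ⟨Or.inl ⟨by omega, h2⟩, by omega⟩
    · refine ⟨Or.inr h1, ?_⟩
      rintro rfl
      omega
  have hcase : ∀ u < c + 2, u < c ∨ u = c ∨ u = c + 1 := fun u hu => by omega
  refine ⟨by omega, by omega, ?_, ?_, by omega, ?_, ?_, ?_, ?_, ?_, ?_, ?_, ?_, ?_⟩
  · intro u hu hu'
    rcases hcase u hu' with hu' | rfl | rfl
    · rw [hA.fst u hu', hA.lst u hu']; exact h.range u hu hu'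
    · omega
    · omega
  · rw [hA.parent 0 (by omega), h.parent_zero]
  · rw [hA.parent 1 h1c, h.parent_one]
  · rw [hA.kind 1 h1c, h.kind_one]
  · intro u hu hu'
    rcases hcase u hu' with hu' | rfl | rfl
    · obtain ⟨h1, h2, h3, h4⟩ := h.child u hu hu'
      rw [hA.parent u hu', hA.kind u hu', hA.fst u hu', hA.lst u hu', hA.fst _ (by omega),
        hA.lst _ (by omega)]
      exact ⟨h1, h2, by omega, h4⟩
    · rw [e1, e2, e3, e4, hA.fst v hv, hA.lst v hv]
      exact ⟨hv1, hv, by omega, Or.inl ⟨rfl, rfl, hk'⟩⟩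
    · rw [e5, e6, e7, e8, hA.fst v hv, hA.lst v hv]
      exact ⟨hv1, by omega, by omega, Or.inr ⟨rfl, rfl, by omega⟩⟩
  · have := h.size
    rw [Finset.sum_eq_sum_Ico_succ_bot hv] at this
    rw [Finset.sum_Ico_succ_top (by omega), Finset.sum_Ico_succ_top (by omega),
      Finset.sum_congr (s₁ := Finset.Ico (v + 1) c) rfl fun u hu => by
        rw [hA.fst u (Finset.mem_Ico.1 hu).2, hA.lst u (Finset.mem_Ico.1 hu).2], e1, e2, e5, e6]
    omega
  · have := h.cost
    rw [Finset.sum_eq_sum_Ico_succ_bot hv, subtreeCost, hc] at this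
    have hp : L'.pos α t v = liftJoin α t (L.fst v) (L.lst v) := by
      rw [hA.pos hv, pos, if_neg (by omega)]
    have a1 : L'.arcCost α t c =
        segCost α (joinHeight α t (L.fst v) k) (joinHeight α t (L.fst v) (L.lst v)) := by
      rw [arcCost, e3, hp, pos, if_neg (by omega), e1, e2, IsInstance.norm_liftJoin,
        IsInstance.norm_liftJoin, segCost]
    have a2 : L'.arcCost α t (c + 1) =
        segCost α (joinHeight α t (k + 1) (L.lst v)) (joinHeight α t (L.fst v) (L.lst v)) := by
      rw [arcCost, e7, hp, pos, if_neg (by omega), e5, e6, IsInstance.norm_liftJoin,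
        IsInstance.norm_liftJoin, segCost]
      push_cast
      rfl
    rw [Finset.sum_Ico_succ_top (by omega), Finset.sum_Ico_succ_top (by omega),
      Finset.sum_Ico_succ_top (by omega), Finset.sum_Ico_succ_top (by omega), a1, a2,
      Finset.sum_congr rfl fun u hu =>
        hA.arcCost h (Finset.mem_Ico.1 hu).1 (Finset.mem_Ico.1 hu).2,
      Finset.sum_congr (s₁ := Finset.Ico (v + 1) c) rfl fun u hu =>
        hA.subtreeCost (Finset.mem_Ico.1 hu).2, subtreeCost, subtreeCost, e1, e2, e5, e6, ← this,
      splitCost]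
    push_cast
    ring
  · intro u w h1 h2 h3 h4
    have hvu : ∀ u, u < c → L'.Active (v + 1) u →
        L.lst u < L.fst v ∨ L.lst v < L.fst u := by
      intro u hu h5
      obtain ⟨h6, h7⟩ := hact u hu h5
      rcases h7.lt_or_gt with h7 | h7
      · exact h.disjoint u v h7 hv h6 (Or.inl ⟨le_rfl, hv1⟩)
      · exact (h.disjoint v u h7 hu (Or.inl ⟨le_rfl, hv1⟩) h6).symm
    rcases hcase w h2 with hw | rfl | rfl
    · rw [hA.fst u (by omega), hA.fst w hw, hA.lst u (by omega), hA.lst w hw]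
      exact h.disjoint u w h1 hw (hact u (by omega) h3).1 (hact w hw h4).1
    · have := hvu u h1 h3
      rw [hA.fst u h1, hA.lst u h1, e1, e2]
      omega
    · rcases hcase u (by omega) with hu | rfl | rfl
      · have := hvu u hu h3
        rw [hA.fst u hu, hA.lst u hu, e5, e6]
        omega
      · rw [e1, e2, e5, e6]
        omega
      · omega
  · intro x h1 h2
    obtain ⟨u, h3, h4, h5, h6⟩ := h.cover x h1 h2
    by_cases huv : u = v
    · subst huv
      rcases le_or_gt x k with hx | hx
      · exact ⟨c, by omega, Or.inl ⟨by omega, by omega⟩, by omega, by omega⟩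
      · exact ⟨c + 1, by omega, Or.inl ⟨by omega, by omega⟩, by omega, by omega⟩
    · refine ⟨u, by omega, ?_, by rwa [hA.fst u h3], by rwa [hA.lst u h3]⟩
      unfold Active at h4 ⊢
      rw [hA.fst u h3, hA.lst u h3]
      omega
  · intro u h1 h2 h3
    rw [hA.fst u (by omega), hA.lst u (by omega)] at h3
    rw [hA.fst u (by omega), ht]
    refine h.term u h1 ?_ h3
    rcases (Nat.lt_succ_iff.1 h2).eq_or_lt with rfl | h2
    · omega
    · exact h2
  · intro u h1 h2 h3
    rw [hA.fst u (by omega), hA.lst u (by omega)] at h3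
    rcases (Nat.lt_succ_iff.1 h2).eq_or_lt with rfl | h2
    · exact ⟨c, by omega, by omega, e3⟩
    · obtain ⟨w, h5, h6, h7⟩ := h.inner u h1 h2 h3
      exact ⟨w, h5, by omega, by rw [hA.parent w h6, h7]⟩

end Layout

end SpiralTrees
-- The spiral tree of a complete layout
namespace SpiralTrees

namespace Layout

variable {n : ℕ} [NeZero n] {α : ℝ} {t : Fin n → ℂ} {F : Fin n → Fin n → ℝ} {L : Layout} {a c : ℕ}

variable (α t) in
/-- The arc from a node to its parent. -/
def arc (L : Layout) (u : ℕ) : List (Bool × ℝ≥0∞) :=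
  if u = 0 then [] else if L.parent u = 0 then [(false, ⊤)] else
    segArc (decide (L.kind u = 1)) (L.height α t u) (L.height α t (L.parent u))

theorem pos_of_pos {u : ℕ} (hu : 1 ≤ u) : L.pos α t u = liftJoin α t (L.fst u) (L.lst u) :=
  if_neg (by omega)

theorem zero_notMem_arcTrace_arc (u : ℕ) : (0 : ℂ) ∉ arcTrace α (L.pos α t u) (L.arc α t u) := by
  unfold arc
  split_ifs with h1 h2
  · simp [arcTrace]
  · rw [pos_of_pos (by omega)]
    rintro (⟨s, -, -, h⟩ | h)
    · rw [liftJoin, spiral_cyl] at h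
      exact cyl_ne_zero _ _ _ h.symm
    · exact h
  · rw [pos_of_pos (by omega)]
    exact zero_notMem_arcTrace_segArc

theorem IsPartial.eq_one (h : L.IsPartial α t F a c c) {u : ℕ} (h1 : 1 ≤ u) (h2 : u < c)
    (h3 : L.parent u = 0) : u = 1 := by
  by_contra h4
  have := h.child u (by omega) h2
  omega

theorem IsPartial.height_lt (H : IsInstance α t) (h : L.IsPartial α t F a c c) {u : ℕ} (h1 : 2 ≤ u)
    (h2 : u < c) : L.height α t u < L.height α t (L.parent u) := by
  obtain ⟨-, -, -, ⟨-, h3, h4⟩ | ⟨-, h3, h4⟩⟩ := h.child u h1 h2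
  · rw [height, height, h3]
    exact H.joinHeight_lt_right (by omega)
  · rw [height, height, h3]
    exact H.joinHeight_lt_left (by omega)

theorem IsPartial.arcEnd_arc (H : IsInstance α t) (h : L.IsPartial α t F a c c) {u : ℕ}
    (hu : u < c) : arcEnd α (L.pos α t u) (L.arc α t u) = L.pos α t (L.parent u) := by
  unfold arc
  split_ifs with h1 h2
  · rw [h1, h.parent_zero]; rfl
  · rw [h2, pos, pos, if_pos rfl]
    simp [arcEnd, segEnd]
  · have h4 : 2 ≤ u := by
      by_contra h5
      obtain rfl : u = 1 := by omega
      exact h2 h.parent_one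
    obtain ⟨h5, -, -, ⟨h6, h7, h8⟩ | ⟨h6, h7, h8⟩⟩ := h.child u h4 hu
    · rw [pos_of_pos (by omega), pos_of_pos h5, height, height, h6, h7]
      exact arcEnd_right H (by omega)
    · rw [pos_of_pos (by omega), pos_of_pos h5, height, height, h6, h7]
      exact arcEnd_left H (by omega)

theorem IsPartial.pos_parent_ne (H : IsInstance α t) (h : L.IsPartial α t F a c c) {u : ℕ}
    (h1 : 1 ≤ u) (hu : u < c) : L.pos α t (L.parent u) ≠ L.pos α t u := by
  by_cases h2 : u = 1
  · subst h2
    rw [h.parent_one, pos, if_pos rfl, pos_of_pos le_rfl]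
    exact (cyl_ne_zero _ _ _).symm
  · have h3 := h.height_lt H (by omega) hu
    rw [pos_of_pos (h.child u (by omega) hu).1, pos_of_pos h1]
    exact liftJoin_ne h3

/-- Once all nodes have been processed, the only active ones are singletons; the covering property
then yields the leaf of any terminal, through its lift in the window from `a` to `a + n - 1`. -/
theorem IsPartial.exists_leaf (h : L.IsPartial α t F a c c) (i : Fin n) :
    ∃ u, 1 ≤ u ∧ u < c ∧ L.fst u = L.lst u ∧ L.fst u % n = i ∧ L.term i = u := by
  obtain ⟨k, h1, h2, h3⟩ : ∃ k, a ≤ k ∧ k < a + n ∧ k % n = i := by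
    have hi := i.2
    obtain ⟨x, hx⟩ : ∃ x : Fin n, ((red n a : Fin n) + x) = i := ⟨i - red n a, by abel⟩
    refine ⟨a + x.val, by omega, by omega, ?_⟩
    have e := red_val (n := n) ((a + x.val : ℕ) : ℤ)
    push_cast at e
    rw [red_add, red_coe, hx] at e
    exact_mod_cast e.symm
  obtain ⟨u, h4, h5, h6, h7⟩ := h.cover k h1 h2
  have h8 : 1 ≤ u ∧ L.fst u = L.lst u := by
    unfold Active at h5
    omega
  have h9 : L.fst u = k := by omega
  refine ⟨u, h8.1, h4, h8.2, by rw [h9, h3], ?_⟩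
  rw [← h.term u h8.1 h4 h8.2, h9, h3]

theorem IsPartial.term_lt (h : L.IsPartial α t F a c c) (i : Fin n) : L.term i < c := by
  obtain ⟨u, -, h1, -, -, h2⟩ := h.exists_leaf i
  omega

/-- The tree that a complete layout describes. -/
def IsPartial.tree (H : IsInstance α t) (h : L.IsPartial α t F a c c) : SpiralSubtree α t where
  V := Fin c
  fintypeV := inferInstance
  root := ⟨0, h.one_le⟩
  parent u := ⟨L.parent u, by
    rcases Nat.eq_zero_or_pos u.1 with h0 | h0
    · rw [h0, h.parent_zero]; exact h.one_le
    · exact (h.parent_lt h0 u.2).trans u.2⟩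
  parent_root := Fin.ext h.parent_zero
  parent_iterate := by
    rintro ⟨u, hu⟩
    induction u using Nat.strong_induction_on with
    | _ u ih =>
      rcases Nat.eq_zero_or_pos u with rfl | h0
      · exact ⟨0, rfl⟩
      · obtain ⟨k, hk⟩ := ih (L.parent u) (h.parent_lt h0 hu) ((h.parent_lt h0 hu).trans hu)
        exact ⟨k + 1, hk⟩
  pos u := L.pos α t u
  term i := ⟨L.term i, h.term_lt i⟩
  pos_term i := by
    obtain ⟨u, h1, h2, h3, h4, h5⟩ := h.exists_leaf i
    change L.pos α t (L.term i) = t i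
    rw [h5, pos_of_pos h1, ← h3, H.liftJoin_self]
    congr 1
    apply Fin.ext
    have := red_val (n := n) (L.fst u)
    rw [← h4]
    exact_mod_cast this
  leaf_term := by
    rintro ⟨v, hv⟩ hw
    rcases Nat.eq_zero_or_pos v with rfl | h0
    · exact absurd (Fin.ext h.parent_one) (hw ⟨1, h.one_lt⟩ (by simp))
    · rcases (h.range v h0 hv).2.1.eq_or_lt with h1 | h1
      · exact ⟨⟨L.fst v % n, Nat.mod_lt _ (NeZero.pos n)⟩, Fin.ext (h.term v h0 hv h1)⟩
      · obtain ⟨w, h2, h3, h4⟩ := h.inner v h0 hv h1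
        refine absurd (Fin.ext h4) (hw ⟨w, h3⟩ fun h5 => ?_)
        have := congrArg Fin.val h5
        simp only at this
        omega
  arc u := L.arc α t u
  arc_root := if_pos rfl
  arc_end u := h.arcEnd_arc H u.2
  arc_ne u hu := h.pos_parent_ne H (Nat.pos_of_ne_zero fun h0 => hu (Fin.ext h0)) u.2
  arc_avoid u := zero_notMem_arcTrace_arc u.1

theorem IsPartial.length_tree (H : IsInstance α t) (h : L.IsPartial α t F a c c) :
    (h.tree H).length = rootCost α t F a := by
  rw [SpiralSubtree.length_eq _ H.cos_pos, Finset.mul_sum]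
  have h1 := h.cost
  rw [Finset.Ico_self, Finset.sum_empty, add_zero] at h1
  rw [← h1]
  change ∑ u : Fin c, L.arcCost α t u = _
  rw [Fin.sum_univ_eq_sum_range (fun u => L.arcCost α t u), Finset.range_eq_Ico,
    Finset.sum_eq_sum_Ico_succ_bot h.one_le, arcCost, h.parent_zero, sub_self, mul_zero, zero_add]

theorem IsPartial.exists_arc (h : L.IsPartial α t F a c c) {u : ℕ} (h1 : 1 ≤ u) (hu : u < c) :
    ∃ (left : Bool) (τ : ℝ≥0∞), L.arc α t u = [(left, τ)] ∧ L.kind u = if left then 1 else 0 := by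
  unfold arc
  rw [if_neg (by omega)]
  by_cases h2 : L.parent u = 0
  · obtain rfl := h.eq_one h1 hu h2
    exact ⟨false, ⊤, if_pos h2, h.kind_one⟩
  · rw [if_neg h2]
    refine ⟨_, _, rfl, ?_⟩
    have h4 : 2 ≤ u := by
      by_contra h5
      obtain rfl : u = 1 := by omega
      exact h2 h.parent_one
    obtain ⟨-, -, -, ⟨h6, -⟩ | ⟨h6, -⟩⟩ := h.child u h4 hu <;> simp [h6]

end Layout

end SpiralTrees
namespace SpiralTrees

/-! ### The program: selecting the best starting terminal -/

namespace Program

abbrev lastExpr (i : IntExpr) : IntExpr := .sub (.add i (var 0)) (.const 1)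

abbrev rootExpr (i : IntExpr) : RealExpr :=
  .add (.cell 9 i (lastExpr i)) (.mul secExpr (radiusExpr i (lastExpr i)))

abbrev bestExpr : RealExpr := .cell 3 (.const 0) (.const 0)

def selectInit : Program :=
  .seq (.setReal 3 (.const 0) (.const 0) (rootExpr (.const 0)))
    (.seq (setVar 6 (.const 0)) (setVar 13 (.const 0)))

def selectStep : Program :=
  .seq (.cond (.ltReal (rootExpr (var 13)) bestExpr)
      (.seq (.setReal 3 (.const 0) (.const 0) (rootExpr (var 13))) (setVar 6 (var 13))) .skip)
    (setVar 13 (.add (var 13) (.const 1)))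

def selectProgram : Program := .seq selectInit (.loop (.ltInt (var 13) (var 0)) selectStep)

end Program

open Program

variable {n : ℕ} [NeZero n] {α : ℝ} {t : Fin n → ℂ} {F : Fin n → Fin n → ℝ}

attribute [local simp] Program.exec IntExpr.eval RealExpr.eval Test.holds State.int_setInt
  State.real_setInt State.int_setReal State.real_setReal

variable (α t F) in
/-- The state holds the best of the first `m` starting terminals and the corresponding length. -/
structure HasBest (m : ℕ) (s : State) : Prop where
  lt : s.int 6 0 0 < n
  eq : s.real 3 0 0 = rootCost α t F (s.int 6 0 0)
  le : ∀ i < m, s.real 3 0 0 ≤ rootCost α t F i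

theorem eval_rootExpr {s : State} (H : HasLifts α t n s) (hT : HasTable α t F n 0 s) {i : IntExpr}
    {a : ℕ} (hi : i.eval s = a) (ha : a < n) : (rootExpr i).eval s = rootCost α t F a := by
  have e : (lastExpr i).eval s = a + n - 1 := by simp [hi, H.size]
  rw [rootExpr, RealExpr.eval, RealExpr.eval, RealExpr.eval, eval_secExpr H,
    eval_radiusExpr H (by omega) (by omega), e, hi,
    (hT a (a + n - 1) (by omega) (by omega) (by omega) (by omega)).1, rootCost]

theorem selectStep_spec {s : State} {m : ℕ} (H : HasLifts α t n s) (hT : HasTable α t F n 0 s)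
    (hm : m < n) (hs : s.int 13 0 0 = m) (hB : HasBest α t F m s) :
    (selectStep.exec s).int 13 0 0 = m + 1 ∧ HasBest α t F (m + 1) (selectStep.exec s) := by
  have hv := eval_rootExpr H hT (i := var 13) (by simpa using hs) hm
  unfold selectStep
  generalize rootExpr (var 13) = E at hv
  obtain ⟨c1, c2, c3⟩ := hB
  by_cases hlt : rootCost α t F m < s.real 3 0 0
  · have hb : Test.holds s (.ltReal E bestExpr) := by simpa [hv] using hlt
    rw [exec_seq, exec_cond_of_holds hb]
    refine ⟨by simp [hs], ⟨by simpa [hs] using hm, by simp [hs, hv], fun i hi => ?_⟩⟩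
    have : rootCost α t F m ≤ rootCost α t F i := by
      rcases (Nat.lt_succ_iff.1 hi).eq_or_lt with rfl | h
      · exact le_rfl
      · exact hlt.le.trans (c3 i h)
    simpa [hv] using this
  · have hb : ¬ Test.holds s (.ltReal E bestExpr) := by simpa [hv] using hlt
    rw [exec_seq, exec_cond_of_not_holds hb]
    refine ⟨by simp [hs], ⟨by simpa using c1, by simpa using c2, fun i hi => ?_⟩⟩
    have : s.real 3 0 0 ≤ rootCost α t F i := by
      rcases (Nat.lt_succ_iff.1 hi).eq_or_lt with rfl | h
      · exact not_lt.1 hlt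
      · exact c3 i h
    simpa using this

def selectCost : ℕ := selectInit.bound + selectStep.bound + 40

theorem HasTable.of_frame {P : Program} {s s' : State} {d m : ℕ} (hT : HasTable α t F d m s)
    (h : P.Frame s s') (h5 : 5 ∉ P.intWrites) (h9 : 9 ∉ P.realWrites) : HasTable α t F d m s' :=
  hT.of_eq (h.2 9 h9) (h.1 5 h5)

theorem halts_selectProgram {s : State} (H : HasLifts α t n s) (hT : HasTable α t F n 0 s) :
    Halts selectProgram s (n * selectCost + selectCost) (HasBest α t F n) := by
  have hv := eval_rootExpr H hT (i := .const 0) rfl (NeZero.pos n)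
  refine Halts.mono (Halts.seq (Halts.exec (Q := fun s => s.int 13 0 0 = 0 ∧ HasBest α t F 0 s)
    (by decide) ⟨by simp [selectInit], ?_⟩)
    fun s₁ f₁ ⟨h1, h2⟩ => (Halts.loop (N := n) (M := selectStep.bound)
      (Inv := fun k s => s.int 13 0 0 = k ∧ k ≤ n ∧ HasBest α t F k s)
        ⟨h1, Nat.zero_le n, h2⟩ ?_)) ?_ ?_
  · unfold selectInit
    generalize rootExpr (.const 0) = E at hv
    exact ⟨by simpa using NeZero.pos n, by simp [hv], fun i hi => absurd hi (Nat.not_lt_zero i)⟩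
  · rintro k s' f ⟨e1, e2, e3⟩ hb
    replace hb : s'.int 13 0 0 < s'.int 0 0 0 := hb
    have H' := (H.of_frame f₁ (by decide) (by decide) (by decide) (by decide)).of_frame f
      (by decide) (by decide) (by decide) (by decide)
    rw [e1, H'.size] at hb
    have := selectStep_spec H' ((hT.of_frame f₁ (by decide) (by decide)).of_frame f (by decide)
      (by decide)) hb e1 e3
    exact ⟨hb, Halts.exec (by decide) ⟨this.1, hb, this.2⟩⟩
  · have h1 : (Test.ltInt (var 13) (var 0)).cost = 7 := rfl
    rw [h1, selectCost]
    have : n * (7 + selectStep.bound + 1) ≤ n * (selectInit.bound + selectStep.bound + 40) :=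
      Nat.mul_le_mul_left n (by omega)
    omega
  · rintro s' f ⟨k, ⟨e1, e2, e3⟩, hb⟩
    replace hb : ¬ s'.int 13 0 0 < s'.int 0 0 0 := hb
    have h0 : s'.int 0 0 0 = n := by rw [f.1 0 (by decide), H.size]
    rw [e1, h0] at hb
    obtain rfl : k = n := by omega
    exact e3

theorem HasBest.eq_treeCost (HI : IsInstance α t) {s : State} (hB : HasBest α t F n s) :
    s.real 3 0 0 = treeCost α t F := by
  have key : ∀ i : Fin n, F i (i - 1) + spiralDist α (joinPoint α t i (i - 1)) 0 =
      rootCost α t F i := fun i => by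
    have := rootCost_eq HI F (i : ℕ)
    rw [red_coe] at this
    have hi := NeZero.pos n
    rw [this, rootCost, red_coe, show (((i : ℕ) + n - 1 : ℕ) : ℤ) = (i : ℕ) + n - 1 by omega]
  refine le_antisymm (le_ciInf fun i => ?_) ?_
  · rw [key]; exact hB.le i i.2
  · rw [hB.eq, ← key ⟨_, hB.lt⟩]
    exact treeCost_le F _

/-! ### The program: writing the tree -/

namespace Program

abbrev fstExpr : IntExpr := .cell 7 (var 14) (.const 0)

abbrev lstExpr : IntExpr := .cell 8 (var 14) (.const 0)

abbrev cutOfExpr : IntExpr := .cell 5 fstExpr lstExpr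

/-- The polar angle of the join point of two lifts. -/
abbrev directionExpr (i j : IntExpr) : RealExpr :=
  .mul tanExpr (.div (.add (.cell 7 i (.const 0)) (.cell 8 j (.const 0))) (.ofInt (.const 2)))

/-- Node `0` is the root and node `1` the whole interval from the best starting terminal; its arc is
a right spiral followed all the way into the origin. -/
def treeInit : Program :=
  .seq (setVar 1 (.const 2))
  (.seq (.setInt 2 (.const 0) (.const 0) (.const 0))
  (.seq (.setReal 2 (.const 0) (.const 0) (.ofInt (.const 0)))
  (.seq (.setReal 2 (.const 0) (.const 1) (.ofInt (.const 0)))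
  (.seq (.setInt 2 (.const 1) (.const 0) (.const 0))
  (.seq (.setInt 2 (.const 1) (.const 1) (.const 0))
  (.seq (.setInt 7 (.const 1) (.const 0) (var 6))
  (.seq (.setInt 8 (.const 1) (.const 0) (lastExpr (var 6)))
  (setVar 14 (.const 1)))))))))

def positionStep : Program :=
  .seq (.setReal 2 (var 14) (.const 0)
      (.mul (radiusExpr fstExpr lstExpr) (.cos (directionExpr fstExpr lstExpr))))
    (.setReal 2 (var 14) (.const 1)
      (.mul (radiusExpr fstExpr lstExpr) (.sin (directionExpr fstExpr lstExpr))))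

def splitStep : Program :=
  .seq (.setInt 2 (var 1) (.const 0) (var 14))
  (.seq (.setInt 2 (var 1) (.const 1) (.const 0))
  (.seq (.setInt 7 (var 1) (.const 0) fstExpr)
  (.seq (.setInt 8 (var 1) (.const 0) cutOfExpr)
  (.seq (.setInt 2 (.add (var 1) (.const 1)) (.const 0) (var 14))
  (.seq (.setInt 2 (.add (var 1) (.const 1)) (.const 1) (.const 1))
  (.seq (.setInt 7 (.add (var 1) (.const 1)) (.const 0) (.add cutOfExpr (.const 1)))
  (.seq (.setInt 8 (.add (var 1) (.const 1)) (.const 0) lstExpr)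
  (setVar 1 (.add (var 1) (.const 2))))))))))

/-- A lift index is below `2n`, so its residue modulo `n` takes at most one subtraction. -/
def leafStep : Program :=
  .cond (.ltInt fstExpr (var 0)) (.setInt 3 fstExpr (.const 0) (var 14))
    (.setInt 3 (.sub fstExpr (var 0)) (.const 0) (var 14))

def nodeStep : Program :=
  .seq positionStep (.seq (.cond (.ltInt fstExpr lstExpr) splitStep leafStep)
    (setVar 14 (.add (var 14) (.const 1))))

/-- The nodes form a queue in order of creation: cell `14` is the node being processed and cell `1`
the number of nodes created. -/
def treeProgram : Program := .seq treeInit (.loop (.ltInt (var 14) (var 1)) nodeStep)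

end Program

/-- The layout that the state holds. -/
def State.layout (s : State) : Layout where
  fst u := s.int 7 u 0
  lst u := s.int 8 u 0
  parent u := s.int 2 u 0
  kind u := s.int 2 u 1
  term u := s.int 3 u 0

variable (α t F) in
/-- The state holds a partial tree in which the nodes below `v` have been processed. -/
structure HasTree (a v : ℕ) (s : State) : Prop where
  current : s.int 14 0 0 = v
  isPartial : s.layout.IsPartial α t F a v (s.int 1 0 0)
  re : ∀ u < v, s.real 2 u 0 = (s.layout.pos α t u).re
  im : ∀ u < v, s.real 2 u 1 = (s.layout.pos α t u).im

theorem treeInit_spec {s : State} (H : s.int 0 0 0 = n) :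
    HasTree α t F (s.int 6 0 0) 1 (treeInit.exec s) := by
  have e : (treeInit.exec s).int 1 0 0 = 2 := by simp [treeInit]
  refine ⟨by simp [treeInit], ?_, ?_, ?_⟩
  · rw [e]
    apply Layout.IsPartial.init <;> simp [State.layout, treeInit, H]
  · intro u hu
    obtain rfl : u = 0 := by omega
    simp [Layout.pos, treeInit]
  · intro u hu
    obtain rfl : u = 0 := by omega
    simp [Layout.pos, treeInit]

theorem cyl_re (h θ : ℝ) : (cyl α h θ).re = Real.exp (-h) * Real.cos (Real.tan α * θ) := by
  rw [cyl, Complex.exp_re]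
  simp [-Complex.ofReal_mul]

theorem cyl_im (h θ : ℝ) : (cyl α h θ).im = Real.exp (-h) * Real.sin (Real.tan α * θ) := by
  rw [cyl, Complex.exp_im]
  simp [-Complex.ofReal_mul]

theorem positionStep_spec {s : State} {v a b : ℕ} (H : HasLifts α t n s) (hv : s.int 14 0 0 = v)
    (hv1 : 1 ≤ v) (ha : s.int 7 v 0 = a) (hb : s.int 8 v 0 = b) (ha' : a < 2 * n) (hb' : b < 2 * n) :
    (positionStep.exec s).real 2 v 0 = (s.layout.pos α t v).re ∧
      (positionStep.exec s).real 2 v 1 = (s.layout.pos α t v).im ∧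
      ∀ u < v, ∀ j, (positionStep.exec s).real 2 u j = s.real 2 u j := by
  have e1 := H.fst_of_lt ha'
  have e2 := H.snd_of_lt hb'
  have e : -joinHeight α t a b = (liftX α t a - liftY α t b) / 2 := by unfold joinHeight; ring
  rw [Layout.pos_of_pos hv1, liftJoin, cyl_re, cyl_im, Real.tan_eq_sin_div_cos]
  refine ⟨?_, ?_, fun u hu j => ?_⟩
  · simp [positionStep, State.layout, hv, ha, hb, e1, e2, e, H.alpha]
  · simp [positionStep, State.layout, hv, ha, hb, e1, e2, e, H.alpha]
  · simp [positionStep, hv, hu.ne]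

theorem splitStep_spec {s : State} {a v : ℕ} (hP : s.layout.IsPartial α t F a v (s.int 1 0 0))
    (hT : HasTable α t F n 0 s) (ha : a < n) (hs : s.int 14 0 0 = v) (hv : v < s.int 1 0 0)
    (hlt : s.int 7 v 0 < s.int 8 v 0) :
    (splitStep.exec s).layout.IsPartial α t F a (v + 1) ((splitStep.exec s).int 1 0 0) ∧
      s.layout.Agree (splitStep.exec s).layout (s.int 1 0 0) := by
  have h1 := hP.range v hP.one_le hv
  simp only [State.layout] at h1
  obtain ⟨-, h2⟩ := hT (s.int 7 v 0) (s.int 8 v 0) hlt.le (by omega) (by omega) (by omega)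
  obtain ⟨h3, h4, h5⟩ := h2 hlt
  have hA : s.layout.Agree (splitStep.exec s).layout (s.int 1 0 0) := by
    constructor <;> intro u hu <;>
    · have e1 : u ≠ s.int 1 0 0 := by omega
      have e2 : u ≠ s.int 1 0 0 + 1 := by omega
      simp [State.layout, splitStep, e1, e2]
  have e : (splitStep.exec s).int 1 0 0 = s.int 1 0 0 + 2 := by simp [splitStep]
  have e1 : v ≠ s.int 1 0 0 := by omega
  refine ⟨?_, hA⟩
  rw [e]
  refine hP.split (k := s.int 5 (s.int 7 v 0) (s.int 8 v 0)) hv hA h3 h4 h5 ?_ ?_ ?_ ?_ ?_ ?_ ?_ ?_ ?_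
  all_goals simp [State.layout, splitStep, hs, e1]

theorem leafStep_spec {s : State} {a v : ℕ} (hP : s.layout.IsPartial α t F a v (s.int 1 0 0))
    (hF : ∀ i, F i i = 0) (h0 : s.int 0 0 0 = n) (ha : a < n) (hs : s.int 14 0 0 = v)
    (hv : v < s.int 1 0 0) (hlt : ¬ s.int 7 v 0 < s.int 8 v 0) :
    (leafStep.exec s).layout.IsPartial α t F a (v + 1) ((leafStep.exec s).int 1 0 0) ∧
      s.layout.Agree (leafStep.exec s).layout (s.int 1 0 0) := by
  have h1 := hP.range v hP.one_le hv
  simp only [State.layout] at h1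
  have key : leafStep.exec s = s.setInt 3 (s.int 7 v 0 % n) 0 v := by
    by_cases hn : s.int 7 v 0 < n
    · have hb : Test.holds s (.ltInt fstExpr (var 0)) := by simpa [hs, h0] using hn
      rw [leafStep, exec_cond_of_holds hb, Nat.mod_eq_of_lt hn]
      simp [hs]
    · have hb : ¬ Test.holds s (.ltInt fstExpr (var 0)) := by simpa [hs, h0] using hn
      rw [leafStep, exec_cond_of_not_holds hb, Nat.mod_eq_sub_mod (by omega),
        Nat.mod_eq_of_lt (by omega)]
      simp [hs, h0]
  have hA : s.layout.Agree (leafStep.exec s).layout (s.int 1 0 0) := by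
    rw [key]
    constructor <;> intro u hu <;> simp [State.layout]
  have e : (leafStep.exec s).int 1 0 0 = s.int 1 0 0 := by rw [key]; simp
  refine ⟨?_, hA⟩
  rw [e]
  refine hP.leaf hF hv hA (le_antisymm h1.2.1 (not_lt.1 hlt)) ?_ ?_
  · rw [key]; simp [State.layout]
  · intro i hi
    have hi' : i ≠ s.int 7 v 0 % n := hi
    rw [key]; simp [State.layout, hi']

end SpiralTrees
-- Correctness of the tree-writing loop, and total running time
namespace SpiralTrees

open Program

variable {n : ℕ} [NeZero n] {α : ℝ} {t : Fin n → ℂ} {F : Fin n → Fin n → ℝ}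

attribute [local simp] Program.exec IntExpr.eval RealExpr.eval Test.holds State.int_setInt
  State.real_setInt State.int_setReal State.real_setReal

theorem nodeStep_spec {s : State} {a v : ℕ} (H : HasLifts α t n s) (hT : HasTable α t F n 0 s)
    (hF : ∀ i, F i i = 0) (ha : a < n) (h : HasTree α t F a v s) (hv : v < s.int 1 0 0) :
    HasTree α t F a (v + 1) (nodeStep.exec s) := by
  obtain ⟨h1, h2, h3, h4⟩ := h
  have hr := h2.range v h2.one_le hv
  simp only [State.layout] at hr
  obtain ⟨p1, p2, p3⟩ := positionStep_spec (α := α) (t := t) H h1 h2.one_le rfl rfl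
    (by omega : s.int 7 v 0 < 2 * n) (by omega : s.int 8 v 0 < 2 * n)
  have hi : (positionStep.exec s).int = s.int := by simp [positionStep]
  have hT' : HasTable α t F n 0 (positionStep.exec s) :=
    hT.of_eq (by funext x y; simp [positionStep]) (by rw [hi])
  have hlay : (positionStep.exec s).layout = s.layout := by unfold State.layout; rw [hi]
  unfold nodeStep
  rw [exec_seq, exec_seq]
  generalize positionStep.exec s = s₁ at *
  rw [← hlay, ← hi] at h2
  rw [← hi] at hv h1
  obtain ⟨q1, q2, q3⟩ : (((Program.cond (.ltInt fstExpr lstExpr) splitStep leafStep).exec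
      s₁).layout.IsPartial α t F a (v + 1)
        (((Program.cond (.ltInt fstExpr lstExpr) splitStep leafStep).exec s₁).int 1 0 0)) ∧
      s₁.layout.Agree ((Program.cond (.ltInt fstExpr lstExpr) splitStep leafStep).exec s₁).layout
        (s₁.int 1 0 0) ∧
      ((Program.cond (.ltInt fstExpr lstExpr) splitStep leafStep).exec s₁).real = s₁.real ∧
      ((Program.cond (.ltInt fstExpr lstExpr) splitStep leafStep).exec s₁).int 14 0 0 = v := by
    by_cases hlt : s₁.int 7 v 0 < s₁.int 8 v 0
    · have hb : Test.holds s₁ (.ltInt fstExpr lstExpr) := by simpa [h1] using hlt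
      rw [exec_cond_of_holds hb]
      obtain ⟨g1, g2⟩ := splitStep_spec h2 hT' ha h1 hv hlt
      exact ⟨g1, g2, by simp [splitStep], by simp [splitStep, h1]⟩
    · have hb : ¬ Test.holds s₁ (.ltInt fstExpr lstExpr) := by simpa [h1] using hlt
      rw [exec_cond_of_not_holds hb]
      obtain ⟨g1, g2⟩ := leafStep_spec h2 hF (by rw [hi, H.size]) ha h1 hv hlt
      refine ⟨g1, g2, ?_, ?_⟩
      · unfold leafStep Program.exec
        split_ifs <;> simp
      · unfold leafStep Program.exec
        split_ifs <;> simp [h1]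
  generalize (Program.cond (.ltInt fstExpr lstExpr) splitStep leafStep).exec s₁ = s₂ at *
  obtain ⟨q3, q4⟩ := q3
  have hlay' : ((setVar 14 (.add (var 14) (.const 1))).exec s₂).layout = s₂.layout := by
    simp [State.layout]
  have hpos : ∀ u < v + 1, s₂.layout.pos α t u = s.layout.pos α t u := fun u hu => by
    rw [q2.pos (by omega), hlay]
  refine ⟨by simp [q4], ?_, fun u hu => ?_, fun u hu => ?_⟩
  · rw [hlay']
    simpa using q1
  · rw [hlay', hpos u hu]
    simp only [Program.exec, State.real_setInt, q3]
    rcases (Nat.lt_succ_iff.1 hu).eq_or_lt with rfl | h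
    · exact p1
    · rw [p3 u h]; exact h3 u h
  · rw [hlay', hpos u hu]
    simp only [Program.exec, State.real_setInt, q3]
    rcases (Nat.lt_succ_iff.1 hu).eq_or_lt with rfl | h
    · exact p2
    · rw [p3 u h]; exact h4 u h

def nodeCost : ℕ := treeInit.bound + nodeStep.bound + 40

theorem halts_treeProgram {s : State} {a : ℕ} (H : HasLifts α t n s) (hT : HasTable α t F n 0 s)
    (hF : ∀ i, F i i = 0) (ha : a < n) (hs : s.int 6 0 0 = a) :
    Halts treeProgram s (2 * n * nodeCost + nodeCost) fun s' =>
      HasTree α t F a (s'.int 1 0 0) s' := by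
  refine Halts.mono (Halts.seq (Halts.exec (Q := HasTree α t F a 1) (by decide)
    (hs ▸ treeInit_spec H.size))
    fun s₁ f₁ h1 => (Halts.loop (N := 2 * n) (M := nodeStep.bound)
      (Inv := fun k s => HasTree α t F a (k + 1) s) h1 ?_)) ?_ ?_
  · rintro k s' f e1 hb
    replace hb : s'.int 14 0 0 < s'.int 1 0 0 := hb
    have H' := (H.of_frame f₁ (by decide) (by decide) (by decide) (by decide)).of_frame f
      (by decide) (by decide) (by decide) (by decide)
    rw [e1.current] at hb
    -- The size invariant gives at most `2n` nodes, hence at most `2n` iterations.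
    have := e1.isPartial.size
    exact ⟨by omega, Halts.exec (by decide) (nodeStep_spec H'
      ((hT.of_frame f₁ (by decide) (by decide)).of_frame f (by decide) (by decide)) hF ha e1 hb)⟩
  · have h1 : (Test.ltInt (var 14) (var 1)).cost = 7 := rfl
    rw [h1, nodeCost]
    have : 2 * n * (7 + nodeStep.bound + 1) ≤ 2 * n * (treeInit.bound + nodeStep.bound + 40) :=
      Nat.mul_le_mul_left _ (by omega)
    omega
  · rintro s' - ⟨k, e1, hb⟩
    replace hb : ¬ s'.int 14 0 0 < s'.int 1 0 0 := hb
    rw [e1.current] at hb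
    have : k + 1 = s'.int 1 0 0 := le_antisymm e1.isPartial.le (not_lt.1 hb)
    rwa [← this]

theorem HasTree.exists_describes (HI : IsInstance α t) {s : State} {a : ℕ}
    (h : HasTree α t F a (s.int 1 0 0) s) (h3 : s.real 3 0 0 = rootCost α t F a) :
    ∃ T : SpiralSubtree α t, T.IsSpiralTree ∧ T.length = rootCost α t F a ∧ Describes s T := by
  refine ⟨h.isPartial.tree HI, (if_pos rfl : s.layout.pos α t 0 = 0), h.isPartial.length_tree HI,
    ⟨Equiv.refl _, fun v => rfl, fun v hv => ?_, fun v => ⟨h.re _ v.2, h.im _ v.2⟩, fun i => rfl⟩, ?_⟩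
  · exact h.isPartial.exists_arc (Nat.pos_of_ne_zero fun h0 => hv (Fin.ext h0)) v.2
  · rw [h3, h.isPartial.length_tree HI]

/-- The program that computes an optimal spiral tree. -/
def spiralTreeProgram : Program :=
  .seq liftProgram (.seq tableProgram (.seq selectProgram treeProgram))

theorem exists_runs_spiralTreeProgram : ∃ C : ℕ, ∀ (n : ℕ) [NeZero n] (α : ℝ) (t : Fin n → ℂ)
    (F : Fin n → Fin n → ℝ), IsInstance α t → IsRecurrence α t F →
      ∃ (s : State) (c : ℕ), Runs spiralTreeProgram (inputState α t) s c ∧ c ≤ C * n ^ 3 ∧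
        ∃ T : SpiralSubtree α t, T.IsSpiralTree ∧ T.length = treeCost α t F ∧ Describes s T := by
  -- Each lower power of `n` in the step count is at most `n ^ 3`, so the coefficients are added:
  -- the table contributes `2n³ + 2n²` steps of cost `stepCost`, and `300` absorbs the loop
  -- overheads.
  refine ⟨2 * liftCost + 4 * stepCost + 2 * selectCost + 3 * nodeCost + 300,
    fun n _ α t F HI hF => ?_⟩
  have hH : HasInput α t (inputState α t) := hasInput_inputState
  have hz : ∀ a i j, 2 ≤ a → (inputState α t).real a i j = 0 := fun a i j ha => by
    have h0 : a ≠ 0 := by omega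
    have h1 : a ≠ 1 := by omega
    simp [inputState, h0, h1]
  have key : Halts spiralTreeProgram (inputState α t) ((n * liftCost + liftCost) +
      ((n * (2 * n * (n * stepCost + stepCost + 40) + 60) + 60) +
        ((n * selectCost + selectCost) + (2 * n * nodeCost + nodeCost) + 1) + 1) + 1) fun s =>
      ∃ T : SpiralSubtree α t, T.IsSpiralTree ∧ T.length = treeCost α t F ∧ Describes s T := by
    refine Halts.seq (halts_liftProgram hH (by simp [inputState])) fun s₁ f₁ h1 =>
      Halts.seq (halts_tableProgram HI hF h1 fun a => ?_) fun s₂ f₂ h2 =>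
      Halts.seq (halts_selectProgram
        (h1.of_frame f₂ (by decide) (by decide) (by decide) (by decide)) h2) fun s₃ f₃ h3 =>
      (halts_treeProgram ((h1.of_frame f₂ (by decide) (by decide) (by decide) (by decide)).of_frame
        f₃ (by decide) (by decide) (by decide) (by decide)) (h2.of_frame f₃ (by decide) (by decide))
        hF.1 h3.lt rfl).mono le_rfl fun s₄ f₄ h4 => ?_
    · rw [f₁.2 9 (by decide), hz 9 a a (by omega)]
    · rw [← h3.eq_treeCost HI, h3.eq]
      exact h4.exists_describes HI (by rw [f₄.2 3 (by decide), h3.eq])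
  obtain ⟨s, c, h1, h2, h3⟩ := key
  refine ⟨s, c, h1, h2.trans ?_, h3⟩
  have hn : 1 ≤ n := NeZero.pos n
  have e1 : n ≤ n ^ 3 := Nat.le_self_pow (by omega) n
  have e2 : n ^ 2 ≤ n ^ 3 := Nat.pow_le_pow_right hn (by omega)
  have e3 : 1 ≤ n ^ 3 := hn.trans e1
  have m : ∀ x c : ℕ, x ≤ n ^ 3 → x * c ≤ c * n ^ 3 := fun x c hx => by
    rw [mul_comm c]; exact Nat.mul_le_mul_right c hx
  have a1 := m n liftCost e1
  have a2 := m 1 liftCost e3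
  have a3 := m (n ^ 2) stepCost e2
  have a4 := m n selectCost e1
  have a5 := m 1 selectCost e3
  have a6 := m n nodeCost e1
  have a7 := m 1 nodeCost e3
  nlinarith

end SpiralTrees
end

theorem mainTheorem8 :
    (∀ (n : ℕ) [NeZero n] (α : ℝ) (t : Fin n → ℂ), IsInstance α t →
      -- the intersection points `p_ij` exist and are unique, lie in the wedges, and `p_ii = t_i`
      (∀ i j, (∃! x, IsSpiralIntersection α (t i) (t j) x) ∧
        joinPoint α t i j ∈ wedge (t i) (t j)) ∧
      (∀ i, joinPoint α t i i = t i) ∧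
      -- leaf order of planar spiral trees
      (∀ T : SpiralSubtree α t, T.IsSpiralTree → T.IsPlanar →
        T.TerminalsAreLeaves ∧ T.LeafOrderFollows) ∧
      -- leaf order of optimal spiral trees
      (∀ T : SpiralSubtree α t, T.IsOptimal → T.TerminalsAreLeaves ∧ T.LeafOrderFollows) ∧
      -- the recurrence has exactly one solution `F`
      (∃! F : Fin n → Fin n → ℝ, IsRecurrence α t F) ∧
      ∀ F : Fin n → Fin n → ℝ, IsRecurrence α t F →
        -- `F i j` is the length of the optimal spiral subtree for `t_i, …, t_j` in the wedge
        (∀ i j, IsLeast {l : ℝ | ∃ T : SpiralSubtree α (cyclicRange t i j),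
          T.carrier ⊆ wedge (t i) (t j) ∧ T.length = l} (F i j)) ∧
        -- the length of the optimal spiral tree
        IsLeast {l : ℝ | ∃ T : SpiralSubtree α t, T.IsSpiralTree ∧ T.length = l}
          (⨅ i : Fin n, (F i (i - 1) + spiralDist α (joinPoint α t i (i - 1)) 0))) ∧
    -- an exact algorithm that runs in time `O(n ^ 3)`
    (∃ (P : Program) (C : ℕ), ∀ (n : ℕ) [NeZero n] (α : ℝ) (t : Fin n → ℂ), IsInstance α t →
      ∃ (s : State) (c : ℕ), Runs P (inputState α t) s c ∧ c ≤ C * n ^ 3 ∧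
        ∃ T : SpiralSubtree α t, T.IsOptimal ∧ Describes s T) := by
  obtain ⟨C, hC⟩ := exists_runs_spiralTreeProgram
  refine ⟨fun n _ α t H => ?_, spiralTreeProgram, C, fun n _ α t H => ?_⟩
  · obtain ⟨F₀, hF₀, -⟩ := existsUnique_isRecurrence α t
    have hplanar : ∀ T : SpiralSubtree α t, T.IsSpiralTree → T.IsPlanar →
        T.TerminalsAreLeaves ∧ T.LeafOrderFollows := fun T hT hP =>
      ⟨T.terminalsAreLeaves H hT, T.leafOrderFollows_of_isPlanar H hT hP⟩
    refine ⟨fun i j => ⟨H.existsUnique_isSpiralIntersection i j, H.joinPoint_mem_wedge i j⟩,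
      H.joinPoint_self, hplanar, fun T hT => hplanar T hT.1 ?_, existsUnique_isRecurrence α t,
      fun F hF => ⟨isLeast_wedge H hF, ?_⟩⟩
    -- The output of the program attains `treeCost`, while a tree that is not planar is strictly
    -- longer; so an optimal tree is planar and inherits the leaf order.
    · by_contra hP
      obtain ⟨-, -, -, -, T', hT', hl, -⟩ := hC n α t F₀ H hF₀
      exact absurd (hT.2 T' hT') (not_le.2 (hl ▸ treeCost_lt_length H hF₀ hT.1 hP))
    -- Attainment is again witnessed by the program's output.
    · obtain ⟨-, -, -, -, T', hT', hl, -⟩ := hC n α t F H hF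
      refine ⟨⟨T', hT', hl⟩, ?_⟩
      rintro l ⟨T, hT, rfl⟩
      exact treeCost_le_length H hF hT
  · obtain ⟨F, hF, -⟩ := existsUnique_isRecurrence α t
    obtain ⟨s, c, h1, h2, T, hT, hl, hd⟩ := hC n α t F H hF
    exact ⟨s, c, h1, h2, T, ⟨hT, fun T' hT' => hl ▸ treeCost_le_length H hF hT'⟩, hd⟩
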